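/- Let $k$ be a field of characteristic zero. By a dg coalgebra over $k$ we mean a $\mathbb{Z}$-graded (with differential of degree $-1$) coassociative, counital, coaugmented, conilpotent differential graded $k$-coalgebra; morphisms preserve all of this structure. Let $\mathrm{CDGC}_k$ be the full subcategory of those dg coalgebras whose coproduct is graded cocommutative. For a dg coalgebra $C$ with differential $\partial$ and coproduct $\Delta$, let $\Omega C=(T(s^{-1}\bar C),D)$ be its cobar construction, where $\bar C$ is the cokernel of the coaugmentation and $D$ is the derivation extending $-s^{-1}\partial s+(s^{-1}\otimes s^{-1})\Delta s$. A morphism $f$ of dg coalgebras is an $\Omega$-quasi-isomorphism if $\Omega f$ induces an isomorphism on homology, and two dg coalgebras are $\Omega$-quasi-isomorphic if they are connected by a finite zig-zag of $\Omega$-quasi-isomorphisms of dg coalgebras. For a pointed path-connected topological space $(X,b)$, let $C_*(X,b;k)$ be the dg coalgebra of pointed normalized singular chains: the $k$-module generated by the singular simplices $\Delta^n\to X$ that send all vertices of $\Delta^n$ to $b$, modulo degenerate simplices, with the usual boundary and the Alexander–Whitney coproduct. Let $\mathrm{Top}_*$ be either the category of all pointed path-connected topological spaces and base point preserving continuous maps,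 or its full subcategory on those spaces that are locally path-connected and semi-locally simply connected. Then in either case there is no functor $\mathcal{C}\colon \mathrm{Top}_*\to \mathrm{CDGC}_k$ such that for every $(X,b)\in\mathrm{Top}_*$ the dg coalgebra $\mathcal{C}(X,b)$ is $\Omega$-quasi-isomorphic to $C_*(X,b;k)$. -/

import Mathlib

open CategoryTheory Opposite
open scoped TensorProduct DirectSum

universe u v w

/-! ### Graded modules -/

section Graded

variable {k : Type u} [CommRing k] {V : Type v} [AddCommGroup V] [Module k V]

/-- The sign `(-1)^n` as a scalar. -/
def koszulSign (k : Type u) [CommRing k] (n : ℤ) : k := ((n.negOnePow : ℤ) : k)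

theorem koszulSign_add (m n : ℤ) : koszulSign k (m + n) = koszulSign k m * koszulSign k n := by
  simp [koszulSign, Int.negOnePow_add]

theorem koszulSign_mul_self (m : ℤ) : koszulSign k m * koszulSign k m = 1 := by
  rw [← koszulSign_add]
  simp [koszulSign, Int.negOnePow_even _ (Even.add_self m)]

@[simp] theorem koszulSign_zero : koszulSign k 0 = 1 := by simp [koszulSign]

theorem koszulSign_sub_one (m : ℤ) : koszulSign k (m - 1) = - koszulSign k m := by
  simp [koszulSign, Int.negOnePow_sub]

theorem koszulSign_natCast (m : ℕ) : koszulSign k (m : ℤ) = (-1) ^ m := by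
  induction m with
  | zero => simp
  | succ m ih =>
    have := koszulSign_sub_one (k := k) ((m : ℤ) + 1)
    rw [add_sub_cancel_right, ih] at this
    rw [pow_succ, this]
    push_cast
    ring

variable {gr : ℤ → Submodule k V}

/-- The identification of a graded module with the direct sum of its homogeneous parts. -/
noncomputable def sumEquiv (h : DirectSum.IsInternal gr) : (⨁ n, gr n) ≃ₗ[k] V :=
  LinearEquiv.ofBijective (DirectSum.coeLinearMap gr) h

theorem sumEquiv_symm_of_mem (h : DirectSum.IsInternal gr) {n : ℤ} {x : V} (hx : x ∈ gr n) :
    (sumEquiv h).symm x = DirectSum.lof k ℤ (fun i => gr i) n ⟨x, hx⟩ := by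
  rw [LinearEquiv.symm_apply_eq]
  exact (DirectSum.coeLinearMap_lof gr n ⟨x, hx⟩).symm

/-- The linear endomorphism of a graded module that multiplies each element of degree `n`
by `c n`. -/
noncomputable def scaleDeg (h : DirectSum.IsInternal gr) (c : ℤ → k) : V →ₗ[k] V :=
  (DirectSum.toModule k ℤ V (fun n => c n • (gr n).subtype)) ∘ₗ (sumEquiv h).symm.toLinearMap

theorem scaleDeg_of_mem (h : DirectSum.IsInternal gr) (c : ℤ → k) {n : ℤ} {x : V}
    (hx : x ∈ gr n) : scaleDeg h c x = c n • x := by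
  simp [scaleDeg, sumEquiv_symm_of_mem h hx]

/-- The sign involution `x ↦ (-1)^|x| x` of a graded module. -/
noncomputable def signInv (h : DirectSum.IsInternal gr) : V →ₗ[k] V := scaleDeg h (koszulSign k)

/-- The projection of a graded module onto its odd part. -/
noncomputable def oddPart (h : DirectSum.IsInternal gr) : V →ₗ[k] V :=
  scaleDeg h (fun n => if Odd n then 1 else 0)

/-- The graded interchange map `x ⊗ y ↦ (-1)^(|x||y|) y ⊗ x`
(see `gradedSwap_tmul`). -/
noncomputable def gradedSwap (h : DirectSum.IsInternal gr) : V ⊗[k] V →ₗ[k] V ⊗[k] V :=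
  (TensorProduct.comm k V V).toLinearMap ∘ₗ
    (LinearMap.id - (2 : k) • TensorProduct.map (oddPart h) (oddPart h))

theorem gradedSwap_tmul (h : DirectSum.IsInternal gr) {m n : ℤ} {x y : V}
    (hx : x ∈ gr m) (hy : y ∈ gr n) :
    gradedSwap h (x ⊗ₜ y) = koszulSign k (m * n) • (y ⊗ₜ[k] x) := by
  have hs : koszulSign k (m * n) = 1 - 2 * ((if Odd m then 1 else 0) * (if Odd n then 1 else 0)) := by
    by_cases hm : Odd m
    · by_cases hn : Odd n
      · simp only [koszulSign, Int.negOnePow_odd _ (hm.mul hn), hm, hn, if_true]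
        push_cast
        ring
      · have hn' : Even n := Int.not_odd_iff_even.mp hn
        simp [koszulSign, Int.negOnePow_even _ (hn'.mul_left m), hn]
    · have hm' : Even m := Int.not_odd_iff_even.mp hm
      simp [koszulSign, Int.negOnePow_even _ (hm'.mul_right n), hm]
  simp only [gradedSwap, oddPart, LinearMap.comp_apply, LinearMap.sub_apply, LinearMap.smul_apply,
    LinearMap.id_apply, TensorProduct.map_tmul, scaleDeg_of_mem h _ hx, scaleDeg_of_mem h _ hy,
    TensorProduct.smul_tmul_smul, map_sub, map_smul, LinearEquiv.coe_coe, TensorProduct.comm_tmul,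
    hs, sub_smul, one_smul, mul_smul]

/-- The degree `n` part of `V ⊗ V` for a graded module `V`. -/
def tensorDeg (gr : ℤ → Submodule k V) (n : ℤ) : Submodule k (V ⊗[k] V) :=
  ⨆ p : ℤ, LinearMap.range (TensorProduct.mapIncl (gr p) (gr (n - p)))

theorem graded_induction (h : DirectSum.IsInternal gr) {P : V → Prop}
    (hom : ∀ n x, x ∈ gr n → P x) (add : ∀ x y, P x → P y → P (x + y)) (x : V) : P x := by
  have hx : x ∈ ⨆ i, gr i := by rw [h.submodule_iSup_eq_top]; trivial
  induction hx using Submodule.iSup_induction' with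
  | mem i x hx => exact hom i x hx
  | zero => exact hom 0 0 (zero_mem _)
  | add x y _ _ h1 h2 => exact add x y h1 h2

theorem tmul_mem_tensorDeg {p q n : ℤ} (hn : p + q = n) {x y : V} (hx : x ∈ gr p) (hy : y ∈ gr q) :
    x ⊗ₜ[k] y ∈ tensorDeg gr n := by
  obtain rfl : q = n - p := by omega
  exact Submodule.mem_iSup_of_mem p ⟨(⟨x, hx⟩ : gr p) ⊗ₜ (⟨y, hy⟩ : gr (n - p)), rfl⟩

theorem tensorDeg_induction {n : ℤ} {P : ∀ t : V ⊗[k] V, t ∈ tensorDeg gr n → Prop}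
    (hom : ∀ p x y (hx : x ∈ gr p) (hy : y ∈ gr (n - p)),
      P (x ⊗ₜ y) (tmul_mem_tensorDeg (by omega) hx hy))
    (h0 : P 0 (zero_mem _))
    (add : ∀ x y hx hy, P x hx → P y hy → P (x + y) (add_mem hx hy))
    {t : V ⊗[k] V} (ht : t ∈ tensorDeg gr n) : P t ht := by
  have key : ∃ h, P t h := by
    induction ht using Submodule.iSup_induction' with
    | mem i x hx =>
      obtain ⟨y, rfl⟩ := hx
      induction y using TensorProduct.induction_on with
      | zero => exact ⟨by rw [map_zero]; exact zero_mem _, by simpa using h0⟩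
      | tmul a b => exact ⟨_, hom i _ _ a.2 b.2⟩
      | add a b ha hb =>
        obtain ⟨ha1, ha2⟩ := ha
        obtain ⟨hb1, hb2⟩ := hb
        simp only [map_add]
        exact ⟨add_mem ha1 hb1, add _ _ _ _ ha2 hb2⟩
    | zero => exact ⟨_, h0⟩
    | add x y _ _ h1 h2 => exact ⟨_, add x y _ _ h1.2 h2.2⟩
  exact key.2

theorem isInternal_of_decomp (δ : V →ₗ[k] ⨁ n, gr n)
    (h1 : ∀ x, DirectSum.coeLinearMap gr (δ x) = x)
    (h2 : ∀ n (x : V) (hx : x ∈ gr n), δ x = DirectSum.lof k ℤ (fun i => gr i) n ⟨x, hx⟩) :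
    DirectSum.IsInternal gr := by
  have : DirectSum.Decomposition gr := DirectSum.Decomposition.ofLinearMap gr δ
    (LinearMap.ext h1) (by
      ext n x
      simp [h2 n x.1 x.2])
  exact DirectSum.Decomposition.isInternal gr

theorem isInternal_map_of_surjective {W : Type w} [AddCommGroup W] [Module k W]
    (h : DirectSum.IsInternal gr) {e : V} {m : ℤ} (he : e ∈ gr m)
    (q : V →ₗ[k] W) (hq : Function.Surjective q) (hk : LinearMap.ker q = Submodule.span k {e}) :
    DirectSum.IsInternal (fun n => (gr n).map q) := by
  let φ : (⨁ n, gr n) →ₗ[k] ⨁ n, (gr n).map q :=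
    DirectSum.toModule k ℤ _ (fun n => DirectSum.lof k ℤ (fun i => (gr i).map q) n ∘ₗ
      (q.restrict (fun x hx => Submodule.mem_map_of_mem hx) : gr n →ₗ[k] (gr n).map q))
  let ψ : V →ₗ[k] ⨁ n, (gr n).map q := φ ∘ₗ (sumEquiv h).symm.toLinearMap
  have key : ∀ n (x : V) (hx : x ∈ gr n), ψ x =
      DirectSum.lof k ℤ (fun i => (gr i).map q) n ⟨q x, Submodule.mem_map_of_mem hx⟩ := by
    intro n x hx
    simp only [ψ, φ, LinearMap.comp_apply, LinearEquiv.coe_coe, sumEquiv_symm_of_mem h hx,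
      DirectSum.toModule_lof]
    rfl
  have he0 : q e = 0 := by
    rw [← LinearMap.mem_ker, hk]; exact Submodule.mem_span_singleton_self e
  have hz : LinearMap.ker q ≤ LinearMap.ker ψ := by
    rw [hk, Submodule.span_singleton_le_iff_mem, LinearMap.mem_ker, key m e he]
    simp only [he0]
    exact map_zero _
  let δ : W →ₗ[k] ⨁ n, (gr n).map q :=
    (Submodule.liftQ _ ψ hz) ∘ₗ (q.quotKerEquivOfSurjective hq).symm.toLinearMap
  have hδ : ∀ x, δ (q x) = ψ x := by
    intro x
    have : (q.quotKerEquivOfSurjective hq).symm (q x) = Submodule.Quotient.mk x := by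
      rw [LinearEquiv.symm_apply_eq]; rfl
    simp only [δ, LinearMap.comp_apply, LinearEquiv.coe_coe, this, Submodule.liftQ_apply]
  refine isInternal_of_decomp δ ?_ ?_
  · intro x
    obtain ⟨x, rfl⟩ := hq x
    rw [hδ]
    induction x using graded_induction h with
    | hom n x hx => rw [key n x hx, DirectSum.coeLinearMap_lof]
    | add x y h1 h2 => rw [map_add, map_add, map_add, h1, h2]
  · rintro n _ ⟨x, hx, rfl⟩
    rw [hδ]
    exact key n x hx

end Graded

/-! ### Coaugmented coalgebras -/

section Reduced

variable {k : Type u} [CommRing k] {C : Type v} [AddCommGroup C] [Module k C] [Coalgebra k C]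

/-- The coproduct induced on the cokernel of the coaugmentation determined by `e`. -/
noncomputable def reducedComul (e : C) (he : IsGroupLikeElem k e) :
    (C ⧸ Submodule.span k {e}) →ₗ[k]
      (C ⧸ Submodule.span k {e}) ⊗[k] (C ⧸ Submodule.span k {e}) :=
  Submodule.liftQ _ (TensorProduct.map (Submodule.mkQ _) (Submodule.mkQ _) ∘ₗ Coalgebra.comul) (by
    rw [Submodule.span_singleton_le_iff_mem, LinearMap.mem_ker, LinearMap.comp_apply,
      he.comul_eq_tmul_self, TensorProduct.map_tmul]
    have : (Submodule.span k {e}).mkQ e = 0 := by simp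
    rw [this, TensorProduct.tmul_zero])

theorem reducedComul_mkQ (e : C) (he : IsGroupLikeElem k e) (x : C) :
    reducedComul e he ((Submodule.span k {e}).mkQ x) =
      TensorProduct.map (Submodule.mkQ _) (Submodule.mkQ _) (Coalgebra.comul (R := k) x) := rfl

/-- The `n`-fold iterated reduced coproduct `C̄ → C̄^{⊗ (n + 1)}`, where `C̄^{⊗ (n + 1)}` is
regarded as a direct summand of the tensor algebra of `C̄`. -/
noncomputable def iterReducedComul (e : C) (he : IsGroupLikeElem k e) :
    ℕ → (C ⧸ Submodule.span k {e}) →ₗ[k] TensorAlgebra k (C ⧸ Submodule.span k {e})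
  | 0 => TensorAlgebra.ι k
  | n + 1 => LinearMap.mul' k _ ∘ₗ
      TensorProduct.map (TensorAlgebra.ι k) (iterReducedComul e he n) ∘ₗ reducedComul e he

theorem reducedComul_coassoc (e : C) (he : IsGroupLikeElem k e) (x : C ⧸ Submodule.span k {e}) :
    TensorProduct.assoc k _ _ _ (TensorProduct.map (reducedComul e he) LinearMap.id
      (reducedComul e he x)) =
    TensorProduct.map LinearMap.id (reducedComul e he) (reducedComul e he x) := by
  obtain ⟨x, rfl⟩ := Submodule.mkQ_surjective _ x
  set q := (Submodule.span k {e}).mkQ with hq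
  rw [reducedComul_mkQ]
  have h1 : ∀ t : C ⊗[k] C, TensorProduct.assoc k _ _ _
      (TensorProduct.map (reducedComul e he) LinearMap.id (TensorProduct.map q q t)) =
      TensorProduct.map q (TensorProduct.map q q)
        (TensorProduct.assoc k _ _ _ (Coalgebra.comul.rTensor C t)) := by
    intro t
    induction t using TensorProduct.induction_on with
    | zero => simp
    | add a b ha hb => simp only [map_add, ha, hb]
    | tmul a b =>
      simp only [TensorProduct.map_tmul, LinearMap.rTensor_tmul, LinearMap.id_apply, hq,
        reducedComul_mkQ]
      generalize (Coalgebra.comul a : C ⊗[k] C) = s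
      induction s using TensorProduct.induction_on with
      | zero => simp
      | add c d hc hd => simp only [map_add, TensorProduct.add_tmul, hc, hd]
      | tmul c d => simp
  have h2 : ∀ t : C ⊗[k] C,
      TensorProduct.map LinearMap.id (reducedComul e he) (TensorProduct.map q q t) =
      TensorProduct.map q (TensorProduct.map q q) (Coalgebra.comul.lTensor C t) := by
    intro t
    induction t using TensorProduct.induction_on with
    | zero => simp
    | add a b ha hb => simp only [map_add, ha, hb]
    | tmul a b =>
      simp only [TensorProduct.map_tmul, LinearMap.lTensor_tmul, LinearMap.id_apply, hq,
        reducedComul_mkQ]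
  rw [h1, h2, Coalgebra.coassoc_apply]

end Reduced

/-- A differential graded coalgebra over `k`: `ℤ`-graded, with differential of degree `-1`,
coassociative, counital, coaugmented (by the degree-zero group-like cycle `one`)
and conilpotent. -/
structure DGC (k : Type u) [CommRing k] where
  carrier : Type v
  [addCommGroup : AddCommGroup carrier]
  [module : Module k carrier]
  [coalgebra : Coalgebra k carrier]
  gr : ℤ → Submodule k carrier
  isInternal : DirectSum.IsInternal gr
  d : carrier →ₗ[k] carrier
  d_mem : ∀ n x, x ∈ gr n → d x ∈ gr (n - 1)
  d_d : ∀ x, d (d x) = 0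
  comul_mem : ∀ n x, x ∈ gr n → Coalgebra.comul (R := k) x ∈ tensorDeg gr n
  counit_of_mem : ∀ n x, n ≠ 0 → x ∈ gr n → Coalgebra.counit (R := k) x = 0
  comul_d : ∀ x, Coalgebra.comul (R := k) (d x) =
    TensorProduct.map d LinearMap.id (Coalgebra.comul (R := k) x) +
      TensorProduct.map (signInv isInternal) d (Coalgebra.comul (R := k) x)
  counit_d : ∀ x, Coalgebra.counit (R := k) (d x) = 0
  one : carrier
  one_groupLike : IsGroupLikeElem k one
  one_mem : one ∈ gr 0
  d_one : d one = 0
  conilpotent : ∀ x, ∃ n, iterReducedComul one one_groupLike n x = 0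

attribute [instance] DGC.addCommGroup DGC.module DGC.coalgebra

namespace DGC

variable {k : Type u} [CommRing k]

/-- Morphisms of coaugmented dg coalgebras. -/
@[ext] structure Hom (C D : DGC.{u, v} k) where
  toLinearMap : C.carrier →ₗ[k] D.carrier
  map_mem : ∀ n x, x ∈ C.gr n → toLinearMap x ∈ D.gr n
  map_d : ∀ x, toLinearMap (C.d x) = D.d (toLinearMap x)
  map_comul : ∀ x, Coalgebra.comul (R := k) (toLinearMap x) =
    TensorProduct.map toLinearMap toLinearMap (Coalgebra.comul (R := k) x)
  map_counit : ∀ x, Coalgebra.counit (R := k) (toLinearMap x) = Coalgebra.counit (R := k) x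
  map_one : toLinearMap C.one = D.one

instance : Category (DGC.{u, v} k) where
  Hom := Hom
  id C :=
    { toLinearMap := LinearMap.id
      map_mem := fun _ _ h => h
      map_d := fun _ => rfl
      map_comul := fun x => by simp
      map_counit := fun _ => rfl
      map_one := rfl }
  comp f g :=
    { toLinearMap := g.toLinearMap ∘ₗ f.toLinearMap
      map_mem := fun n x h => g.map_mem n _ (f.map_mem n x h)
      map_d := fun x => by simp [f.map_d, g.map_d]
      map_comul := fun x => by
        rw [LinearMap.comp_apply, g.map_comul, f.map_comul, TensorProduct.map_comp,
          LinearMap.comp_apply]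
      map_counit := fun x => by simp [f.map_counit, g.map_counit]
      map_one := by simp [f.map_one, g.map_one] }

/-- Graded cocommutativity: the coproduct is invariant under the graded interchange. -/
def IsCocommutative : ObjectProperty (DGC.{u, v} k) := fun C =>
  ∀ x, gradedSwap C.isInternal (Coalgebra.comul (R := k) x) = Coalgebra.comul (R := k) x

end DGC

/-- The category of cocommutative dg coalgebras, a full subcategory of dg coalgebras. -/
abbrev CDGC (k : Type u) [CommRing k] := (DGC.IsCocommutative (k := k)).FullSubcategory

/-- A unital augmented differential graded associative algebra over `k`, `ℤ`-graded with
differential of degree `-1`. -/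
structure DGA (k : Type u) [CommRing k] where
  carrier : Type v
  [ring : Ring carrier]
  [algebra : Algebra k carrier]
  gr : ℤ → Submodule k carrier
  isInternal : DirectSum.IsInternal gr
  one_mem : 1 ∈ gr 0
  mul_mem : ∀ m n a b, a ∈ gr m → b ∈ gr n → a * b ∈ gr (m + n)
  d : carrier →ₗ[k] carrier
  d_mem : ∀ n a, a ∈ gr n → d a ∈ gr (n - 1)
  d_d : ∀ a, d (d a) = 0
  leibniz : ∀ n a b, a ∈ gr n → d (a * b) = d a * b + koszulSign k n • (a * d b)
  aug : carrier →ₐ[k] k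
  aug_of_mem : ∀ n a, n ≠ 0 → a ∈ gr n → aug a = 0
  aug_d : ∀ a, aug (d a) = 0

attribute [instance] DGA.ring DGA.algebra

namespace DGA

variable {k : Type u} [CommRing k]

/-- Morphisms of augmented dg algebras. -/
@[ext] structure Hom (A B : DGA.{u, v} k) where
  toAlgHom : A.carrier →ₐ[k] B.carrier
  map_mem : ∀ n a, a ∈ A.gr n → toAlgHom a ∈ B.gr n
  map_d : ∀ a, toAlgHom (A.d a) = B.d (toAlgHom a)
  map_aug : ∀ a, B.aug (toAlgHom a) = A.aug a

instance : Category (DGA.{u, v} k) where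
  Hom := Hom
  id A :=
    { toAlgHom := AlgHom.id k _
      map_mem := fun _ _ h => h
      map_d := fun _ => rfl
      map_aug := fun _ => rfl }
  comp f g :=
    { toAlgHom := g.toAlgHom.comp f.toAlgHom
      map_mem := fun n x h => g.map_mem n _ (f.map_mem n x h)
      map_d := fun x => by simp [f.map_d, g.map_d]
      map_aug := fun x => by simp [f.map_aug, g.map_aug] }

/-- Cycles of degree `n`. -/
def cycles (A : DGA.{u, v} k) (n : ℤ) : Submodule k A.carrier := A.gr n ⊓ LinearMap.ker A.d

/-- Boundaries of degree `n`. -/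
def boundaries (A : DGA.{u, v} k) (n : ℤ) : Submodule k A.carrier := (A.gr (n + 1)).map A.d

/-- The homology of a dg algebra in degree `n`. -/
abbrev homology (A : DGA.{u, v} k) (n : ℤ) : Type v :=
  A.cycles n ⧸ (A.boundaries n).submoduleOf (A.cycles n)

/-- The map induced by a morphism of dg algebras on homology in degree `n`. -/
def homologyMap {A B : DGA.{u, v} k} (f : A ⟶ B) (n : ℤ) : A.homology n →ₗ[k] B.homology n :=
  Submodule.mapQ _ _
    ((Hom.toAlgHom f).toLinearMap.restrict (p := A.cycles n) (q := B.cycles n) (by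
      rintro x ⟨hx, hd⟩
      refine ⟨Hom.map_mem f n x hx, ?_⟩
      have hd : A.d x = 0 := hd
      change B.d (Hom.toAlgHom f x) = 0
      rw [← Hom.map_d f, hd, map_zero]))
    (by
      rintro ⟨x, hx⟩ ⟨y, hy, hyx⟩
      refine ⟨Hom.toAlgHom f y, Hom.map_mem f _ y hy, ?_⟩
      rw [← Hom.map_d f, hyx]
      rfl)

/-- A quasi-isomorphism is a morphism inducing isomorphisms on homology in all degrees. -/
def IsQuasiIso {A B : DGA.{u, v} k} (f : A ⟶ B) : Prop :=
  ∀ n, Function.Bijective (homologyMap f n)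

end DGA

/-! ### The cobar construction -/

namespace DGC

variable {k : Type u} [CommRing k]

section Objects

variable (C : DGC.{u, v} k)

/-- The cokernel of the coaugmentation. -/
abbrev bar : Type v := C.carrier ⧸ Submodule.span k {C.one}

/-- The projection onto the cokernel of the coaugmentation. -/
abbrev proj : C.carrier →ₗ[k] C.bar := (Submodule.span k {C.one}).mkQ

theorem proj_one : C.proj C.one = 0 := by simp [proj]

/-- The grading of the cokernel of the coaugmentation. -/
def barGr (n : ℤ) : Submodule k C.bar := (C.gr n).map C.proj

theorem barGr_isInternal : DirectSum.IsInternal C.barGr :=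
  isInternal_map_of_surjective C.isInternal C.one_mem C.proj (Submodule.mkQ_surjective _)
    (Submodule.ker_mkQ _)

/-- The differential of the cokernel of the coaugmentation. -/
def barD : C.bar →ₗ[k] C.bar :=
  Submodule.mapQ _ _ C.d (by
    rw [Submodule.span_singleton_le_iff_mem, Submodule.mem_comap, C.d_one]
    exact zero_mem _)

theorem barD_proj (x : C.carrier) : C.barD (C.proj x) = C.proj (C.d x) := rfl

/-- The coproduct of the cokernel of the coaugmentation. -/
noncomputable def barComul : C.bar →ₗ[k] C.bar ⊗[k] C.bar := reducedComul C.one C.one_groupLike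

theorem barComul_proj (x : C.carrier) : C.barComul (C.proj x) =
    TensorProduct.map C.proj C.proj (Coalgebra.comul (R := k) x) := rfl

/-- The sign involution of the cokernel of the coaugmentation. -/
noncomputable def barSign : C.bar →ₗ[k] C.bar := signInv C.barGr_isInternal

theorem barSign_of_mem {n : ℤ} {x : C.bar} (hx : x ∈ C.barGr n) :
    C.barSign x = koszulSign k n • x := scaleDeg_of_mem _ _ hx

theorem barSign_proj (x : C.carrier) :
    C.barSign (C.proj x) = C.proj (signInv C.isInternal x) := by
  induction x using graded_induction C.isInternal with
  | hom n x hx =>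
    rw [C.barSign_of_mem (Submodule.mem_map_of_mem hx), signInv, scaleDeg_of_mem _ _ hx, map_smul]
  | add x y h1 h2 => simp only [map_add, h1, h2]

theorem barD_mem {n : ℤ} {x : C.bar} (hx : x ∈ C.barGr n) : C.barD x ∈ C.barGr (n - 1) := by
  obtain ⟨x, hx, rfl⟩ := hx
  exact Submodule.mem_map_of_mem (C.d_mem n x hx)

theorem barD_barD (x : C.bar) : C.barD (C.barD x) = 0 := by
  obtain ⟨x, rfl⟩ := Submodule.mkQ_surjective _ x
  rw [barD_proj, barD_proj, C.d_d, map_zero]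

theorem barComul_mem {n : ℤ} {x : C.bar} (hx : x ∈ C.barGr n) :
    C.barComul x ∈ tensorDeg C.barGr n := by
  obtain ⟨x, hx, rfl⟩ := hx
  rw [barComul_proj]
  have ht := C.comul_mem n x hx
  generalize (Coalgebra.comul x : C.carrier ⊗[k] C.carrier) = t at ht ⊢
  induction ht using tensorDeg_induction with
  | hom p a b ha hb =>
    rw [TensorProduct.map_tmul]
    exact tmul_mem_tensorDeg (by omega) (Submodule.mem_map_of_mem ha) (Submodule.mem_map_of_mem hb)
  | h0 => rw [map_zero]; exact zero_mem _
  | add s t _ _ h1 h2 => rw [map_add]; exact add_mem h1 h2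

theorem barComul_barD (x : C.bar) : C.barComul (C.barD x) =
    TensorProduct.map C.barD LinearMap.id (C.barComul x) +
      TensorProduct.map C.barSign C.barD (C.barComul x) := by
  obtain ⟨x, rfl⟩ := Submodule.mkQ_surjective _ x
  rw [barD_proj, barComul_proj, barComul_proj, C.comul_d, map_add]
  generalize (Coalgebra.comul x : C.carrier ⊗[k] C.carrier) = t
  induction t using TensorProduct.induction_on with
  | zero => simp only [map_zero]
  | tmul a b => simp only [TensorProduct.map_tmul, barD_proj, barSign_proj, LinearMap.id_apply]
  | add s t hs ht =>
    simp only [map_add]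
    rw [add_add_add_comm, hs, ht, add_add_add_comm]

theorem barSign_barSign (x : C.bar) : C.barSign (C.barSign x) = x := by
  induction x using graded_induction C.barGr_isInternal with
  | hom n x hx =>
    rw [C.barSign_of_mem hx, map_smul, C.barSign_of_mem hx, smul_smul, koszulSign_mul_self, one_smul]
  | add x y h1 h2 => rw [map_add, map_add, h1, h2]

theorem barD_barSign (x : C.bar) : C.barD (C.barSign x) = - C.barSign (C.barD x) := by
  induction x using graded_induction C.barGr_isInternal with
  | hom n x hx =>
    rw [C.barSign_of_mem hx, C.barSign_of_mem (C.barD_mem hx), map_smul, koszulSign_sub_one,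
      neg_smul, neg_neg]
  | add x y h1 h2 => simp only [map_add, h1, h2, neg_add]

theorem barComul_barSign (x : C.bar) : C.barComul (C.barSign x) =
    TensorProduct.map C.barSign C.barSign (C.barComul x) := by
  induction x using graded_induction C.barGr_isInternal with
  | hom n x hx =>
    rw [C.barSign_of_mem hx, map_smul]
    have ht := C.barComul_mem hx
    generalize C.barComul x = t at ht ⊢
    induction ht using tensorDeg_induction with
    | hom p a b ha hb =>
      rw [TensorProduct.map_tmul, C.barSign_of_mem ha, C.barSign_of_mem hb,
        TensorProduct.smul_tmul_smul, ← koszulSign_add, add_sub_cancel]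
    | h0 => simp only [map_zero, smul_zero]
    | add s t _ _ h1 h2 => rw [smul_add, map_add, h1, h2]
  | add x y h1 h2 => simp only [map_add, h1, h2]

/-- The tensor algebra on the desuspension of the cokernel of the coaugmentation. The
desuspension does not change the underlying module; it is accounted for in `cobarGr`. -/
abbrev cobarAlg : Type (max u v) := TensorAlgebra k C.bar

/-- The canonical inclusion of generators `x ↦ s⁻¹ x`. -/
noncomputable abbrev gen : C.bar →ₗ[k] C.cobarAlg := TensorAlgebra.ι k

/-- `C.IsWord n w` means that `w` is a product `s⁻¹ x₁ ⋯ s⁻¹ x_r` of desuspended homogeneous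
elements with `∑ (|x_i| - 1) = n`. -/
inductive IsWord : ℤ → C.cobarAlg → Prop
  | one : IsWord 0 1
  | cons {m n : ℤ} {x : C.bar} {w : C.cobarAlg} (hx : x ∈ C.barGr m) (hw : IsWord n w) :
      IsWord (m - 1 + n) (C.gen x * w)

/-- The grading of the cobar construction. -/
def cobarGr (n : ℤ) : Submodule k C.cobarAlg := Submodule.span k {w | C.IsWord n w}

/-- The sign involution of the cobar construction: the algebra map with
`s⁻¹ x ↦ (-1)^(|x| - 1) s⁻¹ x`. -/
noncomputable def cobarSign : C.cobarAlg →ₐ[k] C.cobarAlg :=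
  TensorAlgebra.lift k (- (C.gen ∘ₗ C.barSign))

/-- The cobar differential on generators:
`s⁻¹ x ↦ - s⁻¹ ∂ x + ∑ (-1)^|x'| s⁻¹ x' ⊗ s⁻¹ x''`. -/
noncomputable def cobarDGen : C.bar →ₗ[k] C.cobarAlg :=
  - (C.gen ∘ₗ C.barD) +
    LinearMap.mul' k _ ∘ₗ TensorProduct.map (C.gen ∘ₗ C.barSign) C.gen ∘ₗ C.barComul

/-- The algebra map to `2 × 2` matrices that encodes the extension of `cobarDGen`
to a derivation. -/
noncomputable def cobarMat : C.cobarAlg →ₐ[k] Matrix (Fin 2) (Fin 2) C.cobarAlg :=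
  TensorAlgebra.lift k
    { toFun := fun x => !![C.cobarSign (C.gen x), C.cobarDGen x; 0, C.gen x]
      map_add' := fun x y => by
        ext i j; fin_cases i <;> fin_cases j <;> simp
      map_smul' := fun c x => by
        ext i j; fin_cases i <;> fin_cases j <;> simp }

/-- The cobar differential: the derivation extending `cobarDGen`
(see `cobarD_gen` and `cobarD_mul`). -/
noncomputable def cobarD : C.cobarAlg →ₗ[k] C.cobarAlg where
  toFun a := C.cobarMat a 0 1
  map_add' a b := by simp
  map_smul' c a := by simp

theorem cobarMat_gen (x : C.bar) :
    C.cobarMat (C.gen x) = !![C.cobarSign (C.gen x), C.cobarDGen x; 0, C.gen x] := by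
  simp [cobarMat]

theorem cobarMat_eq (a : C.cobarAlg) :
    C.cobarMat a 0 0 = C.cobarSign a ∧ C.cobarMat a 1 0 = 0 ∧ C.cobarMat a 1 1 = a := by
  induction a using TensorAlgebra.induction with
  | algebraMap r => simp [AlgHom.commutes, Matrix.algebraMap_matrix_apply]
  | ι x =>
    have := C.cobarMat_gen x
    rw [gen] at this
    simp [this]
  | mul a b ha hb =>
    simp [map_mul, Matrix.mul_apply, ha, hb]
  | add a b ha hb => simp [map_add, ha, hb]

theorem cobarD_gen (x : C.bar) : C.cobarD (C.gen x) = C.cobarDGen x := by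
  change C.cobarMat (C.gen x) 0 1 = _
  rw [cobarMat_gen]; rfl

theorem cobarD_mul (a b : C.cobarAlg) :
    C.cobarD (a * b) = C.cobarD a * b + C.cobarSign a * C.cobarD b := by
  change C.cobarMat (a * b) 0 1 = C.cobarMat a 0 1 * b + C.cobarSign a * C.cobarMat b 0 1
  rw [map_mul, Matrix.mul_apply, Fin.sum_univ_two, (C.cobarMat_eq a).1, (C.cobarMat_eq b).2.2,
    add_comm]

theorem cobarD_algebraMap (r : k) : C.cobarD (algebraMap k _ r) = 0 := by
  change C.cobarMat (algebraMap k _ r) 0 1 = 0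
  rw [AlgHom.commutes]
  simp [Matrix.algebraMap_matrix_apply]

theorem cobarD_one : C.cobarD 1 = 0 := by
  rw [← map_one (algebraMap k C.cobarAlg), cobarD_algebraMap]

theorem cobarSign_gen (x : C.bar) : C.cobarSign (C.gen x) = - C.gen (C.barSign x) := by
  simp [cobarSign]

theorem cobarDGen_apply (x : C.bar) : C.cobarDGen x = - C.gen (C.barD x) +
    LinearMap.mul' k _ (TensorProduct.map (C.gen ∘ₗ C.barSign) C.gen (C.barComul x)) := rfl

theorem cobarSign_cobarSign (a : C.cobarAlg) : C.cobarSign (C.cobarSign a) = a := by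
  induction a using TensorAlgebra.induction with
  | algebraMap r => simp [AlgHom.commutes]
  | ι x =>
    change C.cobarSign (C.cobarSign (C.gen x)) = C.gen x
    rw [cobarSign_gen, map_neg, cobarSign_gen, neg_neg, barSign_barSign]
  | mul a b ha hb => rw [map_mul, map_mul, ha, hb]
  | add a b ha hb => rw [map_add, map_add, ha, hb]

theorem cobarD_cobarSign (a : C.cobarAlg) :
    C.cobarD (C.cobarSign a) = - C.cobarSign (C.cobarD a) := by
  induction a using TensorAlgebra.induction with
  | algebraMap r => simp [AlgHom.commutes, cobarD_algebraMap]
  | ι x =>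
    change C.cobarD (C.cobarSign (C.gen x)) = - C.cobarSign (C.cobarD (C.gen x))
    rw [cobarSign_gen, map_neg, cobarD_gen, cobarD_gen, cobarDGen_apply, cobarDGen_apply,
      barD_barSign, barComul_barSign, map_add, map_neg, map_neg, cobarSign_gen]
    generalize C.barComul x = t
    congr 2
    induction t using TensorProduct.induction_on with
    | zero => simp only [map_zero]
    | tmul a b =>
      simp only [TensorProduct.map_tmul, LinearMap.comp_apply, LinearMap.mul'_apply, map_mul,
        cobarSign_gen, neg_mul_neg]
    | add s t hs ht => simp only [map_add, hs, ht]
  | mul a b ha hb =>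
    rw [map_mul, cobarD_mul, cobarD_mul, map_add, map_mul, map_mul, ha, hb]
    simp only [neg_mul, mul_neg, neg_add]
  | add a b ha hb => simp only [map_add, ha, hb, neg_add]

theorem cobarD_cobarD_gen (x : C.bar) : C.cobarD (C.cobarD (C.gen x)) = 0 := by
  rw [cobarD_gen, cobarDGen_apply, map_add, map_neg, cobarD_gen, cobarDGen_apply, barD_barD,
    map_zero, neg_zero, zero_add, barComul_barD]
  have h1 : ∀ t : C.bar ⊗[k] C.bar,
      C.cobarD (LinearMap.mul' k _ (TensorProduct.map (C.gen ∘ₗ C.barSign) C.gen t)) =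
      LinearMap.mul' k _ (TensorProduct.map (C.gen ∘ₗ C.barSign) C.gen
        (TensorProduct.map C.barD LinearMap.id t + TensorProduct.map C.barSign C.barD t)) +
      (LinearMap.mul' k _ (TensorProduct.map
        (LinearMap.mul' k _ ∘ₗ TensorProduct.map C.gen (C.gen ∘ₗ C.barSign)) C.gen
        (TensorProduct.map C.barComul LinearMap.id t)) -
      LinearMap.mul' k _ (TensorProduct.map C.gen
        (LinearMap.mul' k _ ∘ₗ TensorProduct.map (C.gen ∘ₗ C.barSign) C.gen)
        (TensorProduct.map LinearMap.id C.barComul t))) := by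
    intro t
    induction t using TensorProduct.induction_on with
    | zero => simp only [map_zero, add_zero, sub_zero]
    | add s t hs ht =>
      simp only [map_add] at hs ht ⊢
      rw [hs, ht]
      abel
    | tmul a b =>
      have h3 : LinearMap.mul' k _ (TensorProduct.map (C.gen ∘ₗ C.barSign) C.gen
          (TensorProduct.map C.barSign C.barSign (C.barComul a))) =
          LinearMap.mul' k _ (TensorProduct.map C.gen (C.gen ∘ₗ C.barSign) (C.barComul a)) := by
        generalize C.barComul a = s
        induction s using TensorProduct.induction_on with
        | zero => simp only [map_zero]
        | add s t hs ht => simp only [map_add, hs, ht]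
        | tmul c d =>
          simp only [TensorProduct.map_tmul, LinearMap.comp_apply, barSign_barSign]
      simp only [TensorProduct.map_tmul, LinearMap.comp_apply, LinearMap.mul'_apply,
        LinearMap.id_apply, cobarD_mul, cobarD_gen, cobarSign_gen, barSign_barSign, map_add,
        cobarDGen_apply, barD_barSign, barComul_barSign, map_neg, h3]
      noncomm_ring
  have h2 : LinearMap.mul' k _ (TensorProduct.map
        (LinearMap.mul' k _ ∘ₗ TensorProduct.map C.gen (C.gen ∘ₗ C.barSign)) C.gen
        (TensorProduct.map C.barComul LinearMap.id (C.barComul x))) =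
      LinearMap.mul' k _ (TensorProduct.map C.gen
        (LinearMap.mul' k _ ∘ₗ TensorProduct.map (C.gen ∘ₗ C.barSign) C.gen)
        (TensorProduct.map LinearMap.id C.barComul (C.barComul x))) := by
    rw [← show _ = TensorProduct.map LinearMap.id C.barComul (C.barComul x) from
      reducedComul_coassoc C.one C.one_groupLike x]
    change _ = LinearMap.mul' k _ (TensorProduct.map C.gen
        (LinearMap.mul' k _ ∘ₗ TensorProduct.map (C.gen ∘ₗ C.barSign) C.gen)
        (TensorProduct.assoc k _ _ _ (TensorProduct.map C.barComul LinearMap.id (C.barComul x))))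
    generalize TensorProduct.map C.barComul LinearMap.id (C.barComul x) = t
    induction t using TensorProduct.induction_on with
    | zero => simp only [map_zero]
    | add s t hs ht => simp only [map_add, hs, ht]
    | tmul a b =>
      induction a using TensorProduct.induction_on with
      | zero => simp only [map_zero, TensorProduct.zero_tmul]
      | add s t hs ht => simp only [map_add, TensorProduct.add_tmul, hs, ht]
      | tmul c d =>
        simp only [TensorProduct.map_tmul, LinearMap.comp_apply, LinearMap.mul'_apply,
          TensorProduct.assoc_tmul, mul_assoc]
  rw [h1, h2, sub_self, add_zero, neg_add_cancel]

theorem cobarD_cobarD (a : C.cobarAlg) : C.cobarD (C.cobarD a) = 0 := by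
  induction a using TensorAlgebra.induction with
  | algebraMap r => rw [cobarD_algebraMap, map_zero]
  | ι x => exact C.cobarD_cobarD_gen x
  | mul a b ha hb =>
    rw [cobarD_mul, map_add, cobarD_mul, cobarD_mul, ha, hb, cobarD_cobarSign]
    simp
  | add a b ha hb => rw [map_add, map_add, ha, hb, add_zero]

theorem IsWord.mul {C : DGC.{u, v} k} {m n : ℤ} {a b : C.cobarAlg} (ha : C.IsWord m a)
    (hb : C.IsWord n b) : C.IsWord (m + n) (a * b) := by
  induction ha with
  | one => simpa using hb
  | cons hx hw ih =>
    rw [mul_assoc, add_assoc]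
    exact IsWord.cons hx ih

theorem cobarGr_one : (1 : C.cobarAlg) ∈ C.cobarGr 0 := Submodule.subset_span IsWord.one

theorem cobarGr_gen {n : ℤ} {x : C.bar} (hx : x ∈ C.barGr n) : C.gen x ∈ C.cobarGr (n - 1) := by
  have := IsWord.cons hx (IsWord.one (C := C))
  rw [add_zero, mul_one] at this
  exact Submodule.subset_span this

theorem cobarGr_mul {m n : ℤ} {a b : C.cobarAlg} (ha : a ∈ C.cobarGr m) (hb : b ∈ C.cobarGr n) :
    a * b ∈ C.cobarGr (m + n) := by
  have := Submodule.mul_mem_mul ha hb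
  rw [cobarGr, cobarGr, Submodule.span_mul_span] at this
  refine Submodule.span_mono ?_ this
  rintro _ ⟨a, ha, b, hb, rfl⟩
  exact IsWord.mul ha hb

theorem cobarGr_induction {C : DGC.{u, v} k} {n : ℤ} {P : ∀ a : C.cobarAlg, a ∈ C.cobarGr n → Prop}
    (word : ∀ w (hw : C.IsWord n w), P w (Submodule.subset_span hw))
    (zero : P 0 (zero_mem _))
    (add : ∀ a b ha hb, P a ha → P b hb → P (a + b) (add_mem ha hb))
    (smul : ∀ (c : k) a ha, P a ha → P (c • a) (Submodule.smul_mem _ c ha))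
    {a : C.cobarAlg} (ha : a ∈ C.cobarGr n) : P a ha := by
  induction ha using Submodule.span_induction with
  | mem x h => exact word x h
  | zero => exact zero
  | add x y hx hy h1 h2 => exact add x y hx hy h1 h2
  | smul c x hx h1 => exact smul c x hx h1

instance cobarGr_gradedMonoid : SetLike.GradedMonoid C.cobarGr where
  one_mem := C.cobarGr_one
  mul_mem _ _ _ _ ha hb := C.cobarGr_mul ha hb

/-- The decomposition of a generator into homogeneous components. -/
noncomputable def cobarSplitGen : C.bar →ₗ[k] ⨁ n, C.cobarGr n :=
  DirectSum.toModule k ℤ _ (fun n => DirectSum.lof k ℤ (fun i => C.cobarGr i) (n - 1) ∘ₗ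
    (C.gen.restrict (fun _ hx => C.cobarGr_gen hx) : C.barGr n →ₗ[k] C.cobarGr (n - 1))) ∘ₗ
    (sumEquiv C.barGr_isInternal).symm.toLinearMap

theorem cobarSplitGen_of_mem {n : ℤ} {x : C.bar} (hx : x ∈ C.barGr n) : C.cobarSplitGen x =
    DirectSum.of (fun i => C.cobarGr i) (n - 1) ⟨C.gen x, C.cobarGr_gen hx⟩ := by
  simp only [cobarSplitGen, LinearMap.comp_apply, LinearEquiv.coe_coe,
    sumEquiv_symm_of_mem C.barGr_isInternal hx, DirectSum.toModule_lof]
  rfl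

theorem cobarSplit_word {n : ℤ} {w : C.cobarAlg} (hw : C.IsWord n w) :
    TensorAlgebra.lift k C.cobarSplitGen w =
      DirectSum.of (fun i => C.cobarGr i) n ⟨w, Submodule.subset_span hw⟩ := by
  induction hw with
  | one => rw [map_one]; rfl
  | cons hx hw ih =>
    rw [map_mul, TensorAlgebra.lift_ι_apply, cobarSplitGen_of_mem C hx, ih, DirectSum.of_mul_of]
    rfl

theorem cobarGr_isInternal : DirectSum.IsInternal C.cobarGr := by
  refine isInternal_of_decomp (TensorAlgebra.lift k C.cobarSplitGen).toLinearMap ?_ ?_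
  · intro a
    have : (DirectSum.coeAlgHom C.cobarGr).comp (TensorAlgebra.lift k C.cobarSplitGen) =
        AlgHom.id k _ := by
      apply TensorAlgebra.hom_ext
      ext x
      simp only [LinearMap.comp_apply, AlgHom.toLinearMap_apply, AlgHom.comp_apply,
        TensorAlgebra.lift_ι_apply, AlgHom.id_apply]
      induction C.proj x using graded_induction C.barGr_isInternal with
      | hom n x hx => rw [cobarSplitGen_of_mem C hx, DirectSum.coeAlgHom_of]
      | add x y h1 h2 => rw [map_add, map_add, map_add, h1, h2]
    exact AlgHom.congr_fun this a
  · intro n a ha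
    have h : ∃ ha : a ∈ C.cobarGr n, (TensorAlgebra.lift k C.cobarSplitGen) a =
        DirectSum.lof k ℤ (fun i => C.cobarGr i) n ⟨a, ha⟩ := by
      induction ha using cobarGr_induction with
      | word w hw => exact ⟨_, C.cobarSplit_word hw⟩
      | zero => exact ⟨zero_mem _, by rw [map_zero]; exact (map_zero _).symm⟩
      | add a b _ _ ha hb =>
        obtain ⟨ha, h1⟩ := ha
        obtain ⟨hb, h2⟩ := hb
        exact ⟨add_mem ha hb, by rw [map_add, h1, h2, ← map_add]; rfl⟩
      | smul c a _ ha =>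
        obtain ⟨ha, h1⟩ := ha
        exact ⟨Submodule.smul_mem _ c ha, by rw [map_smul, h1, ← map_smul]; rfl⟩
    exact h.2

theorem cobarSign_of_mem {n : ℤ} {a : C.cobarAlg} (ha : a ∈ C.cobarGr n) :
    C.cobarSign a = koszulSign k n • a := by
  induction ha using cobarGr_induction with
  | word w hw =>
    induction hw with
    | one => simp
    | cons hx hw ih =>
      rw [map_mul, cobarSign_gen, C.barSign_of_mem hx, ih, koszulSign_add, koszulSign_sub_one,
        map_smul, ← neg_smul, smul_mul_smul_comm]
  | zero => simp
  | add a b _ _ ha hb => rw [map_add, ha, hb, smul_add]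
  | smul c a _ ha => rw [map_smul, ha, smul_comm]

theorem cobarD_gen_mem {n : ℤ} {x : C.bar} (hx : x ∈ C.barGr n) :
    C.cobarD (C.gen x) ∈ C.cobarGr (n - 1 - 1) := by
  rw [cobarD_gen, cobarDGen_apply]
  refine add_mem (neg_mem (C.cobarGr_gen (C.barD_mem hx))) ?_
  have ht := C.barComul_mem hx
  generalize C.barComul x = t at ht ⊢
  induction ht using tensorDeg_induction with
  | hom p a b ha hb =>
    rw [TensorProduct.map_tmul, LinearMap.mul'_apply, LinearMap.comp_apply, C.barSign_of_mem ha,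
      map_smul, smul_mul_assoc]
    have := C.cobarGr_mul (C.cobarGr_gen ha) (C.cobarGr_gen hb)
    rw [show p - 1 + (n - p - 1) = n - 1 - 1 by ring] at this
    exact Submodule.smul_mem _ _ this
  | h0 => simp only [map_zero]; exact zero_mem _
  | add s t _ _ h1 h2 => simp only [map_add]; exact add_mem h1 h2

theorem cobarD_mem {n : ℤ} {a : C.cobarAlg} (ha : a ∈ C.cobarGr n) :
    C.cobarD a ∈ C.cobarGr (n - 1) := by
  induction ha using cobarGr_induction with
  | word w hw =>
    induction hw with
    | one => rw [cobarD_one]; exact zero_mem _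
    | @cons m n x w hx hw ih =>
      rw [cobarD_mul]
      refine add_mem ?_ ?_
      · have := C.cobarGr_mul (C.cobarD_gen_mem hx) (Submodule.subset_span hw)
        rwa [show m - 1 - 1 + n = m - 1 + n - 1 by ring] at this
      · rw [C.cobarSign_of_mem (C.cobarGr_gen hx), smul_mul_assoc]
        have := C.cobarGr_mul (C.cobarGr_gen hx) ih
        rw [show m - 1 + (n - 1) = m - 1 + n - 1 by ring] at this
        exact Submodule.smul_mem _ _ this
  | zero => rw [map_zero]; exact zero_mem _
  | add a b _ _ ha hb => rw [map_add]; exact add_mem ha hb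
  | smul c a _ ha => rw [map_smul]; exact Submodule.smul_mem _ c ha

/-- The augmentation of the cobar construction, vanishing on generators. -/
noncomputable def cobarAug : C.cobarAlg →ₐ[k] k := TensorAlgebra.algebraMapInv

theorem cobarAug_gen (x : C.bar) : C.cobarAug (C.gen x) = 0 := by
  simp [cobarAug, TensorAlgebra.algebraMapInv]

theorem cobarAug_cobarD (a : C.cobarAlg) : C.cobarAug (C.cobarD a) = 0 := by
  have hs : ∀ a, C.cobarAug (C.cobarSign a) = C.cobarAug a := by
    intro a
    induction a using TensorAlgebra.induction with
    | algebraMap r => rw [AlgHom.commutes]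
    | ι x =>
      change C.cobarAug (C.cobarSign (C.gen x)) = C.cobarAug (C.gen x)
      rw [cobarSign_gen, map_neg, cobarAug_gen, cobarAug_gen, neg_zero]
    | mul a b ha hb => rw [map_mul, map_mul, map_mul, ha, hb]
    | add a b ha hb => rw [map_add, map_add, map_add, ha, hb]
  induction a using TensorAlgebra.induction with
  | algebraMap r => rw [cobarD_algebraMap, map_zero]
  | ι x =>
    change C.cobarAug (C.cobarD (C.gen x)) = 0
    rw [cobarD_gen, cobarDGen_apply, map_add, map_neg, cobarAug_gen, neg_zero, zero_add]
    generalize C.barComul x = t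
    induction t using TensorProduct.induction_on with
    | zero => simp only [map_zero]
    | tmul a b =>
      rw [TensorProduct.map_tmul, LinearMap.mul'_apply, map_mul, cobarAug_gen, mul_zero]
    | add s t hs ht => simp only [map_add, hs, ht, add_zero]
  | mul a b ha hb => rw [cobarD_mul, map_add, map_mul, map_mul, ha, hb, zero_mul, mul_zero, add_zero]
  | add a b ha hb => rw [map_add, map_add, ha, hb, add_zero]

theorem cobarAug_of_mem {n : ℤ} (hn : n ≠ 0) {a : C.cobarAlg} (ha : a ∈ C.cobarGr n) :
    C.cobarAug a = 0 := by
  induction ha using cobarGr_induction with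
  | word w hw =>
    cases hw with
    | one => exact absurd rfl hn
    | cons hx hw => rw [map_mul, cobarAug_gen, zero_mul]
  | zero => rw [map_zero]
  | add a b _ _ ha hb => rw [map_add, ha, hb, add_zero]
  | smul c a _ ha => rw [map_smul, ha, smul_zero]

/-- The cobar construction `Ω C = (T(s⁻¹ C̄), D)` of a dg coalgebra. -/
noncomputable def cobarObj : DGA.{u, max u v} k where
  carrier := C.cobarAlg
  gr := C.cobarGr
  isInternal := C.cobarGr_isInternal
  one_mem := C.cobarGr_one
  mul_mem _ _ _ _ ha hb := C.cobarGr_mul ha hb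
  d := C.cobarD
  d_mem _ _ ha := C.cobarD_mem ha
  d_d := C.cobarD_cobarD
  leibniz n a b ha := by rw [cobarD_mul, C.cobarSign_of_mem ha, smul_mul_assoc]
  aug := C.cobarAug
  aug_of_mem _ _ hn ha := C.cobarAug_of_mem hn ha
  aug_d := C.cobarAug_cobarD

end Objects

section Maps

variable {C D : DGC.{u, v} k}

/-- The map induced by a morphism of dg coalgebras on cokernels of the coaugmentations. -/
def barMap (f : C ⟶ D) : C.bar →ₗ[k] D.bar :=
  Submodule.mapQ _ _ (Hom.toLinearMap f) (by
    rw [Submodule.span_singleton_le_iff_mem, Submodule.mem_comap, Hom.map_one f]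
    exact Submodule.mem_span_singleton_self _)

theorem barMap_proj (f : C ⟶ D) (x : C.carrier) :
    barMap f (C.proj x) = D.proj (Hom.toLinearMap f x) := rfl

theorem barMap_mem (f : C ⟶ D) {n : ℤ} {x : C.bar} (hx : x ∈ C.barGr n) :
    barMap f x ∈ D.barGr n := by
  obtain ⟨x, hx, rfl⟩ := hx
  exact Submodule.mem_map_of_mem (Hom.map_mem f n x hx)

theorem barMap_barSign (f : C ⟶ D) (x : C.bar) :
    barMap f (C.barSign x) = D.barSign (barMap f x) := by
  induction x using graded_induction C.barGr_isInternal with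
  | hom n x hx => rw [C.barSign_of_mem hx, map_smul, D.barSign_of_mem (barMap_mem f hx)]
  | add x y h1 h2 => simp only [map_add, h1, h2]

theorem barMap_barD (f : C ⟶ D) (x : C.bar) : barMap f (C.barD x) = D.barD (barMap f x) := by
  obtain ⟨x, rfl⟩ := Submodule.mkQ_surjective _ x
  rw [barD_proj, barMap_proj, barMap_proj, barD_proj, Hom.map_d f]

theorem barMap_barComul (f : C ⟶ D) (x : C.bar) : D.barComul (barMap f x) =
    TensorProduct.map (barMap f) (barMap f) (C.barComul x) := by
  obtain ⟨x, rfl⟩ := Submodule.mkQ_surjective _ x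
  rw [barMap_proj, barComul_proj, barComul_proj, Hom.map_comul f]
  generalize (Coalgebra.comul x : C.carrier ⊗[k] C.carrier) = t
  induction t using TensorProduct.induction_on with
  | zero => simp only [map_zero]
  | tmul a b => simp only [TensorProduct.map_tmul, barMap_proj]
  | add s t hs ht => simp only [map_add, hs, ht]

/-- The algebra map `T(s⁻¹ C̄) → T(s⁻¹ D̄)` induced by a morphism of dg coalgebras. -/
noncomputable def cobarAlgMap (f : C ⟶ D) : C.cobarAlg →ₐ[k] D.cobarAlg :=
  TensorAlgebra.lift k (D.gen ∘ₗ barMap f)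

theorem cobarAlgMap_gen (f : C ⟶ D) (x : C.bar) :
    cobarAlgMap f (C.gen x) = D.gen (barMap f x) := by simp [cobarAlgMap]

theorem cobarAlgMap_cobarSign (f : C ⟶ D) (a : C.cobarAlg) :
    cobarAlgMap f (C.cobarSign a) = D.cobarSign (cobarAlgMap f a) := by
  induction a using TensorAlgebra.induction with
  | algebraMap r => simp only [AlgHom.commutes]
  | ι x =>
    change cobarAlgMap f (C.cobarSign (C.gen x)) = D.cobarSign (cobarAlgMap f (C.gen x))
    rw [cobarSign_gen, map_neg, cobarAlgMap_gen, cobarAlgMap_gen, cobarSign_gen, barMap_barSign]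
  | mul a b ha hb => simp only [map_mul, ha, hb]
  | add a b ha hb => simp only [map_add, ha, hb]

theorem cobarAlgMap_cobarD (f : C ⟶ D) (a : C.cobarAlg) :
    cobarAlgMap f (C.cobarD a) = D.cobarD (cobarAlgMap f a) := by
  induction a using TensorAlgebra.induction with
  | algebraMap r => rw [cobarD_algebraMap, AlgHom.commutes, cobarD_algebraMap, map_zero]
  | ι x =>
    change cobarAlgMap f (C.cobarD (C.gen x)) = D.cobarD (cobarAlgMap f (C.gen x))
    rw [cobarD_gen, cobarAlgMap_gen, cobarD_gen, cobarDGen_apply, cobarDGen_apply, map_add,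
      map_neg, cobarAlgMap_gen, barMap_barD, barMap_barComul]
    congr 1
    generalize C.barComul x = t
    induction t using TensorProduct.induction_on with
    | zero => simp only [map_zero]
    | tmul a b =>
      simp only [TensorProduct.map_tmul, LinearMap.mul'_apply, LinearMap.comp_apply, map_mul,
        cobarAlgMap_gen, barMap_barSign]
    | add s t hs ht => simp only [map_add, hs, ht]
  | mul a b ha hb =>
    rw [cobarD_mul, map_add, map_mul, map_mul, map_mul, cobarD_mul, ha, hb, cobarAlgMap_cobarSign]
  | add a b ha hb => simp only [map_add, ha, hb]

theorem cobarAlgMap_mem (f : C ⟶ D) {n : ℤ} {a : C.cobarAlg} (ha : a ∈ C.cobarGr n) :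
    cobarAlgMap f a ∈ D.cobarGr n := by
  induction ha using cobarGr_induction with
  | word w hw =>
    induction hw with
    | one => rw [map_one]; exact D.cobarGr_one
    | cons hx hw ih =>
      rw [map_mul, cobarAlgMap_gen]
      exact D.cobarGr_mul (D.cobarGr_gen (barMap_mem f hx)) ih
  | zero => rw [map_zero]; exact zero_mem _
  | add a b _ _ ha hb => rw [map_add]; exact add_mem ha hb
  | smul c a _ ha => rw [map_smul]; exact Submodule.smul_mem _ c ha

theorem cobarAlgMap_aug (f : C ⟶ D) (a : C.cobarAlg) :
    D.cobarAug (cobarAlgMap f a) = C.cobarAug a := by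
  induction a using TensorAlgebra.induction with
  | algebraMap r => simp only [AlgHom.commutes]
  | ι x =>
    change D.cobarAug (cobarAlgMap f (C.gen x)) = C.cobarAug (C.gen x)
    rw [cobarAlgMap_gen, cobarAug_gen, cobarAug_gen]
  | mul a b ha hb => simp only [map_mul, ha, hb]
  | add a b ha hb => simp only [map_add, ha, hb]

end Maps

/-- The cobar functor `Ω` from dg coalgebras to augmented dg algebras. -/
noncomputable def cobar (k : Type u) [CommRing k] : DGC.{u, v} k ⥤ DGA.{u, max u v} k where
  obj C := C.cobarObj
  map f :=
    { toAlgHom := cobarAlgMap f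
      map_mem := fun _ _ ha => cobarAlgMap_mem f ha
      map_d := cobarAlgMap_cobarD f
      map_aug := cobarAlgMap_aug f }
  map_id C := by
    apply DGA.Hom.ext
    apply TensorAlgebra.hom_ext
    apply LinearMap.ext
    intro x
    obtain ⟨x, rfl⟩ := Submodule.mkQ_surjective _ x
    exact cobarAlgMap_gen (𝟙 C) _
  map_comp {C D E} f g := by
    apply DGA.Hom.ext
    apply TensorAlgebra.hom_ext
    apply LinearMap.ext
    intro x
    obtain ⟨x, rfl⟩ := Submodule.mkQ_surjective _ x
    change cobarAlgMap (f ≫ g) (C.gen (C.proj x)) =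
      cobarAlgMap g (cobarAlgMap f (C.gen (C.proj x)))
    simp only [cobarAlgMap_gen]
    rfl

/-- A morphism of dg coalgebras is an `Ω`-quasi-isomorphism if its image under the cobar
functor is a quasi-isomorphism. -/
def IsOmegaQuasiIso {C D : DGC.{u, v} k} (f : C ⟶ D) : Prop :=
  DGA.IsQuasiIso ((cobar k).map f)

/-- Two dg coalgebras are `Ω`-quasi-isomorphic if they are connected by a finite zig-zag of
`Ω`-quasi-isomorphisms of dg coalgebras. -/
def OmegaQuasiIsomorphic (C D : DGC.{u, v} k) : Prop :=
  Relation.EqvGen (fun C' D' : DGC.{u, v} k => ∃ f : C' ⟶ D', IsOmegaQuasiIso f) C D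

end DGC

/-! ### Normalized chains on a simplicial set -/

namespace NormChains

/-- The `n`-simplices of a simplicial set. -/
abbrev Simplex (S : SSet.{w}) (n : ℕ) : Type w := S.obj (op (SimplexCategory.mk n))

variable (k : Type u) [CommRing k] (S : SSet.{w})

/-- The module of normalized chains (in all degrees): the free module on all simplices modulo
the submodule generated by the degenerate ones. -/
def Carrier : Type (max u w) :=
  ((Σ n : ℕ, Simplex S n) →₀ k) ⧸ Submodule.span k
    {c : (Σ n : ℕ, Simplex S n) →₀ k | ∃ (n : ℕ) (x : Simplex S n), x ∈ S.degenerate n ∧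
      c = Finsupp.single ⟨n, x⟩ 1}

noncomputable instance : AddCommGroup (Carrier k S) :=
  inferInstanceAs (AddCommGroup (_ ⧸ Submodule.span k _))

noncomputable instance : Module k (Carrier k S) :=
  inferInstanceAs (Module k (_ ⧸ Submodule.span k _))

variable {S}

/-- The class of a simplex. -/
noncomputable def cls (n : ℕ) (x : Simplex S n) : Carrier k S :=
  Submodule.Quotient.mk (Finsupp.single ⟨n, x⟩ 1)

theorem cls_degenerate {n : ℕ} {x : Simplex S n} (hx : x ∈ S.degenerate n) : cls k n x = 0 :=
  (Submodule.Quotient.mk_eq_zero _).mpr (Submodule.subset_span ⟨n, x, hx, rfl⟩)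

variable {k}
variable {W : Type*} [AddCommGroup W] [Module k W]

/-- A linear map out of the normalized chains is given by its values on simplices,
which have to vanish on degenerate simplices. -/
noncomputable def lift (f : ∀ n, Simplex S n → W) (hf : ∀ n x, x ∈ S.degenerate n → f n x = 0) :
    Carrier k S →ₗ[k] W :=
  Submodule.liftQ _ (Finsupp.linearCombination k (fun p : Σ n : ℕ, Simplex S n => f p.1 p.2)) (by
    rw [Submodule.span_le]
    rintro _ ⟨n, x, hx, rfl⟩
    simp [hf n x hx])

theorem lift_cls (f : ∀ n, Simplex S n → W) (hf : ∀ n x, x ∈ S.degenerate n → f n x = 0)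
    (n : ℕ) (x : Simplex S n) : lift f hf (cls k n x) = f n x := by
  change Finsupp.linearCombination k _ _ = _
  simp

theorem induction {P : Carrier k S → Prop} (cl : ∀ n x, P (cls k n x)) (zero : P 0)
    (add : ∀ a b, P a → P b → P (a + b)) (smul : ∀ (c : k) a, P a → P (c • a))
    (a : Carrier k S) : P a := by
  obtain ⟨a, rfl⟩ := Submodule.Quotient.mk_surjective _ a
  induction a using Finsupp.induction_linear with
  | zero => exact zero
  | add f g hf hg => exact add _ _ hf hg
  | single p c =>
    have h : Finsupp.single p c = c • Finsupp.single p (1 : k) := by simp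
    rw [h]
    exact smul c (cls k p.1 p.2) (cl p.1 p.2)

theorem hom_ext {f g : Carrier k S →ₗ[k] W} (h : ∀ n x, f (cls k n x) = g (cls k n x)) : f = g := by
  ext a
  induction a using induction with
  | cl n x => exact h n x
  | zero => simp
  | add a b ha hb => rw [map_add, map_add, ha, hb]
  | smul c a ha => rw [map_smul, map_smul, ha]

/-- The inclusion of the front face spanned by the vertices `0, …, p`. -/
def front (n : ℕ) (p : Fin (n + 1)) : SimplexCategory.mk ((p : ℕ)) ⟶ SimplexCategory.mk n :=
  SimplexCategory.mkHom
    { toFun := fun j => ⟨j, by have := j.2; have := p.2; omega⟩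
      monotone' := fun _ _ h => h }

/-- The inclusion of the back face spanned by the vertices `p, …, n`. -/
def back (n : ℕ) (p : Fin (n + 1)) : SimplexCategory.mk (n - (p : ℕ)) ⟶ SimplexCategory.mk n :=
  SimplexCategory.mkHom
    { toFun := fun j => ⟨p + j, by have := j.2; have := p.2; omega⟩
      monotone' := fun a b h => by
        have h : (a : ℕ) ≤ b := h
        simp only [Fin.mk_le_mk]
        omega }

variable (k)

/-- The boundary of a simplex: the alternating sum of its faces. -/
noncomputable def bdry : ∀ n : ℕ, Simplex S n → Carrier k S
  | 0, _ => 0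
  | n + 1, x => ∑ i : Fin (n + 2), (-1 : k) ^ (i : ℕ) • cls k n (S.δ i x)

/-- The Alexander-Whitney diagonal of a simplex. -/
noncomputable def diag (n : ℕ) (x : Simplex S n) : Carrier k S ⊗[k] Carrier k S :=
  ∑ p : Fin (n + 1), cls k p (S.map (front n p).op x) ⊗ₜ cls k (n - p) (S.map (back n p).op x)

/-! Auxiliary: faces of `x` indexed by functions on natural numbers. -/

/-- `f` restricts to a monotone map `{0, …, m} → {0, …, n}`. -/
def Valid (m n : ℕ) (f : ℕ → ℕ) : Prop := ∀ i j, i ≤ j → j ≤ m → f i ≤ f j ∧ f j ≤ n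

/-- The map of simplices given by a valid function. -/
def toHom {m n : ℕ} {f : ℕ → ℕ} (h : Valid m n f) : SimplexCategory.mk m ⟶ SimplexCategory.mk n :=
  SimplexCategory.mkHom
    { toFun := fun j => ⟨f j, by have := (h j j le_rfl (by have := j.2; omega)).2; omega⟩
      monotone' := fun a b hab => (h a b hab (by have := b.2; omega)).1 }

open Classical in
/-- The simplex of the normalized chains obtained from `x` along `f`. -/
noncomputable def cell {n : ℕ} (x : Simplex S n) (m : ℕ) (f : ℕ → ℕ) : Carrier k S :=
  if h : Valid m n f then cls k m (S.map (toHom h).op x) else 0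

/-- The function on natural numbers underlying a map of simplices. -/
def fn {m n : ℕ} (φ : SimplexCategory.mk m ⟶ SimplexCategory.mk n) (i : ℕ) : ℕ :=
  if h : i < m + 1 then (φ.toOrderHom ⟨i, h⟩ : ℕ) else 0

theorem valid_fn {m n : ℕ} (φ : SimplexCategory.mk m ⟶ SimplexCategory.mk n) : Valid m n (fn φ) := by
  intro i j hij hj
  have hi' : i < m + 1 := by omega
  have hj' : j < m + 1 := by omega
  simp only [fn, hi', hj', dif_pos]
  refine ⟨φ.toOrderHom.monotone (show (⟨i, hi'⟩ : Fin (m + 1)) ≤ ⟨j, hj'⟩ from hij), ?_⟩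
  have := (φ.toOrderHom ⟨j, hj'⟩).2
  exact Nat.lt_succ_iff.mp this

theorem toHom_fn {m n : ℕ} (φ : SimplexCategory.mk m ⟶ SimplexCategory.mk n) : toHom (valid_fn φ) = φ := by
  ext j
  change fn φ (j : ℕ) = (φ.toOrderHom j : ℕ)
  rw [fn, dif_pos (show (j : ℕ) < m + 1 from j.2)]

theorem valid_congr {m n : ℕ} {f g : ℕ → ℕ} (h : ∀ j ≤ m, f j = g j) (hf : Valid m n f) :
    Valid m n g := by
  intro i j hij hj
  rw [← h i (by omega), ← h j hj]
  exact hf i j hij hj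

theorem cell_congr {n : ℕ} (x : Simplex S n) {m m' : ℕ} {f g : ℕ → ℕ} (hm : m = m')
    (h : ∀ j ≤ m, f j = g j) : cell k x m f = cell k x m' g := by
  subst hm
  by_cases hf : Valid m n f
  · have hg := valid_congr h hf
    have he : toHom hf = toHom hg := by
      ext j
      exact h j (Nat.lt_succ_iff.mp j.2)
    rw [cell, dif_pos hf, cell, dif_pos hg, he]
  · have hg : ¬ Valid m n g := fun hg => hf (valid_congr (fun j hj => (h j hj).symm) hg)
    rw [cell, dif_neg hf, cell, dif_neg hg]

theorem cls_map {n m : ℕ} (x : Simplex S n) (φ : SimplexCategory.mk m ⟶ SimplexCategory.mk n) :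
    cls k m (S.map φ.op x) = cell k x m (fn φ) := by
  rw [cell, dif_pos (valid_fn φ), toHom_fn]

theorem cls_eq {n : ℕ} (x : Simplex S n) : cls k n x = cell k x n (fun j => j) := by
  have h : cls k n x = cell k x n (fn (𝟙 (SimplexCategory.mk n))) := by
    rw [← cls_map]
    simp
  refine h.trans (cell_congr k x rfl fun j hj => ?_)
  simp only [fn, Nat.lt_succ_of_le hj, dif_pos]
  rfl

theorem cell_map {n m p : ℕ} (x : Simplex S n) (φ : SimplexCategory.mk m ⟶ SimplexCategory.mk n) {f : ℕ → ℕ} (hf : Valid p m f) :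
    cell k (S.map φ.op x) p f = cell k x p (fun j => fn φ (f j)) := by
  rw [cell, dif_pos hf]
  have : S.map (toHom hf).op (S.map φ.op x) = S.map (toHom hf ≫ φ).op x := by simp
  rw [this, cls_map]
  refine cell_congr k x rfl fun j hj => ?_
  have h1 := (hf j j le_rfl hj).2
  simp only [fn, Nat.lt_succ_of_le hj, Nat.lt_succ_of_le h1, dif_pos]
  rfl

theorem cell_degenerate {n m : ℕ} (x : Simplex S n) {f : ℕ → ℕ} {i : ℕ} (hi : i + 1 ≤ m)
    (h : f i = f (i + 1)) : cell k x m f = 0 := by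
  by_cases hf : Valid m n f
  · obtain ⟨m, rfl⟩ : ∃ m', m = m' + 1 := ⟨m - 1, by omega⟩
    rw [cell, dif_pos hf]
    apply cls_degenerate
    have hg : Valid m n (fun j => if j ≤ i then f j else f (j + 1)) := by
      intro a b hab hb
      by_cases h1 : a ≤ i <;> by_cases h2 : b ≤ i <;> simp only [h1, h2, if_true, if_false]
      · exact hf a b hab (by omega)
      · exact hf a (b + 1) (by omega) (by omega)
      · omega
      · exact hf (a + 1) (b + 1) (by omega) (by omega)
    have hs : Valid (m + 1) m (fun j => if j ≤ i then j else j - 1) := by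
      intro a b hab hb
      by_cases h1 : a ≤ i <;> by_cases h2 : b ≤ i <;> simp only [h1, h2, if_true, if_false] <;> omega
    have hcalc : ∀ j : ℕ, (if (if j ≤ i then j else j - 1) ≤ i then
        f (if j ≤ i then j else j - 1) else f ((if j ≤ i then j else j - 1) + 1)) = f j := by
      intro j
      by_cases h1 : j ≤ i
      · simp only [h1, if_true]
      · by_cases h2 : j = i + 1
        · simp [h2, h]
        · have h3 : ¬ (j - 1 ≤ i) := by omega
          simp only [h1, h3, if_false]
          congr 1
          omega
    refine ⟨m, by omega, toHom hs, S.map (toHom hg).op x, ?_⟩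
    have : S.map (toHom hs).op (S.map (toHom hg).op x) = S.map (toHom hs ≫ toHom hg).op x := by simp
    rw [this]
    have he : toHom hs ≫ toHom hg = toHom hf := by
      ext j
      exact hcalc j
    rw [he]
  · rw [cell, dif_neg hf]
/-- The function skipping the value `i`. -/
def skip (i j : ℕ) : ℕ := if j < i then j else j + 1

theorem valid_skip (n i : ℕ) : Valid n (n + 1) (skip i) := by
  intro a b hab hb
  simp only [skip]
  split_ifs <;> omega

theorem valid_id {p n : ℕ} (h : p ≤ n) : Valid p n (fun j => j) :=
  fun _ _ hij hj => ⟨hij, le_trans hj h⟩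

theorem valid_shift {p m n : ℕ} (h : p + m ≤ n) : Valid m n (fun j => p + j) :=
  fun _ _ _ _ => ⟨by dsimp only; omega, by dsimp only; omega⟩

theorem bdry_succ {n : ℕ} (x : Simplex S (n + 1)) :
    bdry k (n + 1) x = ∑ i ∈ Finset.range (n + 2), (-1 : k) ^ i • cell k x n (skip i) := by
  rw [bdry, Finset.sum_range]
  refine Finset.sum_congr rfl fun i _ => ?_
  congr 1
  change cls k n (S.map (SimplexCategory.δ i).op x) = _
  rw [cls_map]
  refine cell_congr k x rfl fun j hj => ?_
  simp only [fn, Nat.lt_succ_of_le hj, dif_pos, skip]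
  change ((Fin.succAbove i ⟨j, Nat.lt_succ_of_le hj⟩ : Fin (n + 2)) : ℕ) = _
  simp only [Fin.succAbove, Fin.lt_def, Fin.val_castSucc]
  split_ifs <;> rfl

theorem diag_eq {n : ℕ} (x : Simplex S n) :
    diag k n x = ∑ p ∈ Finset.range (n + 1),
      cell k x p (fun j => j) ⊗ₜ cell k x (n - p) (fun j => p + j) := by
  rw [diag, Finset.sum_range]
  refine Finset.sum_congr rfl fun p _ => ?_
  rw [cls_map, cls_map]
  congr 1
  · refine cell_congr k x rfl fun j hj => ?_
    simp only [fn, Nat.lt_succ_of_le hj, dif_pos]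
    rfl
  · refine cell_congr k x rfl fun j hj => ?_
    simp only [fn, Nat.lt_succ_of_le hj, dif_pos]
    rfl

theorem exists_stationary {n m : ℕ} (h : m < n) {f : ℕ → ℕ} (hf : Valid n m f) :
    ∃ i, i + 1 ≤ n ∧ f i = f (i + 1) := by
  by_contra hc
  push Not at hc
  have : ∀ i ≤ n, i ≤ f i := by
    intro i
    induction i with
    | zero => intro _; omega
    | succ i ih =>
      intro hi
      have h1 := ih (by omega)
      have h2 := hc i hi
      have h3 := (hf i (i + 1) (by omega) hi).1
      omega
  have h1 := this n le_rfl
  have h2 := (hf n n le_rfl le_rfl).2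
  omega

theorem bdry_degenerate (n : ℕ) (x : Simplex S n) (hx : x ∈ S.degenerate n) : bdry k n x = 0 := by
  obtain ⟨m, hm, φ, y, rfl⟩ := hx
  obtain ⟨i, hi, hs⟩ := exists_stationary hm (valid_fn φ)
  obtain ⟨n, rfl⟩ : ∃ n', n = n' + 1 := ⟨n - 1, by omega⟩
  rw [bdry_succ]
  simp only [cell_map k y φ (valid_skip n _)]
  rw [← Finset.sum_subset (s₁ := {i, i + 1})]
  · rw [Finset.sum_pair (by omega), pow_succ]
    rw [cell_congr k y rfl (g := fun j => fn φ (skip (i + 1) j))]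
    · simp
    · intro j hj
      simp only [skip]
      rcases lt_trichotomy j i with h | h | h
      · rw [if_pos h, if_pos (by omega)]
      · subst h
        simp [hs]
      · rw [if_neg (by omega), if_neg (by omega)]
  · intro j hj
    simp only [Finset.mem_insert, Finset.mem_singleton, Finset.mem_range] at hj ⊢
    omega
  · intro j hj hj'
    simp only [Finset.mem_insert, Finset.mem_singleton, Finset.mem_range, not_or] at hj hj'
    rcases lt_or_gt_of_ne hj'.1 with h | h
    · rw [cell_degenerate k y (i := i - 1), smul_zero]
      · omega
      · simp only [skip]
        rw [if_neg (by omega), if_neg (by omega), show i - 1 + 1 = i by omega, hs]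
    · rw [cell_degenerate k y (i := i), smul_zero]
      · omega
      · simp only [skip]
        rw [if_pos (by omega), if_pos (by omega), hs]

theorem diag_degenerate (n : ℕ) (x : Simplex S n) (hx : x ∈ S.degenerate n) : diag k n x = 0 := by
  obtain ⟨m, hm, φ, y, rfl⟩ := hx
  obtain ⟨i, hi, hs⟩ := exists_stationary hm (valid_fn φ)
  rw [diag_eq]
  refine Finset.sum_eq_zero fun p hp => ?_
  rw [Finset.mem_range] at hp
  rw [cell_map k y φ (valid_id (by omega)), cell_map k y φ (valid_shift (by omega))]
  by_cases h : i + 1 ≤ p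
  · rw [cell_degenerate k y h hs, TensorProduct.zero_tmul]
  · rw [cell_degenerate k y (i := i - p) (m := n - p), TensorProduct.tmul_zero]
    · omega
    · rw [show p + (i - p) = i by omega, show p + (i - p + 1) = i + 1 by omega, hs]

variable (S)

/-- The differential on normalized chains. -/
noncomputable def d : Carrier k S →ₗ[k] Carrier k S := lift (bdry k) (bdry_degenerate k)

/-- The Alexander-Whitney coproduct on normalized chains. -/
noncomputable def comul : Carrier k S →ₗ[k] Carrier k S ⊗[k] Carrier k S :=
  lift (diag k) (diag_degenerate k)

/-- The counit on normalized chains: `0`-simplices go to `1`, all others to `0`. -/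
noncomputable def counit : Carrier k S →ₗ[k] k :=
  lift (fun n _ => if n = 0 then 1 else 0) (by
    intro n x hx
    rw [if_neg]
    rintro rfl
    rw [SSet.degenerate_zero] at hx
    exact hx)

/-- The grading of normalized chains by dimension. -/
noncomputable def gr (n : ℤ) : Submodule k (Carrier k S) :=
  Submodule.span k {c | ∃ (m : ℕ) (x : Simplex S m), (m : ℤ) = n ∧ c = cls k m x}

variable {S}

theorem d_cls (n : ℕ) (x : Simplex S n) : d k S (cls k n x) = bdry k n x := lift_cls _ _ _ _

theorem comul_cls (n : ℕ) (x : Simplex S n) : comul k S (cls k n x) = diag k n x := lift_cls _ _ _ _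

theorem counit_cls (n : ℕ) (x : Simplex S n) : counit k S (cls k n x) = if n = 0 then 1 else 0 :=
  lift_cls _ _ _ _

theorem cls_mem (n : ℕ) (x : Simplex S n) : cls k n x ∈ gr k S n :=
  Submodule.subset_span ⟨n, x, rfl, rfl⟩

theorem cell_mem {n : ℕ} (x : Simplex S n) (m : ℕ) (f : ℕ → ℕ) : cell k x m f ∈ gr k S m := by
  by_cases hf : Valid m n f
  · rw [cell, dif_pos hf]; exact cls_mem k _ _
  · rw [cell, dif_neg hf]; exact zero_mem _

theorem d_cell_zero {n : ℕ} (x : Simplex S n) (f : ℕ → ℕ) : d k S (cell k x 0 f) = 0 := by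
  by_cases hf : Valid 0 n f
  · rw [cell, dif_pos hf, d_cls]; rfl
  · rw [cell, dif_neg hf, map_zero]

theorem d_cell_succ {n m : ℕ} (x : Simplex S n) {f : ℕ → ℕ} (hf : Valid (m + 1) n f) :
    d k S (cell k x (m + 1) f) =
      ∑ i ∈ Finset.range (m + 2), (-1 : k) ^ i • cell k x m (fun j => f (skip i j)) := by
  rw [cell, dif_pos hf, d_cls, bdry_succ]
  refine Finset.sum_congr rfl fun i _ => ?_
  rw [cell_map k x _ (valid_skip m i)]
  congr 1
  refine cell_congr k x rfl fun j hj => ?_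
  have := (valid_skip m i j j le_rfl hj).2
  simp only [fn, Nat.lt_succ_of_le this, dif_pos]
  rfl

theorem comul_cell {n m : ℕ} (x : Simplex S n) {f : ℕ → ℕ} (hf : Valid m n f) :
    comul k S (cell k x m f) = ∑ p ∈ Finset.range (m + 1),
      cell k x p f ⊗ₜ cell k x (m - p) (fun j => f (p + j)) := by
  rw [cell, dif_pos hf, comul_cls, diag_eq]
  refine Finset.sum_congr rfl fun p hp => ?_
  rw [Finset.mem_range] at hp
  rw [cell_map k x _ (valid_id (by omega)), cell_map k x _ (valid_shift (by omega))]
  congr 1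
  · refine cell_congr k x rfl fun j hj => ?_
    have : j < m + 1 := by omega
    simp only [fn, this, dif_pos]
    rfl
  · refine cell_congr k x rfl fun j hj => ?_
    have : p + j < m + 1 := by omega
    simp only [fn, this, dif_pos]
    rfl

theorem counit_cell {n m : ℕ} (x : Simplex S n) {f : ℕ → ℕ} (hf : Valid m n f) :
    counit k S (cell k x m f) = if m = 0 then 1 else 0 := by
  rw [cell, dif_pos hf, counit_cls]

theorem d_d (a : Carrier k S) : d k S (d k S a) = 0 := by
  suffices h : d k S ∘ₗ d k S = 0 from LinearMap.congr_fun h a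
  refine hom_ext fun n x => ?_
  rw [LinearMap.comp_apply, LinearMap.zero_apply, d_cls]
  match n, x with
  | 0, x => exact map_zero _
  | 1, x =>
    rw [bdry_succ, map_sum]
    exact Finset.sum_eq_zero fun i _ => by rw [map_smul, d_cell_zero, smul_zero]
  | n + 2, x =>
    rw [bdry_succ, map_sum]
    simp only [map_smul, d_cell_succ k x (valid_skip (n + 1) _), Finset.smul_sum, smul_smul,
      ← pow_add]
    rw [← Finset.sum_product']
    refine Finset.sum_involution
      (fun p _ => if p.2 < p.1 then (p.2, p.1 - 1) else (p.2 + 1, p.1)) ?_ ?_ ?_ ?_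
    · rintro ⟨i, j⟩ hij
      simp only
      split_ifs with h
      · rw [cell_congr k x rfl (g := fun l => skip j (skip (i - 1) l))]
        · rw [show i + j = (j + (i - 1)) + 1 by omega, pow_succ]
          simp
        · intro l _
          simp only [skip]
          split_ifs <;> omega
      · rw [cell_congr k x rfl (g := fun l => skip (j + 1) (skip i l))]
        · rw [show j + 1 + i = (i + j) + 1 by omega, pow_succ]
          simp
        · intro l _
          simp only [skip]
          split_ifs <;> omega
    · rintro ⟨i, j⟩ hij _
      simp only
      split_ifs with h
      · intro he
        simp only [Prod.mk.injEq] at he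
        omega
      · intro he
        simp only [Prod.mk.injEq] at he
        omega
    · rintro ⟨i, j⟩ hij
      simp only [Finset.mem_product, Finset.mem_range] at hij ⊢
      split_ifs with h
      · dsimp only; omega
      · dsimp only; omega
    · rintro ⟨i, j⟩ hij
      simp only
      split_ifs with h1 h2 h2
      · dsimp only at h2; omega
      · ext
        · dsimp only; omega
        · rfl
      · ext
        · rfl
        · dsimp only; omega
      · dsimp only at h2; omega

theorem isInternal : DirectSum.IsInternal (gr k S) := by
  refine isInternal_of_decomp
    (lift (fun n x => DirectSum.lof k ℤ (fun i => gr k S i) n ⟨cls k n x, cls_mem k n x⟩) ?_) ?_ ?_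
  · intro n x hx
    have : (⟨cls k n x, cls_mem k n x⟩ : gr k S n) = 0 := Subtype.ext (cls_degenerate k hx)
    rw [this, map_zero]
  · intro a
    induction a using induction with
    | cl n x => rw [lift_cls, DirectSum.coeLinearMap_lof]
    | zero => rw [map_zero, map_zero]
    | add a b ha hb => rw [map_add, map_add, ha, hb]
    | smul c a ha => rw [map_smul, map_smul, ha]
  · intro n a ha
    induction ha using Submodule.span_induction with
    | mem a h =>
      obtain ⟨m, x, rfl, rfl⟩ := h
      exact lift_cls _ _ _ _
    | zero => rw [map_zero]; exact (map_zero _).symm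
    | add a b _ _ ha hb => rw [map_add, ha, hb, ← map_add]; rfl
    | smul c a _ ha => rw [map_smul, ha, ← map_smul]; rfl

theorem counit_rTensor : (counit k S).rTensor _ ∘ₗ comul k S = TensorProduct.mk k k _ 1 := by
  refine hom_ext fun n x => ?_
  rw [LinearMap.comp_apply, comul_cls, diag_eq, map_sum, Finset.sum_eq_single 0]
  · rw [LinearMap.rTensor_tmul, counit_cell k x (valid_id (by omega)), if_pos rfl]
    rw [TensorProduct.mk_apply, cls_eq k x]
    congr 1
    exact cell_congr k x (by omega) fun j _ => by omega
  · intro p hp hp0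
    rw [Finset.mem_range] at hp
    rw [LinearMap.rTensor_tmul, counit_cell k x (valid_id (by omega)), if_neg hp0,
      TensorProduct.zero_tmul]
  · intro h
    exact absurd (Finset.mem_range.mpr (by omega)) h

theorem counit_lTensor : (counit k S).lTensor _ ∘ₗ comul k S = (TensorProduct.mk k _ k).flip 1 := by
  refine hom_ext fun n x => ?_
  rw [LinearMap.comp_apply, comul_cls, diag_eq, map_sum, Finset.sum_eq_single n]
  · rw [LinearMap.lTensor_tmul, counit_cell k x (valid_shift (by omega)), if_pos (by omega)]
    rw [LinearMap.flip_apply, TensorProduct.mk_apply, cls_eq k x]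
  · intro p hp hp0
    rw [Finset.mem_range] at hp
    rw [LinearMap.lTensor_tmul, counit_cell k x (valid_shift (by omega)), if_neg (by omega),
      TensorProduct.tmul_zero]
  · intro h
    exact absurd (Finset.mem_range.mpr (by omega)) h

theorem coassoc : (TensorProduct.assoc k (Carrier k S) (Carrier k S) (Carrier k S)).toLinearMap ∘ₗ
      (comul k S).rTensor _ ∘ₗ comul k S =
    (comul k S).lTensor _ ∘ₗ comul k S := by
  refine hom_ext fun n x => ?_
  simp only [LinearMap.comp_apply, comul_cls, diag_eq, map_sum, LinearMap.rTensor_tmul,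
    LinearMap.lTensor_tmul]
  have h1 : ∀ p ∈ Finset.range (n + 1),
      (TensorProduct.assoc k (Carrier k S) (Carrier k S) (Carrier k S)).toLinearMap
        (comul k S (cell k x p fun j => j) ⊗ₜ[k] cell k x (n - p) fun j => p + j) =
      ∑ q ∈ Finset.range (p + 1), cell k x q (fun j => j) ⊗ₜ[k]
        (cell k x (p - q) (fun j => q + j) ⊗ₜ[k] cell k x (n - p) fun j => p + j) := by
    intro p hp
    rw [Finset.mem_range] at hp
    rw [comul_cell k x (valid_id (by omega)), TensorProduct.sum_tmul, map_sum]
    rfl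
  have h2 : ∀ q ∈ Finset.range (n + 1),
      (cell k x q (fun j => j) ⊗ₜ[k] comul k S (cell k x (n - q) fun j => q + j)) =
      ∑ r ∈ Finset.range (n - q + 1), cell k x q (fun j => j) ⊗ₜ[k]
        (cell k x r (fun j => q + j) ⊗ₜ[k] cell k x (n - q - r) fun j => q + (r + j)) := by
    intro q hq
    rw [Finset.mem_range] at hq
    rw [comul_cell k x (valid_shift (by omega)), TensorProduct.tmul_sum]
  rw [Finset.sum_congr rfl h1, Finset.sum_congr rfl h2, Finset.sum_sigma', Finset.sum_sigma']
  refine Finset.sum_bij' (fun a _ => ⟨a.2, a.1 - a.2⟩) (fun a _ => ⟨a.1 + a.2, a.1⟩) ?_ ?_ ?_ ?_ ?_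
  · rintro ⟨p, q⟩ h
    simp only [Finset.mem_sigma, Finset.mem_range] at h ⊢
    omega
  · rintro ⟨p, q⟩ h
    simp only [Finset.mem_sigma, Finset.mem_range] at h ⊢
    omega
  · rintro ⟨p, q⟩ h
    simp only [Finset.mem_sigma, Finset.mem_range] at h
    have : q + (p - q) = p := by omega
    simp [this]
  · rintro ⟨p, q⟩ h
    simp
  · rintro ⟨p, q⟩ h
    simp only [Finset.mem_sigma, Finset.mem_range] at h
    congr 2
    exact cell_congr k x (by dsimp only; omega) fun j _ => by dsimp only; omega

noncomputable instance : Coalgebra k (Carrier k S) where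
  comul := comul k S
  counit := counit k S
  coassoc := coassoc k
  rTensor_counit_comp_comul := counit_rTensor k
  lTensor_counit_comp_comul := counit_lTensor k

theorem signInv_cell {n : ℕ} (x : Simplex S n) (m : ℕ) (f : ℕ → ℕ) :
    signInv (isInternal k) (cell k x m f) = (-1 : k) ^ m • cell k x m f := by
  rw [signInv, scaleDeg_of_mem _ _ (cell_mem k x m f), koszulSign_natCast]

theorem comul_d (a : Carrier k S) : comul k S (d k S a) =
    TensorProduct.map (d k S) LinearMap.id (comul k S a) +
      TensorProduct.map (signInv (isInternal k)) (d k S) (comul k S a) := by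
  suffices h : comul k S ∘ₗ d k S = TensorProduct.map (d k S) LinearMap.id ∘ₗ comul k S +
      TensorProduct.map (signInv (isInternal k)) (d k S) ∘ₗ comul k S from LinearMap.congr_fun h a
  refine hom_ext fun n x => ?_
  simp only [LinearMap.comp_apply, LinearMap.add_apply, d_cls, comul_cls, diag_eq, map_sum,
    TensorProduct.map_tmul, LinearMap.id_apply, signInv_cell]
  match n, x with
  | 0, x =>
    simp only [zero_add, Finset.sum_range_one, d_cell_zero, TensorProduct.zero_tmul,
      TensorProduct.tmul_zero, add_zero, Nat.sub_self]
    exact map_zero (comul k S)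
  | m + 1, x =>
    rw [bdry_succ, map_sum]
    have h0 : ∀ i ∈ Finset.range (m + 2), comul k S ((-1 : k) ^ i • cell k x m (skip i)) =
        ∑ p ∈ Finset.range (m + 1), (-1 : k) ^ i •
          (cell k x p (skip i) ⊗ₜ[k] cell k x (m - p) fun j => skip i (p + j)) := by
      intro i _
      rw [LinearMap.map_smul, comul_cell k x (valid_skip m i), Finset.smul_sum]
    rw [Finset.sum_congr rfl h0, Finset.sum_comm]
    refine Eq.trans ?_ (congrArg₂ (· + ·) (Finset.sum_range_succ' _ _)
      (Finset.sum_range_succ _ _)).symm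
    simp only [d_cell_zero, TensorProduct.zero_tmul, add_zero, Nat.sub_self, TensorProduct.tmul_zero]
    rw [← Finset.sum_add_distrib]
    refine Finset.sum_congr rfl fun p hp => ?_
    rw [Finset.mem_range] at hp
    have e1 : m + 1 - p = (m - p) + 1 := by omega
    rw [d_cell_succ k x (valid_id (by omega)), e1, d_cell_succ k x (valid_shift (by omega)),
      show m + 2 = (p + 1) + (m - p + 1) by omega, Finset.sum_range_add, TensorProduct.sum_tmul,
      TensorProduct.tmul_sum, Finset.sum_range_succ (n := p + 1),
      Finset.sum_range_succ' (n := m - p + 1)]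
    have h1 : ∀ i ∈ Finset.range (p + 1), (-1 : k) ^ i •
        (cell k x p (skip i) ⊗ₜ[k] cell k x (m - p) fun j => skip i (p + j)) =
        ((-1 : k) ^ i • cell k x p fun j => skip i j) ⊗ₜ[k]
          cell k x (m + 1 - (p + 1)) fun j => p + 1 + j := by
      intro i hi
      rw [Finset.mem_range] at hi
      rw [TensorProduct.smul_tmul']
      congr 1
      exact cell_congr k x (by omega) fun j _ => by simp only [skip]; split_ifs <;> omega
    have h2 : ∀ i ∈ Finset.range (m - p + 1), (-1 : k) ^ (p + 1 + i) •
        (cell k x p (skip (p + 1 + i)) ⊗ₜ[k] cell k x (m - p) fun j => skip (p + 1 + i) (p + j)) =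
        ((-1 : k) ^ p • cell k x p fun j => j) ⊗ₜ[k]
          ((-1 : k) ^ (i + 1) • cell k x (m - p) fun j => p + skip (i + 1) j) := by
      intro i hi
      rw [Finset.mem_range] at hi
      rw [TensorProduct.smul_tmul_smul, ← pow_add, show p + (i + 1) = p + 1 + i by omega]
      congr 2
      · exact cell_congr k x rfl fun j _ => by simp only [skip]; split_ifs <;> omega
      · exact cell_congr k x rfl fun j _ => by simp only [skip]; split_ifs <;> omega
    have h3 : ((-1 : k) ^ (p + 1) • cell k x p fun j => skip (p + 1) j) ⊗ₜ[k]
          (cell k x (m + 1 - (p + 1)) fun j => p + 1 + j) =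
        - (((-1 : k) ^ p • cell k x p fun j => j) ⊗ₜ[k]
          ((-1 : k) ^ 0 • cell k x (m - p) fun j => p + skip 0 j)) := by
      have c1 : (cell k x p fun j => skip (p + 1) j) = cell k x p fun j => j :=
        cell_congr k x rfl fun j _ => by simp only [skip]; split_ifs <;> omega
      have c2 : (cell k x (m + 1 - (p + 1)) fun j => p + 1 + j) =
          cell k x (m - p) fun j => p + skip 0 j :=
        cell_congr k x (by omega) fun j _ => by simp only [skip]; split_ifs <;> omega
      rw [pow_zero, one_smul, pow_succ, mul_neg_one, neg_smul, TensorProduct.neg_tmul, c1, c2]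
    rw [Finset.sum_congr rfl h1, Finset.sum_congr rfl h2, h3]
    abel

theorem d_mem (n : ℤ) (a : Carrier k S) (ha : a ∈ gr k S n) : d k S a ∈ gr k S (n - 1) := by
  induction ha using Submodule.span_induction with
  | mem a h =>
    obtain ⟨m, x, rfl, rfl⟩ := h
    rw [d_cls]
    match m, x with
    | 0, x => exact zero_mem _
    | m + 1, x =>
      rw [bdry_succ]
      refine sum_mem fun i _ => Submodule.smul_mem _ _ ?_
      have := cell_mem k x m (skip i)
      rwa [show ((m + 1 : ℕ) : ℤ) - 1 = m by push_cast; ring]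
  | zero => rw [map_zero]; exact zero_mem _
  | add a b _ _ ha hb => rw [map_add]; exact add_mem ha hb
  | smul c a _ ha => rw [map_smul]; exact Submodule.smul_mem _ c ha

theorem comul_mem (n : ℤ) (a : Carrier k S) (ha : a ∈ gr k S n) :
    comul k S a ∈ tensorDeg (gr k S) n := by
  induction ha using Submodule.span_induction with
  | mem a h =>
    obtain ⟨m, x, rfl, rfl⟩ := h
    rw [comul_cls, diag_eq]
    refine sum_mem fun p hp => ?_
    rw [Finset.mem_range] at hp
    exact tmul_mem_tensorDeg (by omega) (cell_mem k x p _) (cell_mem k x (m - p) _)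
  | zero => rw [map_zero]; exact zero_mem _
  | add a b _ _ ha hb => rw [map_add]; exact add_mem ha hb
  | smul c a _ ha => rw [map_smul]; exact Submodule.smul_mem _ c ha

theorem counit_of_mem (n : ℤ) (a : Carrier k S) (hn : n ≠ 0) (ha : a ∈ gr k S n) :
    counit k S a = 0 := by
  induction ha using Submodule.span_induction with
  | mem a h =>
    obtain ⟨m, x, rfl, rfl⟩ := h
    rw [counit_cls, if_neg (by omega)]
  | zero => rw [map_zero]
  | add a b _ _ ha hb => rw [map_add, ha, hb, add_zero]
  | smul c a _ ha => rw [map_smul, ha, smul_zero]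

theorem counit_d (a : Carrier k S) : counit k S (d k S a) = 0 := by
  suffices h : counit k S ∘ₗ d k S = 0 from LinearMap.congr_fun h a
  refine hom_ext fun n x => ?_
  rw [LinearMap.comp_apply, LinearMap.zero_apply, d_cls]
  match n, x with
  | 0, x => exact map_zero _
  | 1, x =>
    rw [bdry_succ, map_sum]
    simp only [map_smul, counit_cell k x (valid_skip 0 _)]
    simp [Finset.sum_range_succ]
  | n + 2, x =>
    exact counit_of_mem k (n + 1) _ (by omega) (by
      have := d_mem k _ _ (cls_mem k (n + 2) x)
      rw [d_cls] at this
      rwa [show ((n + 2 : ℕ) : ℤ) - 1 = n + 1 by push_cast; ring] at this)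

theorem vertex_groupLike (b : Simplex S 0) : IsGroupLikeElem k (cls k 0 b) where
  counit_eq_one := by
    change counit k S _ = 1
    rw [counit_cls, if_pos rfl]
  comul_eq_tmul_self := by
    change comul k S _ = _
    rw [comul_cls, diag_eq, zero_add, Finset.sum_range_one, cls_eq k b]
    congr 1
    exact cell_congr k b rfl fun j _ => by omega

theorem iterReducedComul_cls [Subsingleton (Simplex S 0)] (b : Simplex S 0) (m n : ℕ) (h : n ≤ m)
    (x : Simplex S n) : iterReducedComul (cls k 0 b) (vertex_groupLike k b) m
      ((Submodule.span k {cls k 0 b}).mkQ (cls k n x)) = 0 := by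
  have h0 : ∀ y : Simplex S 0, (Submodule.span k {cls k 0 b}).mkQ (cls k 0 y) = 0 := by
    intro y
    rw [Subsingleton.elim y b]
    simp
  induction m generalizing n with
  | zero =>
    obtain rfl : n = 0 := by omega
    rw [h0, map_zero]
  | succ m ih =>
    rw [iterReducedComul, LinearMap.comp_apply, LinearMap.comp_apply, reducedComul_mkQ]
    change LinearMap.mul' k _ (TensorProduct.map _ _
      (TensorProduct.map _ _ (comul k S (cls k n x)))) = 0
    rw [comul_cls, diag, map_sum, map_sum, map_sum]
    refine Finset.sum_eq_zero fun p _ => ?_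
    obtain ⟨p, hp⟩ := p
    rw [TensorProduct.map_tmul, TensorProduct.map_tmul, LinearMap.mul'_apply]
    match p, hp with
    | 0, hp => erw [h0]; rw [map_zero, zero_mul]
    | p + 1, hp => erw [ih (n - (p + 1)) (by omega)]; rw [mul_zero]

variable (S) in
/-- The normalized chains on a reduced simplicial set `S` (one with exactly one `0`-simplex `b`)
as a dg coalgebra. -/
noncomputable def dgc [Subsingleton (Simplex S 0)] (b : Simplex S 0) : DGC.{u, max u w} k where
  carrier := Carrier k S
  gr := gr k S
  isInternal := isInternal k
  d := d k S
  d_mem := d_mem k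
  d_d := d_d k
  comul_mem := comul_mem k
  counit_of_mem := counit_of_mem k
  comul_d := comul_d k
  counit_d := counit_d k
  one := cls k 0 b
  one_groupLike := vertex_groupLike k b
  one_mem := by simpa using cls_mem k 0 b
  d_one := d_cls k 0 b
  conilpotent a := by
    obtain ⟨a, rfl⟩ := Submodule.mkQ_surjective _ a
    have key : ∃ N, ∀ m ≥ N, iterReducedComul (cls k 0 b) (vertex_groupLike k b) m
        ((Submodule.span k {cls k 0 b}).mkQ a) = 0 := by
      induction a using induction with
      | cl n x => exact ⟨n, fun m hm => iterReducedComul_cls k b m n hm x⟩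
      | zero => exact ⟨0, fun m _ => by rw [map_zero, map_zero]⟩
      | add a c ha hc =>
        obtain ⟨N, hN⟩ := ha
        obtain ⟨M, hM⟩ := hc
        exact ⟨max N M, fun m hm => by
          rw [map_add, map_add, hN m (le_trans (le_max_left _ _) hm),
            hM m (le_trans (le_max_right _ _) hm), add_zero]⟩
      | smul r a ha =>
        obtain ⟨N, hN⟩ := ha
        exact ⟨N, fun m hm => by rw [map_smul, map_smul, hN m hm, smul_zero]⟩
    obtain ⟨N, hN⟩ := key
    exact ⟨N, hN N le_rfl⟩

end NormChains

/-! ### Pointed path-connected spaces and pointed singular chains -/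

/-- A pointed path-connected topological space. -/
structure PtdSpace where
  space : TopCat.{w}
  pt : space
  [pathConnected : PathConnectedSpace space]

namespace PtdSpace

/-- A base point preserving continuous map. -/
@[ext] structure Hom (X Y : PtdSpace.{w}) where
  map : X.space ⟶ Y.space
  map_pt : map X.pt = Y.pt

/-- The category of pointed path-connected topological spaces. -/
instance : Category PtdSpace.{w} where
  Hom := Hom
  id X := { map := 𝟙 X.space, map_pt := rfl }
  comp f g := { map := f.map ≫ g.map, map_pt := by simp [f.map_pt, g.map_pt] }

/-- A space is semi-locally simply connected if each point `x` has a neighbourhood in which all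
loops at `x` are null-homotopic in the whole space. -/
def SemilocallySimplyConnected (X : Type w) [TopologicalSpace X] : Prop :=
  ∀ x : X, ∃ U ∈ nhds x, ∀ γ : Path x x, Set.range γ ⊆ U → γ.Homotopic (Path.refl x)

/-- The spaces that are locally path-connected and semi-locally simply connected (so that they
have a universal cover). -/
def HasUniversalCover : ObjectProperty PtdSpace.{w} := fun X =>
  LocallyPathConnectedSpace X.space ∧ SemilocallySimplyConnected X.space

/-- The simplicial set `Sing(X, b)` of those singular simplices of `X` that send all vertices
of the standard simplex to the base point. -/
def sing (X : PtdSpace.{w}) : (TopCat.toSSet.obj X.space).Subcomplex where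
  obj n := {σ | ∀ i, X.space.toSSetObjEquiv n σ (stdSimplex.vertex i) = X.pt}
  map {m n} f σ hσ i := by
    have h : X.space.toSSetObjEquiv n ((TopCat.toSSet.obj X.space).map f σ)
        (stdSimplex.vertex i) = X.space.toSSetObjEquiv m σ
          (stdSimplex.map f.unop.toOrderHom (stdSimplex.vertex i)) := rfl
    rw [h, stdSimplex.map_vertex]
    exact hσ _

instance (X : PtdSpace.{w}) : Subsingleton (NormChains.Simplex X.sing.toSSet 0) where
  allEq := by
    rintro ⟨σ, hσ⟩ ⟨τ, hτ⟩
    apply Subtype.ext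
    apply (X.space.toSSetObjEquiv _).injective
    ext p
    have : p = stdSimplex.vertex (S := ℝ) (X := Fin 1) 0 := Subsingleton.elim (α := stdSimplex ℝ (Fin 1)) _ _
    rw [this]
    exact (hσ 0).trans (hτ 0).symm

/-- The constant `0`-simplex at the base point. -/
noncomputable def singPt (X : PtdSpace.{w}) : NormChains.Simplex X.sing.toSSet 0 :=
  ⟨(X.space.toSSetObjEquiv _).symm (ContinuousMap.const _ X.pt), fun i => by
    rw [Equiv.apply_symm_apply]; rfl⟩

/-- The dg coalgebra `C_*(X, b; k)` of pointed normalized singular chains. -/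
noncomputable def chains (k : Type u) [CommRing k] (X : PtdSpace.{w}) : DGC.{u, max u w} k :=
  NormChains.dgc k X.sing.toSSet X.singPt

end PtdSpace

/-! Functoriality plays no role: a single space is exhibited whose chains are not
`Ω`-quasi-isomorphic to any cocommutative dg coalgebra. The obstruction is the invariant
`DGA.HasAugmentedIdempotent`: the homology of the cobar construction vanishes in negative degrees,
and the augmentation ideal of its degree-zero homology contains a nonzero idempotent.
Quasi-isomorphisms preserve it in both directions, hence so do zig-zags.

The space is the quotient of punctured real 3-space by the antipodal map, a model of the projective
plane. Degree-zero homology of the cobar construction should be thought of as the group algebra of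
the fundamental group, here of order two with generator γ, and (1 - γ)/2 is the idempotent. Only two
facts are checked by hand: a singular triangle shows that γ² is 1 up to a boundary, and the
monodromy of the double cover gives a character that separates γ from 1
(`NormChains.hasAugmentedIdempotent`).

For cocommutative C the cobar construction is a dg bialgebra under the shuffle coproduct, since
cocommutativity is exactly what makes the differential a coderivation (`DGC.cobarComul_cobarD`). If
the homology vanishes in negative degrees, the Künneth theorem makes degree-zero homology a
cocommutative conilpotent bialgebra. In characteristic zero such a bialgebra is an enveloping
algebra, so it has no idempotents besides 0 and 1. The proof bypasses the structure theorem and uses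
the coradical filtration. Contraction with a functional f vanishing at 1 lowers the filtration by
one and is a derivation on the associated graded (`contr_mul`). Hence for z of filtration p,
contracting z² with f in total 2p times gives a binomial multiple of the square of the scalar
obtained by contracting z with f in total p times (`contr_pow_mul`). If z² = z and p > 0, this
square is zero, as z is already killed by 2p contractions. By polarization (`mem_fil_of_contr_pow`)
z has filtration p - 1. Descending, z is a scalar, and it vanishes because its augmentation does
(`mem_Bd_of_idempotent`).

Everything is done on cycles modulo boundaries inside the algebra, and iterated coproducts are
replaced by iterated contractions with functionals. -/

/-! ### Graded tensor squares of dg algebras -/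

section GradedTensorSquare

open GradedTensorProduct

variable {k : Type u} [Field k] {T : Type v} [Ring T] [Algebra k T]
  (𝒜 : ℤ → Submodule k T) [GradedAlgebra 𝒜]

theorem uzpow_smul_eq_koszulSign {M : Type*} [AddCommGroup M] [Module k M] (n : ℤ) (x : M) :
    ((-1 : ℤˣ) ^ n) • x = koszulSign k n • x := by
  rw [koszulSign, Int.cast_smul_eq_zsmul, Units.smul_def]
  congr 2

variable {𝒜}

theorem gtmul_mul_gtmul (a d : T) {b c : T} {j i : ℤ} (hb : b ∈ 𝒜 j) (hc : c ∈ 𝒜 i) :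
    ((a ᵍ⊗ₜ[k] b : 𝒜 ᵍ⊗[k] 𝒜) * (c ᵍ⊗ₜ[k] d : 𝒜 ᵍ⊗[k] 𝒜)) =
      koszulSign k (j * i) • ((a * c) ᵍ⊗ₜ[k] (b * d) : 𝒜 ᵍ⊗[k] 𝒜) := by
  rw [← uzpow_smul_eq_koszulSign]
  exact tmul_coe_mul_coe_tmul 𝒜 𝒜 a ⟨b, hb⟩ ⟨c, hc⟩ d

theorem comm_gtmul {a b : T} {i j : ℤ} (ha : a ∈ 𝒜 i) (hb : b ∈ 𝒜 j) :
    GradedTensorProduct.comm 𝒜 𝒜 (a ᵍ⊗ₜ[k] b) =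
      koszulSign k (j * i) • (b ᵍ⊗ₜ[k] a : 𝒜 ᵍ⊗[k] 𝒜) := by
  rw [← uzpow_smul_eq_koszulSign]
  exact comm_coe_tmul_coe 𝒜 𝒜 ⟨a, ha⟩ ⟨b, hb⟩

theorem graded_alg_induction {P : T → Prop} (hom : ∀ n x, x ∈ 𝒜 n → P x)
    (add : ∀ x y, P x → P y → P (x + y)) (x : T) : P x :=
  graded_induction (DirectSum.Decomposition.isInternal 𝒜) hom add x

theorem gtensor_induction {P : 𝒜 ᵍ⊗[k] 𝒜 → Prop}
    (tmul : ∀ i j a b, a ∈ 𝒜 i → b ∈ 𝒜 j → P (a ᵍ⊗ₜ[k] b))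
    (add : ∀ x y, P x → P y → P (x + y)) (x : 𝒜 ᵍ⊗[k] 𝒜) : P x := by
  obtain ⟨x, rfl⟩ := (GradedTensorProduct.of k 𝒜 𝒜).surjective x
  induction x using TensorProduct.induction_on with
  | zero =>
    have := tmul 0 0 0 0 (zero_mem _) (zero_mem _)
    rwa [GradedTensorProduct.tmul, TensorProduct.tmul_zero] at this
  | add x y hx hy => rw [map_add]; exact add _ _ hx hy
  | tmul a b =>
    induction a using graded_alg_induction (𝒜 := 𝒜) with
    | add x y hx hy => rw [TensorProduct.add_tmul, map_add]; exact add _ _ hx hy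
    | hom i a ha =>
      induction b using graded_alg_induction (𝒜 := 𝒜) with
      | add x y hx hy => rw [TensorProduct.tmul_add, map_add]; exact add _ _ hx hy
      | hom j b hb => exact tmul i j a b ha hb

variable (𝒜)

/-- The sign involution of a graded algebra. -/
noncomputable def algSign : T →ₗ[k] T := signInv (DirectSum.Decomposition.isInternal 𝒜)

variable {𝒜}

theorem algSign_of_mem {n : ℤ} {a : T} (ha : a ∈ 𝒜 n) : algSign 𝒜 a = koszulSign k n • a :=
  scaleDeg_of_mem _ _ ha

variable (𝒜)

/-- A linear endomorphism of the tensor square, regarded as one of the graded tensor square. -/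
noncomputable def gEnd (φ : T ⊗[k] T →ₗ[k] T ⊗[k] T) : 𝒜 ᵍ⊗[k] 𝒜 →ₗ[k] 𝒜 ᵍ⊗[k] 𝒜 :=
  (GradedTensorProduct.of k 𝒜 𝒜).toLinearMap ∘ₗ φ ∘ₗ (GradedTensorProduct.of k 𝒜 𝒜).symm.toLinearMap

/-- The differential of the graded tensor square. -/
noncomputable def tensorD (d : T →ₗ[k] T) : 𝒜 ᵍ⊗[k] 𝒜 →ₗ[k] 𝒜 ᵍ⊗[k] 𝒜 :=
  gEnd 𝒜 (TensorProduct.map d LinearMap.id + TensorProduct.map (algSign 𝒜) d)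

/-- The sign involution of the graded tensor square. -/
noncomputable def tensorSign : 𝒜 ᵍ⊗[k] 𝒜 →ₗ[k] 𝒜 ᵍ⊗[k] 𝒜 :=
  gEnd 𝒜 (TensorProduct.map (algSign 𝒜) (algSign 𝒜))

variable {𝒜}

theorem tensorD_tmul (d : T →ₗ[k] T) (a b : T) : tensorD 𝒜 d (a ᵍ⊗ₜ[k] b) =
    (d a ᵍ⊗ₜ[k] b : 𝒜 ᵍ⊗[k] 𝒜) + (algSign 𝒜 a ᵍ⊗ₜ[k] d b : 𝒜 ᵍ⊗[k] 𝒜) := rfl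

theorem tensorSign_tmul (a b : T) : tensorSign 𝒜 (a ᵍ⊗ₜ[k] b) =
    (algSign 𝒜 a ᵍ⊗ₜ[k] algSign 𝒜 b : 𝒜 ᵍ⊗[k] 𝒜) := rfl

theorem gtmul_smul_left (c : k) (a b : T) :
    ((c • a) ᵍ⊗ₜ[k] b : 𝒜 ᵍ⊗[k] 𝒜) = c • (a ᵍ⊗ₜ[k] b : 𝒜 ᵍ⊗[k] 𝒜) := by
  rw [tmul, ← TensorProduct.smul_tmul', map_smul]

theorem gtmul_smul_right (c : k) (a b : T) :
    (a ᵍ⊗ₜ[k] (c • b) : 𝒜 ᵍ⊗[k] 𝒜) = c • (a ᵍ⊗ₜ[k] b : 𝒜 ᵍ⊗[k] 𝒜) := by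
  rw [tmul, TensorProduct.tmul_smul, map_smul]

theorem gtmul_add_left (a a' b : T) :
    ((a + a') ᵍ⊗ₜ[k] b : 𝒜 ᵍ⊗[k] 𝒜) = (a ᵍ⊗ₜ[k] b : 𝒜 ᵍ⊗[k] 𝒜) + (a' ᵍ⊗ₜ[k] b : 𝒜 ᵍ⊗[k] 𝒜) := by
  rw [tmul, TensorProduct.add_tmul, map_add]

theorem gtmul_add_right (a b b' : T) :
    (a ᵍ⊗ₜ[k] (b + b') : 𝒜 ᵍ⊗[k] 𝒜) = (a ᵍ⊗ₜ[k] b : 𝒜 ᵍ⊗[k] 𝒜) + (a ᵍ⊗ₜ[k] b' : 𝒜 ᵍ⊗[k] 𝒜) := by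
  rw [tmul, TensorProduct.tmul_add, map_add]

/-- Lowering the degree of one of the two middle factors by one changes the Koszul sign (-1)^(jm) by
(-1)^m or (-1)^j, and the sign involutions on the left factors absorb this. The rule reduces
compatibility of a coproduct with the differential to generators, and makes a product of a cycle
with a boundary a boundary. -/
theorem tensorD_mul {d : T →ₗ[k] T} (d_mem : ∀ n a, a ∈ 𝒜 n → d a ∈ 𝒜 (n - 1))
    (leibniz : ∀ a b, d (a * b) = d a * b + algSign 𝒜 a * d b) (x y : 𝒜 ᵍ⊗[k] 𝒜) :
    tensorD 𝒜 d (x * y) = tensorD 𝒜 d x * y + tensorSign 𝒜 x * tensorD 𝒜 d y := by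
  induction x using gtensor_induction with
  | add x x' h h' => simp only [add_mul, map_add, h, h']; abel
  | tmul i j a b ha hb =>
    induction y using gtensor_induction with
    | add y y' h h' => simp only [mul_add, map_add, h, h']; abel
    | tmul m n c e hc he =>
      rw [gtmul_mul_gtmul a e hb hc, map_smul, tensorD_tmul, tensorD_tmul, tensorD_tmul,
        tensorSign_tmul, leibniz, leibniz, algSign_of_mem ha, algSign_of_mem hb,
        algSign_of_mem hc, algSign_of_mem (SetLike.mul_mem_graded ha hc), mul_add, add_mul,
        gtmul_mul_gtmul _ _ hb hc, gtmul_mul_gtmul _ _ (d_mem _ _ hb) hc]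
      simp only [gtmul_smul_left, gtmul_smul_right, smul_mul_assoc, mul_smul_comm,
        gtmul_add_left, gtmul_add_right, smul_add, smul_smul]
      have hx : ∀ (r : k) (x y : 𝒜 ᵍ⊗[k] 𝒜), (r • x) * y = r • (x * y) := fun r x y => smul_mul_assoc r x y
      rw [hx]
      simp only [hx]
      rw [gtmul_mul_gtmul _ _ hb (d_mem _ _ hc), gtmul_mul_gtmul _ _ hb hc]
      have e2 : koszulSign k (j * (m - 1)) = koszulSign k (j * m) * koszulSign k j := by
        rw [mul_sub, mul_one, sub_eq_add_neg, koszulSign_add]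
        simp [koszulSign]
      have e3 : koszulSign k ((j - 1) * m) = koszulSign k (j * m) * koszulSign k m := by
        rw [sub_mul, one_mul, sub_eq_add_neg, koszulSign_add]
        simp [koszulSign]
      have e4 := koszulSign_mul_self (k := k) j
      have e5 := koszulSign_mul_self (k := k) m
      rw [koszulSign_add, e2, e3]
      generalize koszulSign k (j * m) = A at *
      generalize koszulSign k j = J at *
      generalize koszulSign k m = M at *
      generalize koszulSign k i = I at *
      match_scalars
      · ring
      · linear_combination (- A * I) * e4
      · ring
      · ring

end GradedTensorSquare

/-! ### Cocommutative conilpotent dg bialgebras -/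

/-! ### Contractions of the graded tensor square with functionals -/

section Slices

open GradedTensorProduct

variable {k : Type u} [Field k] {T : Type v} [Ring T] [Algebra k T]
  {𝒜 : ℤ → Submodule k T} [GradedAlgebra 𝒜]

/-- Contraction of the left tensor factor with a linear functional. -/
noncomputable def sliceL (f : T →ₗ[k] k) : 𝒜 ᵍ⊗[k] 𝒜 →ₗ[k] T :=
  (TensorProduct.lid k T).toLinearMap ∘ₗ TensorProduct.map f LinearMap.id ∘ₗ
    (GradedTensorProduct.of k 𝒜 𝒜).symm.toLinearMap

/-- Contraction of the right tensor factor with a linear functional. -/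
noncomputable def sliceR (f : T →ₗ[k] k) : 𝒜 ᵍ⊗[k] 𝒜 →ₗ[k] T :=
  (TensorProduct.rid k T).toLinearMap ∘ₗ TensorProduct.map LinearMap.id f ∘ₗ
    (GradedTensorProduct.of k 𝒜 𝒜).symm.toLinearMap

theorem sliceL_tmul (f : T →ₗ[k] k) (a b : T) :
    sliceL f (a ᵍ⊗ₜ[k] b : 𝒜 ᵍ⊗[k] 𝒜) = f a • b := rfl

theorem sliceR_tmul (f : T →ₗ[k] k) (a b : T) :
    sliceR f (a ᵍ⊗ₜ[k] b : 𝒜 ᵍ⊗[k] 𝒜) = f b • a := rfl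

theorem sliceL_add (f g : T →ₗ[k] k) (x : 𝒜 ᵍ⊗[k] 𝒜) :
    sliceL (f + g) x = sliceL f x + sliceL g x := by
  simp only [sliceL, TensorProduct.map_add_left, LinearMap.comp_apply, LinearMap.add_apply, map_add]

theorem sliceL_smul (c : k) (f : T →ₗ[k] k) (x : 𝒜 ᵍ⊗[k] 𝒜) :
    sliceL (c • f) x = c • sliceL f x := by
  simp only [sliceL, TensorProduct.map_smul_left, LinearMap.comp_apply, LinearMap.smul_apply, map_smul]

variable (𝒜) in
/-- Functionals supported in degree zero. -/
def degZero : Submodule k (T →ₗ[k] k) where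
  carrier := {f | ∀ n a, n ≠ 0 → a ∈ 𝒜 n → f a = 0}
  zero_mem' _ _ _ _ := rfl
  add_mem' hf hg n a hn ha := by simp [hf n a hn ha, hg n a hn ha]
  smul_mem' c f hf n a hn ha := by simp [hf n a hn ha]

theorem degZero_algSign {f : T →ₗ[k] k} (hf : f ∈ degZero 𝒜) (a : T) :
    f (algSign 𝒜 a) = f a := by
  induction a using graded_alg_induction (𝒜 := 𝒜) with
  | add a b ha hb => rw [map_add, map_add, map_add, ha, hb]
  | hom n a ha =>
    rw [algSign_of_mem ha, map_smul]
    by_cases hn : n = 0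
    · rw [hn, koszulSign_zero, one_smul]
    · rw [hf n a hn ha, smul_zero]

/-- Closedness of `f` kills the first summand of the differential, and support in degree zero
removes the sign in the second. This is why contractions with closed functionals act on homology. -/
theorem sliceL_tensorD {d : T →ₗ[k] T} {f : T →ₗ[k] k} (hf : f ∈ degZero 𝒜)
    (hd : ∀ a, f (d a) = 0) (x : 𝒜 ᵍ⊗[k] 𝒜) :
    sliceL f (tensorD 𝒜 d x) = d (sliceL f x) := by
  induction x using gtensor_induction with
  | add x y hx hy => simp only [map_add, hx, hy]
  | tmul i j a b ha hb =>
    rw [tensorD_tmul, map_add, sliceL_tmul, sliceL_tmul, sliceL_tmul, hd, zero_smul, zero_add,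
      degZero_algSign hf, map_smul]

theorem sliceL_mem {f : T →ₗ[k] k} (hf : f ∈ degZero 𝒜) {n : ℤ} {x : 𝒜 ᵍ⊗[k] 𝒜}
    (hx : (GradedTensorProduct.of k 𝒜 𝒜).symm x ∈ tensorDeg 𝒜 n) : sliceL f x ∈ 𝒜 n := by
  obtain ⟨x, rfl⟩ := (GradedTensorProduct.of k 𝒜 𝒜).surjective x
  rw [of_symm_of] at hx
  induction hx using tensorDeg_induction with
  | h0 => simp
  | add s t _ _ hs ht => rw [map_add, map_add]; exact add_mem hs ht
  | hom p a b ha hb =>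
    change f a • b ∈ 𝒜 n
    by_cases hp : p = 0
    · rw [hp, sub_zero] at hb
      exact Submodule.smul_mem _ _ hb
    · rw [hf p a hp ha, zero_smul]; exact zero_mem _

/-- Only the degree-zero part of the contracted factor contributes, and there the Koszul sign of the
interchange is trivial. -/
theorem sliceL_comm {f : T →ₗ[k] k} (hf : f ∈ degZero 𝒜) (x : 𝒜 ᵍ⊗[k] 𝒜) :
    sliceL f (GradedTensorProduct.comm 𝒜 𝒜 x) = sliceR f x := by
  induction x using gtensor_induction with
  | add x y hx hy => simp only [map_add, hx, hy]
  | tmul i j a b ha hb =>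
    rw [comm_gtmul ha hb, map_smul, sliceL_tmul, sliceR_tmul]
    by_cases hj : j = 0
    · rw [hj, zero_mul, koszulSign_zero, one_smul]
    · rw [hf j b hj hb, zero_smul, smul_zero]

theorem gtmul_mul_gtmul_of_mem_zero {a : T} (ha : a ∈ 𝒜 0) (b x y : T) :
    (b ᵍ⊗ₜ[k] a : 𝒜 ᵍ⊗[k] 𝒜) * (x ᵍ⊗ₜ[k] y : 𝒜 ᵍ⊗[k] 𝒜) = (b * x) ᵍ⊗ₜ[k] (a * y) := by
  induction x using graded_alg_induction (𝒜 := 𝒜) with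
  | add x x' hx hx' => rw [mul_add, gtmul_add_left, gtmul_add_left, mul_add, hx, hx']
  | hom n x hx => rw [gtmul_mul_gtmul _ _ ha hx, zero_mul, koszulSign_zero, one_smul]

theorem sliceL_one_gtmul_mul (f : T →ₗ[k] k) {a : T} (ha : a ∈ 𝒜 0) (x : 𝒜 ᵍ⊗[k] 𝒜) :
    sliceL f (((1 : T) ᵍ⊗ₜ[k] a : 𝒜 ᵍ⊗[k] 𝒜) * x) = a * sliceL f x := by
  induction x using gtensor_induction with
  | add x y hx hy => simp only [mul_add, map_add, hx, hy]
  | tmul i j b c _ _ => rw [gtmul_mul_gtmul_of_mem_zero ha, sliceL_tmul, sliceL_tmul, one_mul, mul_smul_comm]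

theorem sliceL_mul_one_gtmul (f : T →ₗ[k] k) (a : T) (x : 𝒜 ᵍ⊗[k] 𝒜) :
    sliceL f (x * ((1 : T) ᵍ⊗ₜ[k] a : 𝒜 ᵍ⊗[k] 𝒜)) = sliceL f x * a := by
  induction x using gtensor_induction with
  | add x y hx hy => simp only [add_mul, map_add, hx, hy]
  | tmul i j b c _ hc =>
    rw [gtmul_mul_gtmul _ _ hc SetLike.GradedOne.one_mem, sliceL_tmul, mul_zero, koszulSign_zero, one_smul,
      sliceL_tmul, mul_one, smul_mul_assoc]

theorem tensorSign_of_mem {x : 𝒜 ᵍ⊗[k] 𝒜}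
    (hx : (GradedTensorProduct.of k 𝒜 𝒜).symm x ∈ tensorDeg 𝒜 0) : tensorSign 𝒜 x = x := by
  obtain ⟨x, rfl⟩ := (GradedTensorProduct.of k 𝒜 𝒜).surjective x
  rw [of_symm_of] at hx
  induction hx using tensorDeg_induction with
  | h0 => simp
  | add s t _ _ hs ht => rw [map_add, map_add, hs, ht]
  | hom p a b ha hb =>
    change tensorSign 𝒜 (a ᵍ⊗ₜ[k] b) = _
    rw [tensorSign_tmul, algSign_of_mem ha, algSign_of_mem hb, gtmul_smul_left, gtmul_smul_right,
      smul_smul, ← koszulSign_add, add_sub_cancel, koszulSign_zero, one_smul]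

/-- Expand `x` along a basis of the left factor: the coefficients are the contractions with the
coordinate functionals, so they lie in `N`. -/
theorem mem_range_of_slice {N : Submodule k T} {x : T ⊗[k] T}
    (h : ∀ f : T →ₗ[k] k, sliceL f (GradedTensorProduct.of k 𝒜 𝒜 x) ∈ N) :
    x ∈ LinearMap.range (TensorProduct.map (LinearMap.id : T →ₗ[k] T) N.subtype) := by
  classical
  let b := Module.Basis.ofVectorSpace k T
  rw [← (TensorProduct.equivFinsuppOfBasisLeft (N := T) b).symm_apply_apply x,
    TensorProduct.equivFinsuppOfBasisLeft_symm_apply]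
  refine Submodule.sum_mem _ fun i _ => ?_
  have key : ∀ y : T ⊗[k] T, TensorProduct.equivFinsuppOfBasisLeft b y i =
      sliceL (b.coord i) (GradedTensorProduct.of k 𝒜 𝒜 y) := by
    intro y
    induction y using TensorProduct.induction_on with
    | zero => simp
    | add y z hy hz => simp only [map_add, Finsupp.add_apply, hy, hz]
    | tmul y z => simp; rfl
  have hi := h (b.coord i)
  rw [← key] at hi
  exact ⟨b i ⊗ₜ ⟨_, hi⟩, rfl⟩

end Slices

/-- The coradical filtration determined by a comultiplication: `annFil Δ r` is annihilated by all
`r`-fold contractions with functionals vanishing at `1`. -/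
noncomputable def annFil {k : Type u} [Field k] {T : Type v} [Ring T] [Algebra k T]
    {𝒜 : ℤ → Submodule k T} [GradedAlgebra 𝒜] (Δ : T →ₐ[k] 𝒜 ᵍ⊗[k] 𝒜) : ℕ → Submodule k T
  | 0 => ⊥
  | r + 1 => ⨅ f : {f : T →ₗ[k] k // f 1 = 0},
      (annFil Δ r).comap (sliceL (𝒜 := 𝒜) f.1 ∘ₗ Δ.toLinearMap)

/-- A cocommutative conilpotent dg bialgebra. -/
structure CocommDGBialgebra {k : Type u} [Field k] {T : Type v} [Ring T] [Algebra k T]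
    (𝒜 : ℤ → Submodule k T) [GradedAlgebra 𝒜] where
  d : T →ₗ[k] T
  d_mem : ∀ n a, a ∈ 𝒜 n → d a ∈ 𝒜 (n - 1)
  d_d : ∀ a, d (d a) = 0
  leibniz : ∀ a b, d (a * b) = d a * b + algSign 𝒜 a * d b
  ε : T →ₐ[k] k
  ε_of_mem : ∀ n a, n ≠ 0 → a ∈ 𝒜 n → ε a = 0
  ε_d : ∀ a, ε (d a) = 0
  Δ : T →ₐ[k] 𝒜 ᵍ⊗[k] 𝒜
  Δ_d : ∀ a, Δ (d a) = tensorD 𝒜 d (Δ a)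
  Δ_mem : ∀ n a, a ∈ 𝒜 n → (GradedTensorProduct.of k 𝒜 𝒜).symm (Δ a) ∈ tensorDeg 𝒜 n
  counit : ∀ a, sliceL ε.toLinearMap (Δ a) = a
  comm_Δ : ∀ a, GradedTensorProduct.comm 𝒜 𝒜 (Δ a) = Δ a
  -- Coassociativity in contracted form: both sides apply f to the first and g to the third factor
  -- of the iterated coproduct. This avoids threefold graded tensor products.
  slice_comm : ∀ f g a, sliceL f (Δ (sliceR g (Δ a))) = sliceR g (Δ (sliceL f (Δ a)))
  conilpotent : ∀ a, ∃ r, a ∈ annFil Δ r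

/-! ### Contraction operators and the coradical filtration on degree-zero homology -/

namespace CocommDGBialgebra

open GradedTensorProduct

variable {k : Type u} [Field k] {T : Type v} [Ring T] [Algebra k T]
  {𝒜 : ℤ → Submodule k T} [GradedAlgebra 𝒜] (B : CocommDGBialgebra 𝒜)

/-- The contraction operator `a ↦ f(a') a''`. -/
noncomputable def contr (f : T →ₗ[k] k) : T →ₗ[k] T := sliceL f ∘ₗ B.Δ.toLinearMap

theorem contr_apply (f : T →ₗ[k] k) (a : T) : B.contr f a = sliceL f (B.Δ a) := rfl

/-- Closed functionals of degree zero. -/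
def closed : Submodule k (T →ₗ[k] k) := degZero 𝒜 ⊓ {
  carrier := {f | ∀ a, f (B.d a) = 0}
  zero_mem' _ := rfl
  add_mem' hf hg a := by simp [hf a, hg a]
  smul_mem' c f hf a := by simp [hf a] }

/-- Closed functionals of degree zero vanishing at `1`. -/
def pclosed : Submodule k (T →ₗ[k] k) := B.closed ⊓ LinearMap.ker (LinearMap.applyₗ (1 : T))

theorem ε_mem : B.ε.toLinearMap ∈ B.closed := ⟨B.ε_of_mem, B.ε_d⟩

theorem contr_d {f : T →ₗ[k] k} (hf : f ∈ B.closed) (a : T) :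
    B.contr f (B.d a) = B.d (B.contr f a) := by
  rw [contr_apply, B.Δ_d, sliceL_tensorD hf.1 hf.2, contr_apply]

theorem contr_mem {f : T →ₗ[k] k} (hf : f ∈ B.closed) {n : ℤ} {a : T} (ha : a ∈ 𝒜 n) :
    B.contr f a ∈ 𝒜 n := sliceL_mem hf.1 (B.Δ_mem n a ha)

theorem contr_ε (a : T) : B.contr B.ε.toLinearMap a = a := B.counit a

theorem contr_add (f g : T →ₗ[k] k) (a : T) : B.contr (f + g) a = B.contr f a + B.contr g a :=
  sliceL_add f g _

theorem contr_smul (c : k) (f : T →ₗ[k] k) (a : T) : B.contr (c • f) a = c • B.contr f a :=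
  sliceL_smul c f _

/-- By cocommutativity, contracting the left factor with a degree-zero functional is the same as
contracting the right one, and contractions at opposite ends commute by coassociativity. Commutation
is needed for the binomial expansion in the polarization argument. -/
theorem contr_contr {g : T →ₗ[k] k} (hg : g ∈ B.closed) (f : T →ₗ[k] k) (a : T) :
    B.contr f (B.contr g a) = B.contr g (B.contr f a) := by
  have h : ∀ a, B.contr g a = sliceR g (B.Δ a) := fun a => by
    rw [← sliceL_comm hg.1, B.comm_Δ, contr_apply]
  rw [h, h]
  exact B.slice_comm f g a

/-- Counitality on the right factor, which follows from the left one by cocommutativity. A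
functional is thus recovered from its contraction operator. -/
theorem ε_contr {f : T →ₗ[k] k} (a : T) : B.ε (B.contr f a) = f a := by
  have h1 : sliceR B.ε.toLinearMap (B.Δ a) = a := by
    rw [← sliceL_comm B.ε_mem.1, B.comm_Δ, B.counit]
  have h2 : ∀ x : 𝒜 ᵍ⊗[k] 𝒜, B.ε (sliceL f x) = f (sliceR B.ε.toLinearMap x) := by
    intro x
    induction x using gtensor_induction with
    | add x y hx hy => simp only [map_add, hx, hy]
    | tmul i j a b _ _ =>
      rw [sliceL_tmul, sliceR_tmul, map_smul, map_smul, smul_eq_mul, smul_eq_mul, mul_comm]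
      rfl
  rw [contr_apply, h2, h1]

/-- Cycles of degree zero. -/
def Z : Submodule k T := 𝒜 0 ⊓ LinearMap.ker B.d

/-- Boundaries of degree zero. -/
def Bd : Submodule k T := (𝒜 (0 + 1)).map B.d

/-- The component of degree `n`. -/
noncomputable def _root_.degProj (𝒜 : ℤ → Submodule k T) [GradedAlgebra 𝒜] (n : ℤ) : T →ₗ[k] T :=
  GradedAlgebra.proj 𝒜 n

theorem _root_.degProj_mem (n : ℤ) (a : T) : degProj 𝒜 n a ∈ 𝒜 n := by
  rw [degProj, GradedAlgebra.proj_apply]; exact SetLike.coe_mem _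

theorem _root_.degProj_of_mem {n : ℤ} {a : T} (ha : a ∈ 𝒜 n) : degProj 𝒜 n a = a := by
  rw [degProj, GradedAlgebra.proj_apply, DirectSum.decompose_of_mem_same 𝒜 ha]

theorem _root_.degProj_of_mem_ne {m n : ℤ} (h : m ≠ n) {a : T} (ha : a ∈ 𝒜 m) :
    degProj 𝒜 n a = 0 := by
  rw [degProj, GradedAlgebra.proj_apply, DirectSum.decompose_of_mem_ne 𝒜 ha h]

theorem degProj_d (n : ℤ) (a : T) : degProj 𝒜 n (B.d a) = B.d (degProj 𝒜 (n + 1) a) := by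
  induction a using graded_alg_induction (𝒜 := 𝒜) with
  | add a b ha hb => simp only [map_add, ha, hb]
  | hom m a ha =>
    by_cases h : m = n + 1
    · subst h
      have := B.d_mem _ _ ha
      rw [add_sub_cancel_right] at this
      rw [degProj_of_mem this, degProj_of_mem ha]
    · rw [degProj_of_mem_ne (by omega) (B.d_mem _ _ ha), degProj_of_mem_ne h ha, map_zero]

/-- Since the differential is homogeneous, a boundary of degree zero already bounds its primitive's
component of degree one. So the degrees of chains bounding a given cycle need not be tracked. -/
theorem d_mem_Bd {a : T} (h : B.d a ∈ 𝒜 0) : B.d a ∈ B.Bd := by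
  rw [← degProj_of_mem h, degProj_d]
  exact Submodule.mem_map_of_mem (degProj_mem _ _)

theorem Bd_le_Z : B.Bd ≤ B.Z := by
  rintro _ ⟨a, ha, rfl⟩
  refine ⟨?_, B.d_d a⟩
  have := B.d_mem _ _ ha
  rwa [add_sub_cancel_right] at this

theorem contr_Z {f : T →ₗ[k] k} (hf : f ∈ B.closed) {a : T} (ha : a ∈ B.Z) : B.contr f a ∈ B.Z :=
  ⟨B.contr_mem hf ha.1, by
    rw [SetLike.mem_coe, LinearMap.mem_ker, ← B.contr_d hf, show B.d a = 0 from ha.2, map_zero]⟩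

theorem contr_Bd {f : T →ₗ[k] k} (hf : f ∈ B.closed) {a : T} (ha : a ∈ B.Bd) :
    B.contr f a ∈ B.Bd := by
  obtain ⟨b, hb, rfl⟩ := ha
  rw [B.contr_d hf]
  exact Submodule.mem_map_of_mem (B.contr_mem hf hb)

theorem _root_.algSign_zero {a : T} (ha : a ∈ 𝒜 0) : algSign 𝒜 a = a := by
  rw [algSign_of_mem ha, koszulSign_zero, one_smul]

theorem d_one : B.d 1 = 0 := by
  have := B.leibniz 1 1
  rw [algSign_zero SetLike.GradedOne.one_mem, one_mul, one_mul, mul_one] at this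
  simpa using this

theorem mul_Z {a b : T} (ha : a ∈ B.Z) (hb : b ∈ B.Z) : a * b ∈ B.Z :=
  ⟨by simpa using SetLike.mul_mem_graded ha.1 hb.1, by
    rw [SetLike.mem_coe, LinearMap.mem_ker, B.leibniz, show B.d a = 0 from ha.2, show B.d b = 0 from hb.2]; simp⟩

theorem mul_d {a : T} (ha : a ∈ B.Z) (b : T) : a * B.d b = B.d (a * b) := by
  rw [B.leibniz, show B.d a = 0 from ha.2, algSign_zero ha.1, zero_mul, zero_add]

theorem d_mul {b : T} (hb : b ∈ B.Z) (a : T) : B.d a * b = B.d (a * b) := by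
  rw [B.leibniz, show B.d b = 0 from hb.2, mul_zero, add_zero]

theorem Z_mul_Bd {a b : T} (ha : a ∈ B.Z) (hb : b ∈ B.Bd) : a * b ∈ B.Bd := by
  have h := B.mul_Z ha (B.Bd_le_Z hb)
  obtain ⟨b, hb, rfl⟩ := hb
  rw [B.mul_d ha] at h ⊢
  exact B.d_mem_Bd h.1

theorem Bd_mul_Z {a b : T} (ha : a ∈ B.Bd) (hb : b ∈ B.Z) : a * b ∈ B.Bd := by
  have h := B.mul_Z (B.Bd_le_Z ha) hb
  obtain ⟨a, ha, rfl⟩ := ha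
  rw [B.d_mul hb] at h ⊢
  exact B.d_mem_Bd h.1

theorem ε_Bd {a : T} (ha : a ∈ B.Bd) : B.ε a = 0 := by
  obtain ⟨a, _, rfl⟩ := ha
  exact B.ε_d a

/-- The coradical filtration on the cycles of degree zero modulo boundaries: `fil (p + 1)` consists
of the cycles representing classes of filtration at most `p`. -/
noncomputable def fil : ℕ → Submodule k T
  | 0 => B.Bd
  | p + 1 => B.Z ⊓ ⨅ f : B.pclosed, (fil p).comap (B.contr f.1)

theorem mem_fil_succ {p : ℕ} {a : T} :
    a ∈ B.fil (p + 1) ↔ a ∈ B.Z ∧ ∀ f ∈ B.pclosed, B.contr f a ∈ B.fil p := by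
  simp [fil, Submodule.mem_iInf]

theorem fil_le_Z (p : ℕ) : B.fil p ≤ B.Z := by
  cases p with
  | zero => exact B.Bd_le_Z
  | succ p => exact inf_le_left

theorem Bd_le_fil (p : ℕ) : B.Bd ≤ B.fil p := by
  induction p with
  | zero => exact le_rfl
  | succ p ih =>
    intro a ha
    exact B.mem_fil_succ.mpr ⟨B.Bd_le_Z ha, fun f hf => ih (B.contr_Bd hf.1 ha)⟩

theorem fil_le_succ (p : ℕ) : B.fil p ≤ B.fil (p + 1) := by
  induction p with
  | zero => exact B.Bd_le_fil 1
  | succ p ih =>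
    intro a ha
    rw [mem_fil_succ] at ha ⊢
    exact ⟨ha.1, fun f hf => ih (ha.2 f hf)⟩

theorem fil_mono : Monotone B.fil := monotone_nat_of_le_succ B.fil_le_succ

theorem contr_fil {f : T →ₗ[k] k} (hf : f ∈ B.pclosed) {p : ℕ} {a : T} (ha : a ∈ B.fil p) :
    B.contr f a ∈ B.fil (p - 1) := by
  cases p with
  | zero => exact B.contr_Bd hf.1 ha
  | succ p => exact (B.mem_fil_succ.mp ha).2 f hf

/-- `annFil` demands vanishing under all functionals that kill 1, whereas `fil` only uses the closed
ones of degree zero and asks for vanishing modulo boundaries. Hence conilpotence makes `fil` exhaust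
the cycles. -/
theorem annFil_inf_Z_le (r : ℕ) : annFil B.Δ r ⊓ B.Z ≤ B.fil r := by
  induction r with
  | zero => rintro a ⟨ha, _⟩; rw [annFil, SetLike.mem_coe, Submodule.mem_bot] at ha; rw [ha]; exact zero_mem _
  | succ r ih =>
    rintro a ⟨ha, hz⟩
    rw [annFil, SetLike.mem_coe, Submodule.mem_iInf] at ha
    exact B.mem_fil_succ.mpr ⟨hz, fun f hf => ih ⟨ha ⟨f, hf.2⟩, B.contr_Z hf.1 hz⟩⟩

theorem exists_mem_fil {a : T} (ha : a ∈ B.Z) : ∃ p, a ∈ B.fil p := by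
  obtain ⟨r, hr⟩ := B.conilpotent a
  exact ⟨r, B.annFil_inf_Z_le r ⟨hr, ha⟩⟩

/-- The bottom layer of the filtration consists of scalars. Otherwise a functional that vanishes on
boundaries and at 1 but not at `a`, extended by zero outside degree zero, is closed; its contraction
sends `a` to a boundary, while the augmentation of that boundary is the nonzero value at `a`. -/
theorem mem_fil_one {a : T} (ha : a ∈ B.fil 1) : ∃ c : k, a - c • 1 ∈ B.Bd := by
  by_contra hc
  have hN : a ∉ B.Bd ⊔ Submodule.span k {1} := by
    intro h
    obtain ⟨b, hb, y, hy, rfl⟩ := Submodule.mem_sup.mp h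
    obtain ⟨c, rfl⟩ := Submodule.mem_span_singleton.mp hy
    exact hc ⟨c, by rwa [add_sub_cancel_right]⟩
  obtain ⟨φ, hφa, hφ⟩ := Submodule.exists_le_ker_of_notMem hN
  have ha' := B.mem_fil_succ.mp ha
  have hcl : φ ∘ₗ degProj 𝒜 0 ∈ B.pclosed := by
    refine ⟨⟨fun n x hn hx => ?_, fun x => ?_⟩, ?_⟩
    · rw [LinearMap.comp_apply, degProj_of_mem_ne hn hx, map_zero]
    · rw [LinearMap.comp_apply, B.degProj_d]
      exact hφ (Submodule.mem_sup_left (Submodule.mem_map_of_mem (degProj_mem _ _)))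
    · change φ (degProj 𝒜 0 1) = 0
      rw [degProj_of_mem SetLike.GradedOne.one_mem]
      exact hφ (Submodule.mem_sup_right (Submodule.mem_span_singleton_self _))
  have := B.ε_Bd (ha'.2 _ hcl)
  rw [B.ε_contr, LinearMap.comp_apply, degProj_of_mem ha'.1.1] at this
  exact hφa this

end CocommDGBialgebra

/-! ### Splitting off homology and the Künneth decomposition of the coproduct -/

theorem LinearMap.exists_generalized_inverse {k : Type*} {V W : Type*} [Field k] [AddCommGroup V]
    [Module k V] [AddCommGroup W] [Module k W] (D : V →ₗ[k] W) :
    ∃ G : W →ₗ[k] V, ∀ x, D (G (D x)) = D x := by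
  obtain ⟨g, hg⟩ := D.rangeRestrict.exists_rightInverse_of_surjective D.range_rangeRestrict
  obtain ⟨G, hG⟩ := g.exists_extend
  refine ⟨G, fun x => ?_⟩
  have h1 : G (D x) = g ⟨D x, LinearMap.mem_range_self D x⟩ :=
    LinearMap.congr_fun hG ⟨D x, LinearMap.mem_range_self D x⟩
  rw [h1]
  exact congrArg Subtype.val (LinearMap.congr_fun hg ⟨D x, LinearMap.mem_range_self D x⟩)

namespace CocommDGBialgebra

open GradedTensorProduct

variable {k : Type u} [Field k] {T : Type v} [Ring T] [Algebra k T]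
  {𝒜 : ℤ → Submodule k T} [GradedAlgebra 𝒜] (B : CocommDGBialgebra 𝒜)

theorem exists_graded_generalized_inverse : ∃ g : T →ₗ[k] T,
    (∀ n a, a ∈ 𝒜 n → g a ∈ 𝒜 (n + 1)) ∧ ∀ a, B.d (g (B.d a)) = B.d a := by
  have hD : ∀ n, ∀ x ∈ 𝒜 (n + 1), B.d x ∈ 𝒜 n := fun n x hx => by
    have := B.d_mem _ _ hx
    rwa [add_sub_cancel_right] at this
  choose G hG using fun n => (B.d.restrict (hD n)).exists_generalized_inverse
  let g : T →ₗ[k] T := DirectSum.toModule k ℤ T (fun n => (𝒜 (n + 1)).subtype ∘ₗ G n) ∘ₗ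
    (sumEquiv (DirectSum.Decomposition.isInternal 𝒜)).symm.toLinearMap
  have key : ∀ n a (ha : a ∈ 𝒜 n), g a = G n ⟨a, ha⟩ := by
    intro n a ha
    simp only [g, LinearMap.comp_apply, LinearEquiv.coe_coe,
      sumEquiv_symm_of_mem (DirectSum.Decomposition.isInternal 𝒜) ha, DirectSum.toModule_lof]
    rfl
  refine ⟨g, fun n a ha => ?_, fun a => ?_⟩
  · rw [key n a ha]; exact SetLike.coe_mem _
  · induction a using graded_alg_induction (𝒜 := 𝒜) with
    | add a b ha hb => simp only [map_add, ha, hb]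
    | hom n a ha =>
      obtain ⟨n, rfl⟩ : ∃ m, n = m + 1 := ⟨n - 1, by omega⟩
      rw [key n _ (hD n a ha)]
      exact congrArg Subtype.val (hG n ⟨a, ha⟩)

/-- If the homology vanishes in negative degrees, there is a chain homotopy from the identity to a
map that factors through the homology, and that vanishes in negative degrees. -/
theorem exists_homotopy (hneg : ∀ n < 0, ∀ a ∈ 𝒜 n, B.d a = 0 → ∃ b, B.d b = a) :
    ∃ P h : T →ₗ[k] T, (∀ a, a = P a + (B.d (h a) + h (B.d a))) ∧ (∀ a, P (B.d a) = 0) ∧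
      (∀ a, B.d (P a) = 0) ∧ (∀ n a, a ∈ 𝒜 n → P a ∈ 𝒜 n) ∧
      (∀ n a, a ∈ 𝒜 n → h a ∈ 𝒜 (n + 1)) ∧ ∀ n < 0, ∀ a ∈ 𝒜 n, P a = 0 := by
  obtain ⟨g, hg, hdgd⟩ := B.exists_graded_generalized_inverse
  -- With dgd = d, the map Q = 1 - dg - gd takes values in cycles and kills boundaries.
  let Q : T →ₗ[k] T := LinearMap.id - (B.d ∘ₗ g + g ∘ₗ B.d)
  have hQ : ∀ a, Q a = a - (B.d (g a) + g (B.d a)) := fun a => rfl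
  have Qd : ∀ a, Q (B.d a) = 0 := fun a => by
    rw [hQ, hdgd, B.d_d, map_zero, add_zero, sub_self]
  have dQ : ∀ a, B.d (Q a) = 0 := fun a => by
    rw [hQ, map_sub, map_add, hdgd, B.d_d, zero_add, sub_self]
  have Qmem : ∀ n a, a ∈ 𝒜 n → Q a ∈ 𝒜 n := fun n a ha => by
    refine sub_mem ha (add_mem ?_ ?_)
    · have := B.d_mem _ _ (hg n a ha)
      rwa [add_sub_cancel_right] at this
    · have := hg _ _ (B.d_mem n a ha)
      rwa [sub_add_cancel] at this
  -- The square of Q is used because of negative degrees: the first Q produces a cycle, which is a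
  -- boundary there, and the second Q kills it. The homotopy changes by Qg since Q² = Q - Qgd and dQ
  -- = 0.
  refine ⟨Q ∘ₗ Q, g + Q ∘ₗ g, fun a => ?_, fun a => ?_, fun a => ?_, fun n a ha => ?_,
    fun n a ha => ?_, fun n hn a ha => ?_⟩
  · have h1 : Q (Q a) = Q a - Q (g (B.d a)) := by
      conv_lhs => rw [hQ a, map_sub, map_add, Qd, zero_add]
    simp only [LinearMap.comp_apply, LinearMap.add_apply, map_add, dQ, add_zero]
    rw [h1, hQ a]
    abel
  · simp only [LinearMap.comp_apply, Qd, map_zero]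
  · simp only [LinearMap.comp_apply, dQ]
  · exact Qmem n _ (Qmem n a ha)
  · exact add_mem (hg n a ha) (Qmem _ _ (hg n a ha))
  · obtain ⟨b, hb⟩ := hneg n hn (Q a) (Qmem n a ha) (dQ a)
    rw [LinearMap.comp_apply, ← hb, Qd]

/-- The standard homotopy h ⊗ 1 + P ⊗ h for a tensor product of homotopic maps, with the Koszul sign
put on the left factor in the second term: first deform the left factor from 1 to P, then the right
one. -/
theorem tensor_homotopy {P h : T →ₗ[k] T} (hP : ∀ a, a = P a + (B.d (h a) + h (B.d a)))
    (Pd : ∀ a, P (B.d a) = 0) (dP : ∀ a, B.d (P a) = 0) (Pmem : ∀ n a, a ∈ 𝒜 n → P a ∈ 𝒜 n)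
    (hmem : ∀ n a, a ∈ 𝒜 n → h a ∈ 𝒜 (n + 1)) (x : 𝒜 ᵍ⊗[k] 𝒜)  :
    x = gEnd 𝒜 (TensorProduct.map P P) x +
      (tensorD 𝒜 B.d (gEnd 𝒜 (TensorProduct.map h LinearMap.id +
          TensorProduct.map (P ∘ₗ algSign 𝒜) h) x) +
        gEnd 𝒜 (TensorProduct.map h LinearMap.id + TensorProduct.map (P ∘ₗ algSign 𝒜) h)
          (tensorD 𝒜 B.d x)) := by
  have key : ∀ a b, gEnd 𝒜 (TensorProduct.map h LinearMap.id +
      TensorProduct.map (P ∘ₗ algSign 𝒜) h) (a ᵍ⊗ₜ[k] b) =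
      (h a ᵍ⊗ₜ[k] b : 𝒜 ᵍ⊗[k] 𝒜) + (P (algSign 𝒜 a) ᵍ⊗ₜ[k] h b : 𝒜 ᵍ⊗[k] 𝒜) := fun _ _ => rfl
  have key' : ∀ a b, gEnd 𝒜 (TensorProduct.map P P) (a ᵍ⊗ₜ[k] b) =
      (P a ᵍ⊗ₜ[k] P b : 𝒜 ᵍ⊗[k] 𝒜) := fun _ _ => rfl
  induction x using gtensor_induction with
  | add x y hx hy =>
    conv_lhs => rw [hx, hy]
    simp only [map_add]
    abel
  | tmul i j a b ha hb =>
    rw [key, key', tensorD_tmul, map_add, map_add, key, key, tensorD_tmul, tensorD_tmul,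
      algSign_of_mem ha, algSign_of_mem (hmem i a ha), algSign_of_mem (B.d_mem i a ha)]
    simp only [map_smul, Pd, dP, algSign_of_mem ha, algSign_of_mem (Pmem i a ha), smul_zero,
      smul_smul, koszulSign_mul_self, one_smul]
    have e1 : koszulSign k (i + 1) = - koszulSign k i := by
      have := koszulSign_sub_one (k := k) (i + 1)
      rw [add_sub_cancel_right] at this
      rw [this, neg_neg]
    have h0 : ∀ y : T, ((0 : T) ᵍ⊗ₜ[k] y : 𝒜 ᵍ⊗[k] 𝒜) = 0 := fun y => by
      rw [GradedTensorProduct.tmul, TensorProduct.zero_tmul, map_zero]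
    have h1 : (a ᵍ⊗ₜ[k] b : 𝒜 ᵍ⊗[k] 𝒜) = (P a ᵍ⊗ₜ[k] (P b + (B.d (h b) + h (B.d b)))) +
        ((B.d (h a) + h (B.d a)) ᵍ⊗ₜ[k] b) := by
      rw [← hP b, ← gtmul_add_left, ← hP a]
    rw [h1, e1]
    simp only [h0, gtmul_add_left, gtmul_add_right, gtmul_smul_left]
    simp only [neg_smul]
    abel

/-- The Künneth theorem in the form required. Up to a boundary, `Δ a - 1 ⊗ a` may be replaced by its
image under P ⊗ P, which lives in bidegree (0, 0) because P vanishes in negative degrees.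
Contracting that image with any functional is, up to P, contracting `a` with a closed functional, so
membership in the filtration passes to the right tensor factor. Only the right factor is controlled,
which suffices for left contractions. -/
theorem comul_decomposition (hneg : ∀ n < 0, ∀ a ∈ 𝒜 n, B.d a = 0 → ∃ b, B.d b = a)
    {p : ℕ} {a : T} (ha : a ∈ B.fil (p + 1)) :
    ∃ (τ : T ⊗[k] T) (y : 𝒜 ᵍ⊗[k] 𝒜),
      B.Δ a = (1 ᵍ⊗ₜ[k] a : 𝒜 ᵍ⊗[k] 𝒜) + GradedTensorProduct.of k 𝒜 𝒜 τ + tensorD 𝒜 B.d y ∧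
      τ ∈ LinearMap.range (TensorProduct.map (LinearMap.id : T →ₗ[k] T) (B.fil p).subtype) ∧
      tensorSign 𝒜 (GradedTensorProduct.of k 𝒜 𝒜 τ) = GradedTensorProduct.of k 𝒜 𝒜 τ := by
  obtain ⟨P, h, hP, Pd, dP, Pmem, hmem, Pneg⟩ := B.exists_homotopy hneg
  obtain ⟨hz, hf⟩ := B.mem_fil_succ.mp ha
  set x : 𝒜 ᵍ⊗[k] 𝒜 := B.Δ a - (1 ᵍ⊗ₜ[k] a : 𝒜 ᵍ⊗[k] 𝒜) with hx
  have hdx : tensorD 𝒜 B.d x = 0 := by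
    rw [hx, map_sub, ← B.Δ_d, tensorD_tmul, show B.d a = 0 from hz.2, B.d_one]
    simp [GradedTensorProduct.tmul]
  have hxd : (GradedTensorProduct.of k 𝒜 𝒜).symm x ∈ tensorDeg 𝒜 0 := by
    rw [hx, map_sub]
    exact sub_mem (B.Δ_mem 0 a hz.1)
      (tmul_mem_tensorDeg (add_zero 0) SetLike.GradedOne.one_mem hz.1)
  have hh := B.tensor_homotopy hP Pd dP Pmem hmem x
  rw [hdx, map_zero, add_zero] at hh
  obtain ⟨y, hy⟩ : ∃ y, x = gEnd 𝒜 (TensorProduct.map P P) x + tensorD 𝒜 B.d y := ⟨_, hh⟩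
  refine ⟨TensorProduct.map P P ((GradedTensorProduct.of k 𝒜 𝒜).symm x), y, ?_,
    mem_range_of_slice (𝒜 := 𝒜) fun l => ?_, tensorSign_of_mem ?_⟩
  · rw [add_assoc, ← sub_eq_iff_eq_add']
    exact hy
  · let f : T →ₗ[k] k := l ∘ₗ P ∘ₗ degProj 𝒜 0
    have hfc : f ∈ B.closed := by
      refine ⟨fun n b hn hb => ?_, fun b => ?_⟩
      · simp only [f, LinearMap.comp_apply, degProj_of_mem_ne hn hb, map_zero]
      · simp only [f, LinearMap.comp_apply, B.degProj_d, Pd, map_zero]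
    -- Subtracting a multiple of the counit makes the functional vanish at 1; on `a` this has the
    -- same effect as removing `1 ⊗ a` from the coproduct.
    have hfp : f - f 1 • B.ε.toLinearMap ∈ B.pclosed := by
      refine ⟨sub_mem hfc (Submodule.smul_mem _ _ B.ε_mem), ?_⟩
      change f 1 - f 1 • B.ε 1 = 0
      rw [map_one B.ε, smul_eq_mul, mul_one, sub_self]
    have e1 : sliceL l (GradedTensorProduct.of k 𝒜 𝒜 (TensorProduct.map P P
        ((GradedTensorProduct.of k 𝒜 𝒜).symm x))) = P (sliceL f x) := by
      generalize x = x at hxd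
      obtain ⟨x, rfl⟩ := (GradedTensorProduct.of k 𝒜 𝒜).surjective x
      rw [of_symm_of] at hxd ⊢
      induction hxd using tensorDeg_induction with
      | h0 => simp
      | add s t _ _ hs ht => simp only [map_add, hs, ht]
      | hom q b c hb hc =>
        change l (P b) • P c = P (l (P (degProj 𝒜 0 b)) • c)
        rw [map_smul]
        -- The total degree is zero, so unless both factors have degree zero one of them has
        -- negative degree and is killed by P.
        rcases lt_trichotomy q 0 with hq | rfl | hq
        · simp only [Pneg q hq b hb, degProj_of_mem_ne hq.ne hb, map_zero, zero_smul]
        · rw [degProj_of_mem hb]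
        · rw [Pneg (0 - q) (by omega) c hc, smul_zero, smul_zero]
    have e2 : sliceL f x = B.contr (f - f 1 • B.ε.toLinearMap) a := by
      have e3 : f - f 1 • B.ε.toLinearMap = f + (- f 1) • B.ε.toLinearMap := by
        refine LinearMap.ext fun b => ?_
        rw [LinearMap.sub_apply, LinearMap.add_apply, LinearMap.smul_apply, LinearMap.smul_apply,
          neg_smul, sub_eq_add_neg]
      rw [hx, map_sub, ← contr_apply, sliceL_tmul, e3, B.contr_add, B.contr_smul, B.contr_ε,
        neg_smul, sub_eq_add_neg]
    have h3 := hf _ hfp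
    rw [e1, e2]
    -- On a cycle P differs from the identity by a boundary, so it preserves every step of the
    -- filtration.
    generalize B.contr (f - f 1 • B.ε.toLinearMap) a = b at h3
    have hb := B.fil_le_Z p h3
    have h4 := hP b
    rw [show B.d b = 0 from hb.2, map_zero, add_zero] at h4
    have h5 : B.d (h b) ∈ B.Bd := ⟨h b, hmem 0 b hb.1, rfl⟩
    rw [eq_sub_of_add_eq h4.symm]
    exact sub_mem h3 (B.Bd_le_fil p h5)
  · rw [of_symm_of]
    generalize (GradedTensorProduct.of k 𝒜 𝒜).symm x = t at hxd
    induction hxd using tensorDeg_induction with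
    | h0 => rw [map_zero]; exact zero_mem _
    | add s t _ _ hs ht => rw [map_add]; exact add_mem hs ht
    | hom q b c hb hc =>
      rw [TensorProduct.map_tmul]
      exact tmul_mem_tensorDeg (by omega) (Pmem q b hb) (Pmem _ c hc)

end CocommDGBialgebra

/-! ### Multiplicativity of the coradical filtration -/

namespace CocommDGBialgebra

open GradedTensorProduct

variable {k : Type u} [Field k] {T : Type v} [Ring T] [Algebra k T]
  {𝒜 : ℤ → Submodule k T} [GradedAlgebra 𝒜] (B : CocommDGBialgebra 𝒜)

theorem tensorD_tensorD (x : 𝒜 ᵍ⊗[k] 𝒜) : tensorD 𝒜 B.d (tensorD 𝒜 B.d x) = 0 := by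
  induction x using gtensor_induction with
  | add x y hx hy => simp only [map_add, hx, hy, add_zero]
  | tmul i j a b ha hb =>
    rw [tensorD_tmul, map_add, tensorD_tmul, tensorD_tmul, algSign_of_mem ha,
      algSign_of_mem (B.d_mem i a ha), map_smul, koszulSign_sub_one]
    simp only [B.d_d, gtmul_smul_left, map_smul]
    have h0 : ∀ y : T, ((0 : T) ᵍ⊗ₜ[k] y : 𝒜 ᵍ⊗[k] 𝒜) = 0 := fun y => by
      rw [GradedTensorProduct.tmul, TensorProduct.zero_tmul, map_zero]
    have h1 : ∀ y : T, (y ᵍ⊗ₜ[k] (0 : T) : 𝒜 ᵍ⊗[k] 𝒜) = 0 := fun y => by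
      rw [GradedTensorProduct.tmul, TensorProduct.tmul_zero, map_zero]
    simp only [h0, h1, smul_zero, neg_smul]
    abel

/-- Since the right factors of `x` have degree zero, the product in the graded tensor square carries
no sign and the right factors simply multiply. -/
theorem sliceL_mul_mem {M N : Submodule k T} (hM : M ≤ 𝒜 0) (f : T →ₗ[k] k) {x y : T ⊗[k] T}
    (hx : x ∈ LinearMap.range (TensorProduct.map (LinearMap.id : T →ₗ[k] T) M.subtype))
    (hy : y ∈ LinearMap.range (TensorProduct.map (LinearMap.id : T →ₗ[k] T) N.subtype)) :
    sliceL f (GradedTensorProduct.of k 𝒜 𝒜 x * GradedTensorProduct.of k 𝒜 𝒜 y) ∈ M * N := by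
  obtain ⟨x, rfl⟩ := hx
  obtain ⟨y, rfl⟩ := hy
  induction x using TensorProduct.induction_on with
  | zero => simp
  | add x x' hx hx' => simp only [map_add, add_mul]; exact add_mem hx hx'
  | tmul a b =>
    induction y using TensorProduct.induction_on with
    | zero => simp
    | add x x' hx hx' => simp only [map_add, mul_add]; exact add_mem hx hx'
    | tmul a' b' =>
      rw [TensorProduct.map_tmul, TensorProduct.map_tmul]
      change sliceL f ((a ᵍ⊗ₜ[k] (b : T) : 𝒜 ᵍ⊗[k] 𝒜) * (a' ᵍ⊗ₜ[k] (b' : T) : 𝒜 ᵍ⊗[k] 𝒜)) ∈ M * N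
      rw [gtmul_mul_gtmul_of_mem_zero (hM b.2), sliceL_tmul]
      exact Submodule.smul_mem _ _ (Submodule.mul_mem_mul b.2 b'.2)

/-- Contraction with `f` is a derivation up to boundaries and terms of lower filtration. Multiply
the decompositions `1 ⊗ a + t` and `1 ⊗ b + t'` of the coproducts: `f` kills the product of the
leading terms because `f 1 = 0`, the mixed terms give the two Leibniz summands, and `t * t'` gives
`ρ`. -/
theorem contr_mul
    (hneg : ∀ n < 0, ∀ a ∈ 𝒜 n, B.d a = 0 → ∃ b, B.d b = a)
    {p q : ℕ} {a b : T} (ha : a ∈ B.fil (p + 1)) (hb : b ∈ B.fil (q + 1))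
    {f : T →ₗ[k] k} (hf : f ∈ B.pclosed) : ∃ ρ ∈ B.fil p * B.fil q,
      B.contr f (a * b) - (a * B.contr f b + B.contr f a * b + ρ) ∈ B.Bd := by
  obtain ⟨τ, y, hτ, hτm, hτs⟩ := B.comul_decomposition hneg ha
  obtain ⟨τ', y', hτ', hτm', _⟩ := B.comul_decomposition hneg hb
  have hf1 : f 1 = 0 := hf.2
  have za := B.fil_le_Z _ ha
  have zb := B.fil_le_Z _ hb
  set t := GradedTensorProduct.of k 𝒜 𝒜 τ with ht
  set t' := GradedTensorProduct.of k 𝒜 𝒜 τ' with ht'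
  have hD : ∀ x, sliceL f (tensorD 𝒜 B.d x) = B.d (sliceL f x) :=
    sliceL_tensorD hf.1.1 hf.1.2
  have h1 : sliceL f t = B.contr f a - B.d (sliceL f y) := by
    rw [contr_apply, hτ, map_add, map_add, hD, sliceL_tmul, hf1, zero_smul, zero_add,
      add_sub_cancel_right]
  have h2 : sliceL f t' = B.contr f b - B.d (sliceL f y') := by
    rw [contr_apply, hτ', map_add, map_add, hD, sliceL_tmul, hf1, zero_smul, zero_add,
      add_sub_cancel_right]
  have hdb : tensorD 𝒜 B.d (B.Δ b) = 0 := by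
    rw [← B.Δ_d, show B.d b = 0 from zb.2, map_zero]
  have hda : tensorD 𝒜 B.d (B.Δ a) = 0 := by
    rw [← B.Δ_d, show B.d a = 0 from za.2, map_zero]
  have hU : tensorD 𝒜 B.d ((1 ᵍ⊗ₜ[k] a : 𝒜 ᵍ⊗[k] 𝒜) + t) = 0 := by
    rw [hτ, map_add, B.tensorD_tensorD, add_zero] at hda
    exact hda
  have hS : tensorSign 𝒜 ((1 ᵍ⊗ₜ[k] a : 𝒜 ᵍ⊗[k] 𝒜) + t) = (1 ᵍ⊗ₜ[k] a : 𝒜 ᵍ⊗[k] 𝒜) + t := by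
    rw [map_add, hτs, tensorSign_tmul, algSign_zero SetLike.GradedOne.one_mem, algSign_zero za.1]
  -- The exact parts of the two decompositions stay exact after multiplication, because `Δ b` and `1
  -- ⊗ a + t` are cycles and the latter is fixed by the sign involution.
  have h3 : tensorD 𝒜 B.d y * B.Δ b = tensorD 𝒜 B.d (y * B.Δ b) := by
    rw [tensorD_mul B.d_mem B.leibniz, hdb, mul_zero, add_zero]
  have h4 : ((1 ᵍ⊗ₜ[k] a : 𝒜 ᵍ⊗[k] 𝒜) + t) * tensorD 𝒜 B.d y' =
      tensorD 𝒜 B.d (((1 ᵍ⊗ₜ[k] a : 𝒜 ᵍ⊗[k] 𝒜) + t) * y') := by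
    rw [tensorD_mul B.d_mem B.leibniz, hU, hS, zero_mul, zero_add]
  have hρ := sliceL_mul_mem (𝒜 := 𝒜) (fun x hx => (B.fil_le_Z p hx).1) f hτm hτm'
  refine ⟨_, hρ, ?_⟩
  rw [← ht, ← ht'] at hρ ⊢
  have h5 : B.Δ (a * b) = (1 ᵍ⊗ₜ[k] a : 𝒜 ᵍ⊗[k] 𝒜) * (1 ᵍ⊗ₜ[k] b : 𝒜 ᵍ⊗[k] 𝒜) +
      (1 ᵍ⊗ₜ[k] a : 𝒜 ᵍ⊗[k] 𝒜) * t' + t * (1 ᵍ⊗ₜ[k] b : 𝒜 ᵍ⊗[k] 𝒜) + t * t' +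
      tensorD 𝒜 B.d (((1 ᵍ⊗ₜ[k] a : 𝒜 ᵍ⊗[k] 𝒜) + t) * y') + tensorD 𝒜 B.d (y * B.Δ b) := by
    rw [← h3, ← h4, map_mul, hτ, add_mul]
    congr 1
    rw [hτ']
    noncomm_ring
  have h6 : B.contr f (a * b) - (a * B.contr f b + B.contr f a * b + sliceL f (t * t')) =
      B.d (sliceL f (((1 ᵍ⊗ₜ[k] a : 𝒜 ᵍ⊗[k] 𝒜) + t) * y') + sliceL f (y * B.Δ b) -
        a * sliceL f y' - sliceL f y * b) := by
    rw [contr_apply, h5, map_add, map_add, map_add, map_add, map_add, hD, hD,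
      sliceL_one_gtmul_mul f za.1, sliceL_one_gtmul_mul f za.1, sliceL_mul_one_gtmul, sliceL_tmul,
      hf1, zero_smul, mul_zero, zero_add, h1, h2, map_sub, map_sub, map_add, ← B.mul_d za,
      ← B.d_mul zb, mul_sub, sub_mul]
    abel
  have h7 : B.contr f (a * b) - (a * B.contr f b + B.contr f a * b + sliceL f (t * t')) ∈ B.Z := by
    refine sub_mem (B.contr_Z hf.1 (B.mul_Z za zb)) (add_mem (add_mem
      (B.mul_Z za (B.contr_Z hf.1 zb)) (B.mul_Z (B.contr_Z hf.1 za) zb)) ?_)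
    exact (Submodule.mul_le.mpr fun x hx y hy => B.mul_Z (B.fil_le_Z p hx) (B.fil_le_Z q hy)) hρ
  rw [h6] at h7 ⊢
  exact B.d_mem_Bd h7.1

/-- Induction on the total filtration: by `contr_mul` a contraction of the product is a sum of
products of smaller total filtration. The shift by one in `fil` means that classes of filtration p
and q have product of filtration p + q. -/
theorem mul_mem_fil
    (hneg : ∀ n < 0, ∀ a ∈ 𝒜 n, B.d a = 0 → ∃ b, B.d b = a)
    {p q : ℕ} {a b : T} (ha : a ∈ B.fil (p + 1)) (hb : b ∈ B.fil (q + 1)) :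
    a * b ∈ B.fil (p + q + 1) := by
  induction hn : p + q using Nat.strong_induction_on generalizing p q a b with
  | _ n ih =>
    -- Index zero means a boundary, and boundaries are absorbed by multiplication with cycles; for
    -- positive indices the induction hypothesis applies.
    have ih' : ∀ p' q', p' + q' < p + q + 2 → ∀ x ∈ B.fil p', ∀ y ∈ B.fil q',
        p' + q' ≤ p + q + 1 → x * y ∈ B.fil (p + q) := by
      intro p' q' h1 x hx y hy h2
      cases p' with
      | zero => exact B.Bd_le_fil _ (B.Bd_mul_Z hx (B.fil_le_Z _ hy))
      | succ p' =>
        cases q' with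
        | zero => exact B.Bd_le_fil _ (B.Z_mul_Bd (B.fil_le_Z _ hx) hy)
        | succ q' =>
          exact B.fil_mono (by omega) (ih (p' + q') (by omega) hx hy rfl)
    rw [← hn]
    refine B.mem_fil_succ.mpr ⟨B.mul_Z (B.fil_le_Z _ ha) (B.fil_le_Z _ hb), fun f hf => ?_⟩
    obtain ⟨ρ, hρ, h⟩ := B.contr_mul hneg ha hb hf
    have h' := B.Bd_le_fil (p + q) h
    rw [← sub_add_cancel (B.contr f (a * b)) (a * B.contr f b + B.contr f a * b + ρ)]
    refine add_mem h' (add_mem (add_mem ?_ ?_) ?_)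
    · exact ih' (p + 1) q (by omega) a ha _ (B.contr_fil hf hb) (by omega)
    · exact ih' p (q + 1) (by omega) _ (B.contr_fil hf ha) b hb (by omega)
    · exact (Submodule.mul_le.mpr fun x hx y hy =>
        ih' p q (by omega) x hx y hy (by omega)) hρ

/-- The truncated subtraction is harmless: if `p` or `q` is zero, the product is itself a boundary.
-/
theorem fil_mul_fil_le
    (hneg : ∀ n < 0, ∀ a ∈ 𝒜 n, B.d a = 0 → ∃ b, B.d b = a)
    (p q : ℕ) : B.fil p * B.fil q ≤ B.fil (p + q - 1) := by
  refine Submodule.mul_le.mpr fun x hx y hy => ?_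
  cases p with
  | zero => exact B.Bd_le_fil _ (B.Bd_mul_Z hx (B.fil_le_Z _ hy))
  | succ p =>
    cases q with
    | zero => exact B.Bd_le_fil _ (B.Z_mul_Bd (B.fil_le_Z _ hx) hy)
    | succ q => exact B.fil_mono (by omega) (B.mul_mem_fil hneg hx hy)

theorem contr_pow_mem {f : T →ₗ[k] k} (hf : f ∈ B.pclosed) {p : ℕ} {a : T} (ha : a ∈ B.fil p)
    (n : ℕ) : (B.contr f ^ n) a ∈ B.fil (p - n) := by
  induction n with
  | zero => exact ha
  | succ n ih =>
    rw [pow_succ', Module.End.mul_apply, ← Nat.sub_sub]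
    exact B.contr_fil hf ih

/-- On the associated graded of the coradical filtration contractions act as derivations. -/
theorem contr_pow_mul
    (hneg : ∀ n < 0, ∀ a ∈ 𝒜 n, B.d a = 0 → ∃ b, B.d b = a)
    {p q : ℕ} {a b : T} (ha : a ∈ B.fil (p + 1)) (hb : b ∈ B.fil (q + 1))
    {f : T →ₗ[k] k} (hf : f ∈ B.pclosed) :
    (B.contr f ^ (p + q)) (a * b) -
      ((p + q).choose p : k) • ((B.contr f ^ p) a * (B.contr f ^ q) b) ∈ B.Bd := by
  induction hn : p + q generalizing p q a b with
  | zero =>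
    obtain ⟨rfl, rfl⟩ : p = 0 ∧ q = 0 := by omega
    simp
  | succ n ih =>
    obtain ⟨ρ, hρ, h⟩ := B.contr_mul hneg ha hb hf
    -- The error term lies in step p + q - 1 = n of the filtration, so the remaining `n`
    -- contractions turn it into a boundary.
    have hρ' := B.contr_pow_mem hf (B.fil_mul_fil_le hneg p q hρ) n
    rw [show p + q - 1 - n = 0 by omega] at hρ'
    have h' := B.contr_pow_mem hf (p := 0) h n
    rw [Nat.zero_sub] at h'
    have e1 : (B.contr f ^ n) (a * B.contr f b) -
        ((n.choose p : k)) • ((B.contr f ^ p) a * (B.contr f ^ q) b) ∈ B.Bd := by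
      cases q with
      | zero =>
        have hb0 : B.contr f b ∈ B.Bd := B.contr_fil hf hb
        rw [Nat.choose_eq_zero_of_lt (by omega), Nat.cast_zero, zero_smul, sub_zero]
        have := B.contr_pow_mem hf (p := 0) (B.Z_mul_Bd (B.fil_le_Z _ ha) hb0) n
        rwa [Nat.zero_sub] at this
      | succ q =>
        rw [pow_succ (B.contr f) q, Module.End.mul_apply]
        exact ih ha (B.contr_fil hf hb) (by omega)
    -- For p = 0 the truncated `p - 1` would give the coefficient 1 instead of 0; the extra factor
    -- corrects this, so that `e3` is Pascal's rule for all p.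
    have e2 : (B.contr f ^ n) (B.contr f a * b) -
        ((n.choose (p - 1) : k) * if p = 0 then 0 else 1) •
          ((B.contr f ^ p) a * (B.contr f ^ q) b) ∈ B.Bd := by
      cases p with
      | zero =>
        have ha0 : B.contr f a ∈ B.Bd := B.contr_fil hf ha
        rw [if_pos rfl, mul_zero, zero_smul, sub_zero]
        have := B.contr_pow_mem hf (p := 0) (B.Bd_mul_Z ha0 (B.fil_le_Z _ hb)) n
        rwa [Nat.zero_sub] at this
      | succ p =>
        rw [pow_succ (B.contr f) p, Module.End.mul_apply, if_neg (by omega), mul_one,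
          Nat.add_sub_cancel]
        exact ih (B.contr_fil hf ha) hb (by omega)
    have e3 : (((n + 1).choose p : ℕ) : k) =
        (n.choose p : k) + (n.choose (p - 1) : k) * if p = 0 then 0 else 1 := by
      cases p with
      | zero => simp
      | succ p =>
        rw [Nat.choose_succ_succ, if_neg (by omega), mul_one, Nat.add_sub_cancel, Nat.cast_add,
          add_comm]
    rw [e3, pow_succ, Module.End.mul_apply]
    have e4 := add_mem (add_mem (add_mem h' hρ') e1) e2
    refine (congrArg (· ∈ B.Bd) ?_).mpr e4
    simp only [map_sub, map_add, add_smul]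
    abel

end CocommDGBialgebra

/-! ### Polarization and the absence of idempotents -/

theorem Submodule.mem_of_forall_sum_pow_smul_mem {k : Type*} [Field k] [Infinite k] {T : Type*}
    [AddCommGroup T] [Module k T] (N : Submodule k T) (n : ℕ) (x : ℕ → T)
    (h : ∀ t : k, ∑ i ∈ Finset.range n, t ^ i • x i ∈ N) {i : ℕ} (hi : i < n) : x i ∈ N := by
  by_contra hx
  -- A functional that kills `N` but not `x i` turns the hypothesis into a polynomial vanishing at
  -- every point of an infinite field, while its coefficient at `i` is nonzero.
  obtain ⟨φ, hφ, hN⟩ := Submodule.exists_le_ker_of_notMem hx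
  let p : Polynomial k := ∑ i ∈ Finset.range n, Polynomial.monomial i (φ (x i))
  have hp : p = 0 := Polynomial.funext fun t => by
    have := hN (h t)
    rw [LinearMap.mem_ker, map_sum] at this
    simp only [p, Polynomial.eval_finsetSum, Polynomial.eval_monomial, Polynomial.eval_zero]
    rw [← this]
    exact Finset.sum_congr rfl fun i _ => by rw [map_smul, smul_eq_mul, mul_comm]
  refine hφ ?_
  have h2 : p.coeff i = φ (x i) := by
    simp [p, Polynomial.coeff_monomial, hi]
  rw [← h2, hp, Polynomial.coeff_zero]

namespace CocommDGBialgebra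

open GradedTensorProduct

variable {k : Type u} [Field k] {T : Type v} [Ring T] [Algebra k T]
  {𝒜 : ℤ → Submodule k T} [GradedAlgebra 𝒜] (B : CocommDGBialgebra 𝒜)

/-- The definition of the filtration involves contractions with different functionals, but powers of
a single contraction detect it, as a symmetric multilinear form is determined by its diagonal in
characteristic zero. -/
theorem mem_fil_of_contr_pow [CharZero k] (p : ℕ) {a : T} (ha : a ∈ B.Z)
    (h : ∀ f ∈ B.pclosed, (B.contr f ^ p) a ∈ B.Bd) : a ∈ B.fil p := by
  induction p generalizing a with
  | zero => exact h 0 (zero_mem _)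
  | succ p ih =>
    refine B.mem_fil_succ.mpr ⟨ha, fun g hg => ih (B.contr_Z hg.1 ha) fun f hf => ?_⟩
    have hc : Commute (B.contr g) (B.contr f) :=
      LinearMap.ext fun a => (B.contr_contr hg.1 f a).symm
    let x : ℕ → T := fun i => ((p + 1).choose i : k) • (B.contr g ^ i * B.contr f ^ (p + 1 - i)) a
    -- `x i` is the coefficient of t^i when the hypothesis is applied to the functional t g + f. The
    -- linear coefficient is (p + 1) times the contraction once with g and p times with f.
    have hx : x 1 ∈ B.Bd := by
      refine B.Bd.mem_of_forall_sum_pow_smul_mem (p + 2) x (fun t => ?_) (by omega)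
      refine (congrArg (· ∈ B.Bd) ?_).mpr
        (h (t • g + f) (add_mem (Submodule.smul_mem _ t hg) hf))
      have e : B.contr (t • g + f) = t • B.contr g + B.contr f := LinearMap.ext fun a => by
        rw [contr_add, contr_smul]; rfl
      rw [e, (hc.smul_left t).add_pow, LinearMap.sum_apply]
      refine Finset.sum_congr rfl fun i _ => ?_
      rw [smul_pow, smul_mul_assoc, smul_mul_assoc, LinearMap.smul_apply, ← nsmul_eq_mul',
        LinearMap.smul_apply, ← Nat.cast_smul_eq_nsmul k]
    have hx' : x 1 = ((p + 1 : ℕ) : k) • (B.contr f ^ p) (B.contr g a) := by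
      simp only [x, Nat.choose_one_right, pow_one, Nat.add_sub_cancel]
      rw [(hc.pow_right p).eq, Module.End.mul_apply]
    rw [hx'] at hx
    exact (Submodule.smul_mem_iff _ (Nat.cast_ne_zero.mpr p.succ_ne_zero)).mp hx

/-- The homology in degree zero of a cocommutative conilpotent dg bialgebra in characteristic zero
has no nontrivial augmented idempotent. -/
theorem mem_Bd_of_idempotent [CharZero k]
    (hneg : ∀ n < 0, ∀ a ∈ 𝒜 n, B.d a = 0 → ∃ b, B.d b = a)
    {z : T} (hz : z ∈ B.Z) (hε : B.ε z = 0) (hi : z * z - z ∈ B.Bd) : z ∈ B.Bd := by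
  -- Descent: an idempotent class of positive filtration has smaller filtration.
  have key : ∀ p, z ∈ B.fil (p + 1) → z ∈ B.fil 1 := by
    intro p
    induction p with
    | zero => exact id
    | succ p ih =>
      intro hp
      refine ih (B.mem_fil_of_contr_pow _ hz fun f hf => ?_)
      have h1 := B.contr_pow_mul hneg hp hp hf
      have h2 := B.contr_pow_mem hf (p := 0) hi (p + 1 + (p + 1))
      -- Twice p + 1 contractions are at least p + 2, so they send z to a boundary. As z² - z is a
      -- boundary, the same holds for z².
      have h3 := B.contr_pow_mem hf hp (p + 1 + (p + 1))
      rw [show p + 1 + 1 - (p + 1 + (p + 1)) = 0 by omega] at h3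
      rw [map_sub, Nat.zero_sub] at h2
      have h4 := sub_mem (add_mem h2 h3) h1
      rw [sub_add_cancel, sub_sub_cancel] at h4
      have h5 := (Submodule.smul_mem_iff _ (Nat.cast_ne_zero.mpr
        (Nat.choose_pos (Nat.le_add_right (p + 1) (p + 1))).ne')).mp h4
      have h6 := B.contr_pow_mem hf hp (p + 1)
      rw [Nat.add_sub_cancel_left] at h6
      -- After p + 1 contractions z is a scalar c modulo boundaries; its square is a boundary, and
      -- applying the augmentation gives c² = 0.
      obtain ⟨c, hc⟩ := B.mem_fil_one h6
      set w := (B.contr f ^ (p + 1)) z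
      have e1 : B.ε w = c := by
        have := B.ε_Bd hc
        rw [map_sub, map_smul, map_one, smul_eq_mul, mul_one] at this
        exact sub_eq_zero.mp this
      have e2 := B.ε_Bd h5
      rw [map_mul, e1, mul_self_eq_zero] at e2
      rwa [e2, zero_smul, sub_zero] at hc
  obtain ⟨p, hp⟩ := B.exists_mem_fil hz
  obtain ⟨c, hc⟩ := B.mem_fil_one (key p (B.fil_le_succ p hp))
  have := B.ε_Bd hc
  rw [map_sub, hε, map_smul, map_one, smul_eq_mul, mul_one, zero_sub, neg_eq_zero] at this
  rwa [this, zero_smul, sub_zero] at hc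

end CocommDGBialgebra

/-! ### The cobar construction of a cocommutative coalgebra as a dg bialgebra -/

theorem tensor_graded_induction {k : Type u} [CommRing k] {V : Type v} [AddCommGroup V] [Module k V]
    {gr : ℤ → Submodule k V} (h : DirectSum.IsInternal gr) {P : V ⊗[k] V → Prop}
    (tmul : ∀ i j a b, a ∈ gr i → b ∈ gr j → P (a ⊗ₜ b))
    (add : ∀ x y, P x → P y → P (x + y)) (x : V ⊗[k] V) : P x := by
  induction x using TensorProduct.induction_on with
  | zero => simpa using tmul 0 0 0 0 (zero_mem _) (zero_mem _)
  | add x y hx hy => exact add x y hx hy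
  | tmul a b =>
    induction a using graded_induction h with
    | add a a' ha ha' => rw [TensorProduct.add_tmul]; exact add _ _ ha ha'
    | hom i a ha =>
      induction b using graded_induction h with
      | add b b' hb hb' => rw [TensorProduct.tmul_add]; exact add _ _ hb hb'
      | hom j b hb => exact tmul i j a b ha hb

namespace DGC

open GradedTensorProduct

variable {k : Type u} [Field k] (C : DGC.{u, v} k)

noncomputable instance : GradedAlgebra C.cobarGr where
  toGradedMonoid := C.cobarGr_gradedMonoid
  toDecomposition := C.cobarGr_isInternal.chooseDecomposition

/-- The graded tensor square of the cobar construction. -/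
abbrev cobarSq : Type (max u v) := C.cobarGr ᵍ⊗[k] C.cobarGr

theorem algSign_cobarGr (a : C.cobarAlg) : algSign C.cobarGr a = C.cobarSign a := by
  induction a using graded_alg_induction (𝒜 := C.cobarGr) with
  | hom n a ha => rw [algSign_of_mem ha, C.cobarSign_of_mem ha]
  | add a b ha hb => rw [map_add, map_add, ha, hb]

theorem cobar_word_induction {P : C.cobarAlg → Prop} (one : P 1)
    (gen_mul : ∀ n x w, x ∈ C.barGr n → P w → P (C.gen x * w))
    (add : ∀ a b, P a → P b → P (a + b)) (smul : ∀ (c : k) a, P a → P (c • a))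
    (a : C.cobarAlg) : P a := by
  induction a using graded_alg_induction (𝒜 := C.cobarGr) with
  | add a b ha hb => exact add a b ha hb
  | hom n a ha =>
    induction ha using cobarGr_induction with
    | word w hw =>
      induction hw with
      | one => exact one
      | cons hx hw ih => exact gen_mul _ _ _ hx ih
    | zero => simpa using smul 0 1 one
    | add a b _ _ ha hb => exact add a b ha hb
    | smul c a _ ha => exact smul c a ha

/-- The shuffle coproduct on the cobar construction, for which the generators are primitive. -/
noncomputable def cobarComul : C.cobarAlg →ₐ[k] C.cobarSq :=
  TensorAlgebra.lift k ((includeLeft C.cobarGr C.cobarGr).toLinearMap ∘ₗ C.gen +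
    (includeRight C.cobarGr C.cobarGr).toLinearMap ∘ₗ C.gen)

theorem cobarComul_gen (x : C.bar) : C.cobarComul (C.gen x) =
    (C.gen x ᵍ⊗ₜ[k] (1 : C.cobarAlg) : C.cobarSq) +
      ((1 : C.cobarAlg) ᵍ⊗ₜ[k] C.gen x : C.cobarSq) := by
  rw [cobarComul, TensorAlgebra.lift_ι_apply]
  rfl

theorem gen_gtmul_mul (x : C.cobarAlg) (a b : C.cobarAlg) :
    (x ᵍ⊗ₜ[k] (1 : C.cobarAlg) : C.cobarSq) * (a ᵍ⊗ₜ[k] b : C.cobarSq) =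
      ((x * a) ᵍ⊗ₜ[k] b : C.cobarSq) := by
  rw [gtmul_mul_gtmul_of_mem_zero SetLike.GradedOne.one_mem, one_mul]

theorem one_gtmul_gen_mul {n i : ℤ} {x a : C.cobarAlg} (hx : x ∈ C.cobarGr n)
    (ha : a ∈ C.cobarGr i) (b : C.cobarAlg) :
    ((1 : C.cobarAlg) ᵍ⊗ₜ[k] x : C.cobarSq) * (a ᵍ⊗ₜ[k] b : C.cobarSq) =
      koszulSign k (n * i) • (a ᵍ⊗ₜ[k] (x * b) : C.cobarSq) := by
  rw [gtmul_mul_gtmul _ _ hx ha, one_mul]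

theorem cobarComul_mem {n : ℤ} {a : C.cobarAlg} (ha : a ∈ C.cobarGr n) :
    (GradedTensorProduct.of k C.cobarGr C.cobarGr).symm (C.cobarComul a) ∈
      tensorDeg C.cobarGr n := by
  induction ha using cobarGr_induction with
  | word w hw =>
    induction hw with
    | one =>
      rw [map_one]
      exact tmul_mem_tensorDeg (add_zero 0) C.cobarGr_one C.cobarGr_one
    | @cons m n x w hx hw ih =>
      rw [map_mul, cobarComul_gen]
      obtain ⟨y, hy⟩ := (GradedTensorProduct.of k C.cobarGr C.cobarGr).surjective (C.cobarComul w)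
      rw [← hy] at ih ⊢
      rw [of_symm_of] at ih
      clear hy hw
      induction ih using tensorDeg_induction with
      | h0 => rw [map_zero, mul_zero, map_zero]; exact zero_mem _
      | add s t _ _ hs ht =>
        rw [map_add, mul_add, map_add]
        exact add_mem hs ht
      | hom p a b ha hb =>
        change (GradedTensorProduct.of k C.cobarGr C.cobarGr).symm
          (_ * (a ᵍ⊗ₜ[k] b : C.cobarSq)) ∈ _
        have hg := C.cobarGr_gen hx
        rw [add_mul, gen_gtmul_mul, C.one_gtmul_gen_mul hg ha, map_add, map_smul]
        exact add_mem (tmul_mem_tensorDeg (by ring) (C.cobarGr_mul hg ha) hb)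
          (Submodule.smul_mem _ _ (tmul_mem_tensorDeg (by ring) ha (C.cobarGr_mul hg hb)))
  | zero => simp
  | add a b _ _ ha hb => rw [map_add, map_add]; exact add_mem ha hb
  | smul c a _ ha => rw [map_smul, map_smul]; exact Submodule.smul_mem _ c ha

theorem tensorSign_cobarComul (a : C.cobarAlg) :
    tensorSign C.cobarGr (C.cobarComul a) = C.cobarComul (algSign C.cobarGr a) := by
  induction a using graded_alg_induction (𝒜 := C.cobarGr) with
  | add a b ha hb => simp only [map_add, ha, hb]
  | hom n a ha =>
    rw [algSign_of_mem ha, map_smul]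
    have h := C.cobarComul_mem ha
    obtain ⟨y, hy⟩ := (GradedTensorProduct.of k C.cobarGr C.cobarGr).surjective (C.cobarComul a)
    rw [← hy] at h ⊢
    rw [of_symm_of] at h
    clear hy
    induction h using tensorDeg_induction with
    | h0 => simp
    | add s t _ _ hs ht => simp only [map_add, smul_add, hs, ht]
    | hom p a b ha hb =>
      change tensorSign C.cobarGr (a ᵍ⊗ₜ[k] b : C.cobarSq) = _ • (a ᵍ⊗ₜ[k] b : C.cobarSq)
      rw [tensorSign_tmul, algSign_of_mem ha, algSign_of_mem hb, gtmul_smul_left,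
        gtmul_smul_right, smul_smul, ← koszulSign_add, add_sub_cancel]

theorem gradedSwap_barComul (hC : C.IsCocommutative) (x : C.bar) :
    gradedSwap C.barGr_isInternal (C.barComul x) = C.barComul x := by
  obtain ⟨x, rfl⟩ := Submodule.mkQ_surjective _ x
  rw [barComul_proj]
  nth_rewrite 2 [← hC x]
  generalize (Coalgebra.comul x : C.carrier ⊗[k] C.carrier) = t
  induction t using tensor_graded_induction C.isInternal with
  | add s t hs ht => simp only [map_add, hs, ht]
  | tmul i j a b ha hb =>
    rw [gradedSwap_tmul _ ha hb, map_smul, TensorProduct.map_tmul, TensorProduct.map_tmul,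
      gradedSwap_tmul _ (Submodule.mem_map_of_mem ha) (Submodule.mem_map_of_mem hb)]

/-- A product of two primitive elements fails to be primitive by its cross terms. After desuspension
these cross terms are the difference of `t` and its graded interchange, so they cancel exactly when
`t` is symmetric. -/
theorem cobarComul_quadratic (t : C.bar ⊗[k] C.bar) :
    C.cobarComul (LinearMap.mul' k _ (TensorProduct.map (C.gen ∘ₗ C.barSign) C.gen t)) =
      (LinearMap.mul' k _ (TensorProduct.map (C.gen ∘ₗ C.barSign) C.gen t) ᵍ⊗ₜ[k]
        (1 : C.cobarAlg) : C.cobarSq) +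
      ((1 : C.cobarAlg) ᵍ⊗ₜ[k]
        LinearMap.mul' k _ (TensorProduct.map (C.gen ∘ₗ C.barSign) C.gen t) : C.cobarSq) +
      (GradedTensorProduct.of k C.cobarGr C.cobarGr
          (TensorProduct.map (C.gen ∘ₗ C.barSign) C.gen t) -
        GradedTensorProduct.of k C.cobarGr C.cobarGr (TensorProduct.map (C.gen ∘ₗ C.barSign) C.gen
          (gradedSwap C.barGr_isInternal t))) := by
  induction t using tensor_graded_induction C.barGr_isInternal with
  | add s t hs ht =>
    simp only [map_add, gtmul_add_left, gtmul_add_right, hs, ht]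
    abel
  | tmul i j a b ha hb =>
    rw [gradedSwap_tmul _ ha hb]
    simp only [map_smul, TensorProduct.map_tmul, LinearMap.mul'_apply, LinearMap.comp_apply,
      C.barSign_of_mem ha, C.barSign_of_mem hb, map_mul, cobarComul_gen,
      gtmul_smul_left, gtmul_smul_right, ← TensorProduct.smul_tmul']
    change _ = _ + (_ • (C.gen a ᵍ⊗ₜ[k] C.gen b : C.cobarSq) -
      _ • _ • (C.gen b ᵍ⊗ₜ[k] C.gen a : C.cobarSq))
    rw [add_mul, mul_add, mul_add, gen_gtmul_mul, gen_gtmul_mul,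
      C.one_gtmul_gen_mul (C.cobarGr_gen ha) (C.cobarGr_gen hb),
      C.one_gtmul_gen_mul (C.cobarGr_gen ha) C.cobarGr_one, mul_one, mul_zero,
      koszulSign_zero, one_smul, smul_add, smul_add, smul_add, smul_smul, smul_smul]
    -- The interchange sign of the desuspended generators differs from that of the original elements
    -- by (-1)^(i+j+1); the minus sign is what produces cancellation instead of doubling.
    have e : koszulSign k i * koszulSign k ((i - 1) * (j - 1)) =
        - (koszulSign k (i * j) * koszulSign k j) := by
      rw [← koszulSign_add, ← koszulSign_add, ← koszulSign_sub_one,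
        show i * j + j - 1 = (i + (i - 1) * (j - 1)) + ((j - 1) + (j - 1)) by ring,
        koszulSign_add _ (j - 1 + (j - 1)), koszulSign_add (j - 1), koszulSign_mul_self, mul_one]
    rw [e, neg_smul]
    abel

/-- The place where cocommutativity enters. Both sides obey the same twisted Leibniz rule, so
generators suffice. There the linear part of the differential is primitive, and so is the quadratic
part by `cobarComul_quadratic` and the symmetry of the reduced coproduct. -/
theorem cobarComul_cobarD (hC : C.IsCocommutative) (a : C.cobarAlg) :
    C.cobarComul (C.cobarD a) = tensorD C.cobarGr C.cobarD (C.cobarComul a) := by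
  have h0 : ∀ a : C.cobarAlg, (a ᵍ⊗ₜ[k] (0 : C.cobarAlg) : C.cobarSq) = 0 := fun a => by
    rw [GradedTensorProduct.tmul, TensorProduct.tmul_zero, map_zero]
  have h0' : ∀ a : C.cobarAlg, ((0 : C.cobarAlg) ᵍ⊗ₜ[k] a : C.cobarSq) = 0 := fun a => by
    rw [GradedTensorProduct.tmul, TensorProduct.zero_tmul, map_zero]
  have h1 : tensorD C.cobarGr C.cobarD (1 : C.cobarSq) = 0 := by
    change tensorD C.cobarGr C.cobarD ((1 : C.cobarAlg) ᵍ⊗ₜ[k] (1 : C.cobarAlg) : C.cobarSq) = 0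
    rw [tensorD_tmul, cobarD_one, h0, h0', add_zero]
  induction a using TensorAlgebra.induction with
  | algebraMap r =>
    rw [cobarD_algebraMap, map_zero, AlgHom.commutes, Algebra.algebraMap_eq_smul_one, map_smul, h1,
      smul_zero]
  | ι x =>
    change C.cobarComul (C.cobarD (C.gen x)) = tensorD C.cobarGr C.cobarD (C.cobarComul (C.gen x))
    rw [cobarComul_gen, map_add, tensorD_tmul, tensorD_tmul, cobarD_one, h0, h0', cobarD_gen,
      algSign_zero C.cobarGr_one, cobarDGen_apply, map_add, map_neg, cobarComul_gen,
      cobarComul_quadratic, C.gradedSwap_barComul hC, sub_self, add_zero, add_zero, zero_add,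
      gtmul_add_left, gtmul_add_right, GradedTensorProduct.tmul, GradedTensorProduct.tmul,
      GradedTensorProduct.tmul, GradedTensorProduct.tmul, GradedTensorProduct.tmul,
      GradedTensorProduct.tmul, TensorProduct.neg_tmul, TensorProduct.tmul_neg, map_neg, map_neg]
    abel
  | mul a b ha hb =>
    rw [cobarD_mul, map_add, map_mul, map_mul, map_mul,
      tensorD_mul (fun _ _ h => C.cobarD_mem h) (fun a b => by rw [cobarD_mul, algSign_cobarGr]),
      ha, hb, tensorSign_cobarComul, algSign_cobarGr]
  | add a b ha hb => simp only [map_add, ha, hb]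

theorem comm_cobarComul (a : C.cobarAlg) :
    GradedTensorProduct.comm C.cobarGr C.cobarGr (C.cobarComul a) = C.cobarComul a := by
  suffices h : (GradedTensorProduct.comm C.cobarGr C.cobarGr).toAlgHom.comp C.cobarComul =
      C.cobarComul from AlgHom.congr_fun h a
  refine TensorAlgebra.hom_ext (LinearMap.ext fun x => ?_)
  change GradedTensorProduct.comm C.cobarGr C.cobarGr (C.cobarComul (C.gen x)) =
    C.cobarComul (C.gen x)
  induction x using graded_induction C.barGr_isInternal with
  | add x y hx hy => simp only [map_add, hx, hy]
  | hom n x hx =>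
    have hg := C.cobarGr_gen hx
    rw [cobarComul_gen, map_add, comm_gtmul hg C.cobarGr_one, comm_gtmul C.cobarGr_one hg,
      zero_mul, mul_zero, koszulSign_zero, one_smul, one_smul, add_comm]

/-- The operator `a ↦ (-1)^(n|a|) a` on the cobar construction. -/
noncomputable def cobarTwist (n : ℤ) : C.cobarAlg →ₗ[k] C.cobarAlg :=
  scaleDeg C.cobarGr_isInternal (fun i => koszulSign k (n * i))

theorem cobarTwist_of_mem (n : ℤ) {i : ℤ} {a : C.cobarAlg} (ha : a ∈ C.cobarGr i) :
    C.cobarTwist n a = koszulSign k (n * i) • a := scaleDeg_of_mem _ _ ha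

/-- The generator acts on the left factor, where it is absorbed into the functional, or on the right
factor, after passing the left one at the cost of the sign in `cobarTwist`. This recursion replaces
explicit shuffle sums in the proofs below. -/
theorem sliceL_gen_mul {n : ℤ} {x : C.cobarAlg} (hx : x ∈ C.cobarGr n) (f : C.cobarAlg →ₗ[k] k)
    (y : C.cobarSq) :
    sliceL f (((x ᵍ⊗ₜ[k] (1 : C.cobarAlg) : C.cobarSq) +
      ((1 : C.cobarAlg) ᵍ⊗ₜ[k] x : C.cobarSq)) * y) =
      sliceL (f ∘ₗ LinearMap.mulLeft k x) y + x * sliceL (f ∘ₗ C.cobarTwist n) y := by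
  induction y using gtensor_induction with
  | add y z hy hz =>
    simp only [mul_add, map_add, hy, hz]
    abel
  | tmul i j a b ha hb =>
    rw [add_mul, gen_gtmul_mul, C.one_gtmul_gen_mul hx ha, map_add, map_smul, sliceL_tmul,
      sliceL_tmul, sliceL_tmul, sliceL_tmul, LinearMap.comp_apply, LinearMap.comp_apply,
      C.cobarTwist_of_mem n ha, map_smul, LinearMap.mulLeft_apply, mul_smul_comm, smul_smul,
      smul_eq_mul]

theorem sliceR_gen_mul {n : ℤ} {x : C.cobarAlg} (hx : x ∈ C.cobarGr n) (f : C.cobarAlg →ₗ[k] k)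
    (y : C.cobarSq) :
    sliceR f (((x ᵍ⊗ₜ[k] (1 : C.cobarAlg) : C.cobarSq) +
      ((1 : C.cobarAlg) ᵍ⊗ₜ[k] x : C.cobarSq)) * y) =
      x * sliceR f y + C.cobarTwist n (sliceR (f ∘ₗ LinearMap.mulLeft k x) y) := by
  induction y using gtensor_induction with
  | add y z hy hz =>
    simp only [mul_add, map_add, hy, hz]
    abel
  | tmul i j a b ha hb =>
    rw [add_mul, gen_gtmul_mul, C.one_gtmul_gen_mul hx ha, map_add, map_smul, sliceR_tmul,
      sliceR_tmul, sliceR_tmul, sliceR_tmul, LinearMap.comp_apply, map_smul,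
      C.cobarTwist_of_mem n ha, LinearMap.mulLeft_apply, mul_smul_comm, smul_comm (f (x * b))]

theorem sliceL_cobarComul_cobarTwist (n : ℤ) (f : C.cobarAlg →ₗ[k] k) (a : C.cobarAlg) :
    sliceL f (C.cobarComul (C.cobarTwist n a)) =
      C.cobarTwist n (sliceL (f ∘ₗ C.cobarTwist n) (C.cobarComul a)) := by
  induction a using graded_alg_induction (𝒜 := C.cobarGr) with
  | add a b ha hb => simp only [map_add, ha, hb]
  | hom i a ha =>
    rw [C.cobarTwist_of_mem n ha, map_smul, map_smul]
    have h := C.cobarComul_mem ha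
    obtain ⟨y, hy⟩ := (GradedTensorProduct.of k C.cobarGr C.cobarGr).surjective (C.cobarComul a)
    rw [← hy] at h ⊢
    rw [of_symm_of] at h
    clear hy
    induction h using tensorDeg_induction with
    | h0 => simp
    | add s t _ _ hs ht => simp only [map_add, smul_add, hs, ht]
    | hom p a b ha hb =>
      change _ • sliceL f (a ᵍ⊗ₜ[k] b : C.cobarSq) =
        C.cobarTwist n (sliceL (f ∘ₗ C.cobarTwist n) (a ᵍ⊗ₜ[k] b : C.cobarSq))
      rw [sliceL_tmul, sliceL_tmul, LinearMap.comp_apply, C.cobarTwist_of_mem n ha, map_smul,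
        map_smul, C.cobarTwist_of_mem n hb, smul_smul, smul_smul, smul_eq_mul,
        show n * i = n * p + n * (i - p) by ring, koszulSign_add]
      congr 1
      ring

/-- Induction on word length with both functionals varying. A leading generator may go to the first,
middle or last factor of the iterated coproduct; both sides produce these three terms, and each is
an instance of the induction hypothesis. -/
theorem slice_comm_cobarComul (f g : C.cobarAlg →ₗ[k] k) (a : C.cobarAlg) :
    sliceL f (C.cobarComul (sliceR g (C.cobarComul a))) =
      sliceR g (C.cobarComul (sliceL f (C.cobarComul a))) := by
  induction a using cobar_word_induction generalizing f g with
  | one =>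
    rw [map_one]
    change sliceL f (C.cobarComul (g 1 • (1 : C.cobarAlg))) =
      sliceR g (C.cobarComul (f 1 • (1 : C.cobarAlg)))
    rw [map_smul, map_smul, map_smul, map_smul, map_one C.cobarComul]
    exact smul_comm (g 1) (f 1) (1 : C.cobarAlg)
  | add a b ha hb => simp only [map_add, ha, hb]
  | smul c a ha => simp only [map_smul, ha]
  | gen_mul n x w hx ih =>
    have hg := C.cobarGr_gen hx
    have hL : ∀ f w, sliceL f (C.cobarComul (C.gen x * w)) =
        sliceL (f ∘ₗ LinearMap.mulLeft k (C.gen x)) (C.cobarComul w) +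
          C.gen x * sliceL (f ∘ₗ C.cobarTwist (n - 1)) (C.cobarComul w) := fun f w => by
      rw [map_mul, cobarComul_gen, C.sliceL_gen_mul hg]
    have hR : ∀ f w, sliceR f (C.cobarComul (C.gen x * w)) =
        C.gen x * sliceR f (C.cobarComul w) + C.cobarTwist (n - 1)
          (sliceR (f ∘ₗ LinearMap.mulLeft k (C.gen x)) (C.cobarComul w)) := fun f w => by
      rw [map_mul, cobarComul_gen, C.sliceR_gen_mul hg]
    rw [hR, hL, map_add, map_add, hL, sliceL_cobarComul_cobarTwist, map_add, map_add, hR, ih, ih,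
      ih, add_assoc]

theorem sliceL_cobarAug (a : C.cobarAlg) :
    sliceL C.cobarAug.toLinearMap (C.cobarComul a) = a := by
  induction a using cobar_word_induction with
  | one =>
    rw [map_one]
    change C.cobarAug 1 • (1 : C.cobarAlg) = 1
    rw [map_one, one_smul]
  | add a b ha hb => simp only [map_add, ha, hb]
  | smul c a ha => simp only [map_smul, ha]
  | gen_mul n x w hx ih =>
    rw [map_mul, cobarComul_gen, C.sliceL_gen_mul (C.cobarGr_gen hx)]
    have h1 : C.cobarAug.toLinearMap ∘ₗ LinearMap.mulLeft k (C.gen x) = 0 := LinearMap.ext fun a => by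
      change C.cobarAug (C.gen x * a) = 0
      rw [map_mul, cobarAug_gen, zero_mul]
    have h2 : C.cobarAug.toLinearMap ∘ₗ C.cobarTwist (n - 1) = C.cobarAug.toLinearMap := by
      refine LinearMap.ext fun a => ?_
      induction a using graded_alg_induction (𝒜 := C.cobarGr) with
      | add a b ha hb => rw [map_add, map_add, ha, hb]
      | hom i a ha =>
        rw [LinearMap.comp_apply, C.cobarTwist_of_mem _ ha, map_smul]
        change _ • C.cobarAug a = C.cobarAug a
        by_cases hi : i = 0
        · rw [hi, mul_zero, koszulSign_zero, one_smul]
        · rw [C.cobarAug_of_mem hi ha, smul_zero]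
    have h3 : ∀ y : C.cobarSq, sliceL 0 y = 0 := fun y => by
      have := sliceL_smul (0 : k) (0 : C.cobarAlg →ₗ[k] k) y
      rwa [zero_smul, zero_smul] at this
    rw [h1, h2, h3, ih, zero_add]

theorem annFil_le_succ (r : ℕ) : annFil C.cobarComul r ≤ annFil C.cobarComul (r + 1) := by
  induction r with
  | zero => exact bot_le
  | succ r ih =>
    intro a ha
    rw [annFil, Submodule.mem_iInf] at ha ⊢
    exact fun f => ih (ha f)

/-- By induction on `r`, multiplication by a primitive generator raises the filtration by at most
one, so a word is killed by one contraction more than its length. -/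
theorem gen_mul_annFil {n : ℤ} {x : C.bar} (hx : x ∈ C.barGr n) (r : ℕ) {w : C.cobarAlg}
    (hw : w ∈ annFil C.cobarComul r) : C.gen x * w ∈ annFil C.cobarComul (r + 1) := by
  induction r generalizing w with
  | zero =>
    rw [annFil, Submodule.mem_bot] at hw
    rw [hw, mul_zero]
    exact zero_mem _
  | succ r ih =>
    have hw' := hw
    rw [annFil, Submodule.mem_iInf] at hw ⊢
    rintro ⟨f, hf⟩
    change sliceL f (C.cobarComul (C.gen x * w)) ∈ annFil C.cobarComul (r + 1)
    rw [map_mul, cobarComul_gen, C.sliceL_gen_mul (C.cobarGr_gen hx)]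
    refine add_mem ?_ (ih (hw ⟨f ∘ₗ C.cobarTwist (n - 1), ?_⟩))
    · have e : f ∘ₗ LinearMap.mulLeft k (C.gen x) = f (C.gen x) • C.cobarAug.toLinearMap +
          (f ∘ₗ LinearMap.mulLeft k (C.gen x) - f (C.gen x) • C.cobarAug.toLinearMap) := by abel
      rw [e, sliceL_add, sliceL_smul, sliceL_cobarAug]
      refine add_mem (Submodule.smul_mem _ _ hw') (C.annFil_le_succ r (hw ⟨_, ?_⟩))
      simp [LinearMap.mulLeft_apply]
    · rw [LinearMap.comp_apply, C.cobarTwist_of_mem _ C.cobarGr_one, mul_zero, koszulSign_zero,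
        one_smul, hf]

theorem exists_mem_annFil (a : C.cobarAlg) : ∃ r, a ∈ annFil C.cobarComul r := by
  have hm : Monotone (annFil C.cobarComul) := monotone_nat_of_le_succ C.annFil_le_succ
  induction a using cobar_word_induction with
  | one =>
    refine ⟨1, ?_⟩
    rw [annFil, Submodule.mem_iInf]
    rintro ⟨f, hf⟩
    change sliceL f (C.cobarComul 1) ∈ annFil C.cobarComul 0
    rw [map_one]
    change f 1 • (1 : C.cobarAlg) ∈ annFil C.cobarComul 0
    rw [hf, zero_smul]
    exact zero_mem _
  | gen_mul n x w hx ih =>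
    obtain ⟨r, hr⟩ := ih
    exact ⟨r + 1, C.gen_mul_annFil hx r hr⟩
  | add a b ha hb =>
    obtain ⟨r, hr⟩ := ha
    obtain ⟨s, hs⟩ := hb
    exact ⟨max r s, add_mem (hm (le_max_left _ _) hr) (hm (le_max_right _ _) hs)⟩
  | smul c a ha =>
    obtain ⟨r, hr⟩ := ha
    exact ⟨r, Submodule.smul_mem _ c hr⟩

/-- The cobar construction of a cocommutative dg coalgebra as a cocommutative dg bialgebra. -/
noncomputable def cobarBialgebra (hC : C.IsCocommutative) : CocommDGBialgebra C.cobarGr where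
  d := C.cobarD
  d_mem _ _ ha := C.cobarD_mem ha
  d_d := C.cobarD_cobarD
  leibniz a b := by rw [cobarD_mul, algSign_cobarGr]
  ε := C.cobarAug
  ε_of_mem _ _ hn ha := C.cobarAug_of_mem hn ha
  ε_d := C.cobarAug_cobarD
  Δ := C.cobarComul
  Δ_d := C.cobarComul_cobarD hC
  Δ_mem _ _ ha := C.cobarComul_mem ha
  counit := C.sliceL_cobarAug
  comm_Δ := C.comm_cobarComul
  slice_comm := C.slice_comm_cobarComul
  conilpotent := C.exists_mem_annFil

end DGC

/-! ### Augmented idempotents as a quasi-isomorphism invariant -/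

namespace DGA

variable {k : Type u} [CommRing k]

section

variable (A : DGA.{u, v} k)

theorem map_mem_cycles {A B : DGA.{u, v} k} (f : A ⟶ B) {n : ℤ} {a : A.carrier}
    (ha : a ∈ A.cycles n) : Hom.toAlgHom f a ∈ B.cycles n :=
  ⟨Hom.map_mem f n a ha.1, by
    rw [SetLike.mem_coe, LinearMap.mem_ker, ← Hom.map_d f, show A.d a = 0 from ha.2, map_zero]⟩

theorem map_mem_boundaries {A B : DGA.{u, v} k} (f : A ⟶ B) {n : ℤ} {a : A.carrier}
    (ha : a ∈ A.boundaries n) : Hom.toAlgHom f a ∈ B.boundaries n := by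
  obtain ⟨c, hc, rfl⟩ := ha
  exact ⟨_, Hom.map_mem f _ c hc, (Hom.map_d f c).symm⟩

theorem IsQuasiIso.mem_boundaries {A B : DGA.{u, v} k} {f : A ⟶ B} (hf : IsQuasiIso f) {n : ℤ}
    {a : A.carrier} (ha : a ∈ A.cycles n) (h : Hom.toAlgHom f a ∈ B.boundaries n) :
    a ∈ A.boundaries n := by
  have h0 : homologyMap f n (Submodule.Quotient.mk ⟨a, ha⟩) = 0 := by
    rw [homologyMap, Submodule.mapQ_apply, Submodule.Quotient.mk_eq_zero]
    exact h
  have h1 := (hf n).1 (h0.trans (map_zero _).symm)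
  rwa [Submodule.Quotient.mk_eq_zero] at h1

theorem IsQuasiIso.exists_lift {A B : DGA.{u, v} k} {f : A ⟶ B} (hf : IsQuasiIso f) {n : ℤ}
    {b : B.carrier} (hb : b ∈ B.cycles n) :
    ∃ a ∈ A.cycles n, Hom.toAlgHom f a - b ∈ B.boundaries n := by
  obtain ⟨q, hq⟩ := (hf n).2 (Submodule.Quotient.mk ⟨b, hb⟩)
  obtain ⟨⟨a, ha⟩, rfl⟩ := Submodule.Quotient.mk_surjective _ q
  rw [homologyMap, Submodule.mapQ_apply, Submodule.Quotient.eq] at hq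
  exact ⟨a, ha, hq⟩

theorem mul_mem_boundaries_right {a b : A.carrier} (ha : a ∈ A.cycles 0)
    (hb : b ∈ A.boundaries 0) : a * b ∈ A.boundaries 0 := by
  obtain ⟨c, hc, rfl⟩ := hb
  refine ⟨a * c, ?_, ?_⟩
  · simpa using A.mul_mem _ _ _ _ ha.1 hc
  · rw [A.leibniz 0 a c ha.1, show A.d a = 0 from ha.2, koszulSign_zero, one_smul, zero_mul, zero_add]

theorem mul_mem_boundaries_left {a b : A.carrier} (ha : a ∈ A.boundaries 0)
    (hb : b ∈ A.cycles 0) : a * b ∈ A.boundaries 0 := by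
  obtain ⟨c, hc, rfl⟩ := ha
  refine ⟨c * b, ?_, ?_⟩
  · simpa using A.mul_mem _ _ _ _ hc hb.1
  · rw [A.leibniz _ c b hc, show A.d b = 0 from hb.2, mul_zero, smul_zero, add_zero]

theorem mul_mem_cycles {a b : A.carrier} (ha : a ∈ A.cycles 0) (hb : b ∈ A.cycles 0) :
    a * b ∈ A.cycles 0 :=
  ⟨by simpa using A.mul_mem _ _ _ _ ha.1 hb.1, by
    rw [SetLike.mem_coe, LinearMap.mem_ker, A.leibniz 0 a b ha.1, show A.d a = 0 from ha.2,
      show A.d b = 0 from hb.2, zero_mul, mul_zero, smul_zero, add_zero]⟩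

theorem aug_boundaries {n : ℤ} {a : A.carrier} (ha : a ∈ A.boundaries n) : A.aug a = 0 := by
  obtain ⟨c, _, rfl⟩ := ha
  exact A.aug_d c

/-- The homology is concentrated in nonnegative degrees and its augmentation ideal in degree zero
contains a nonzero idempotent. -/
def HasAugmentedIdempotent : Prop :=
  (∀ n < 0, A.cycles n ≤ A.boundaries n) ∧
    ∃ z ∈ A.cycles 0, A.aug z = 0 ∧ z * z - z ∈ A.boundaries 0 ∧ z ∉ A.boundaries 0

end

theorem IsQuasiIso.hasAugmentedIdempotent_iff {A B : DGA.{u, v} k} {f : A ⟶ B}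
    (hf : IsQuasiIso f) : A.HasAugmentedIdempotent ↔ B.HasAugmentedIdempotent := by
  constructor
  · rintro ⟨hneg, z, hz, hε, hi, hn⟩
    refine ⟨fun n h0 b hb => ?_, Hom.toAlgHom f z, map_mem_cycles f hz, ?_, ?_, ?_⟩
    · obtain ⟨a, ha, hab⟩ := hf.exists_lift hb
      have := sub_mem (map_mem_boundaries f (hneg n h0 ha)) hab
      rwa [sub_sub_cancel] at this
    · rw [Hom.map_aug f, hε]
    · rw [← map_mul, ← map_sub]
      exact map_mem_boundaries f hi
    · exact fun h => hn (hf.mem_boundaries hz h)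
  · rintro ⟨hneg, z, hz, hε, hi, hn⟩
    obtain ⟨a, ha, haz⟩ := hf.exists_lift hz
    refine ⟨fun n h0 b hb => hf.mem_boundaries hb (hneg n h0 (map_mem_cycles f hb)), a, ha, ?_,
      ?_, ?_⟩
    · have := B.aug_boundaries haz
      rw [map_sub, Hom.map_aug f, hε, sub_zero] at this
      exact this
    · refine hf.mem_boundaries (sub_mem (A.mul_mem_cycles ha ha) ha) ?_
      rw [map_sub, map_mul]
      have h1 := B.mul_mem_boundaries_left haz (map_mem_cycles f ha)
      have h2 := B.mul_mem_boundaries_right hz haz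
      -- With e = f(a) - z a boundary, f(a)² - f(a) = e f(a) + z e + (z² - z) - e.
      have h3 := add_mem (add_mem h1 h2) (sub_mem hi haz)
      refine (congrArg (· ∈ B.boundaries 0) ?_).mpr h3
      noncomm_ring
    · intro h
      have := sub_mem (map_mem_boundaries f h) haz
      rw [sub_sub_cancel] at this
      exact hn this

end DGA

namespace DGC

/-- The invariant is defined for every dg algebra, so the intermediate coalgebras of the zig-zag
need not be cocommutative. -/
theorem OmegaQuasiIsomorphic.hasAugmentedIdempotent_iff {k : Type u} [CommRing k]
    {C D : DGC.{u, v} k} (h : OmegaQuasiIsomorphic C D) :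
    C.cobarObj.HasAugmentedIdempotent ↔ D.cobarObj.HasAugmentedIdempotent := by
  induction h with
  | rel C D h => exact h.choose_spec.hasAugmentedIdempotent_iff
  | refl C => exact Iff.rfl
  | symm C D _ ih => exact ih.symm
  | trans C D E _ _ h1 h2 => exact h1.trans h2

theorem IsCocommutative.not_hasAugmentedIdempotent {k : Type u} [Field k] [CharZero k]
    {C : DGC.{u, v} k} (hC : C.IsCocommutative) : ¬ C.cobarObj.HasAugmentedIdempotent := by
  rintro ⟨hneg, z, hz, hε, hi, hn⟩
  refine hn ((C.cobarBialgebra hC).mem_Bd_of_idempotent (fun n h0 a ha hd => ?_) hz hε hi)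
  obtain ⟨b, _, hb⟩ := hneg n h0 ⟨ha, hd⟩
  exact ⟨b, hb⟩

end DGC

/-! ### Characters and connectivity of the cobar construction -/

namespace DGC

variable {k : Type u} [CommRing k] (C : DGC.{u, v} k)

/-- A twisting cochain with values in `k` induces an algebra map out of the cobar construction that
vanishes on boundaries. -/
theorem lift_cobarD_eq_zero (φ : C.bar →ₗ[k] k)
    (hφ : ∀ x, φ (C.barD x) =
      LinearMap.mul' k k (TensorProduct.map (φ ∘ₗ C.barSign) φ (C.barComul x)))
    (a : C.cobarAlg) : TensorAlgebra.lift k φ (C.cobarD a) = 0 := by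
  induction a using TensorAlgebra.induction with
  | algebraMap r => rw [cobarD_algebraMap, map_zero]
  | ι x =>
    change TensorAlgebra.lift k φ (C.cobarD (C.gen x)) = 0
    rw [cobarD_gen, cobarDGen_apply, map_add, map_neg, TensorAlgebra.lift_ι_apply, hφ,
      neg_add_eq_zero]
    generalize C.barComul x = t
    induction t using TensorProduct.induction_on with
    | zero => simp only [map_zero]
    | tmul a b =>
      simp only [TensorProduct.map_tmul, LinearMap.mul'_apply, LinearMap.comp_apply, map_mul,
        TensorAlgebra.lift_ι_apply]
    | add s t hs ht => simp only [map_add, hs, ht]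
  | mul a b ha hb => rw [cobarD_mul, map_add, map_mul, map_mul, ha, hb, zero_mul, mul_zero, add_zero]
  | add a b ha hb => rw [map_add, map_add, ha, hb, add_zero]

/-- If the reduced coalgebra lives in positive degrees, desuspended generators have degree at least
zero, and hence so do all nonzero words. -/
theorem cobarGr_eq_bot (h : ∀ n ≤ 0, C.barGr n = ⊥) {n : ℤ} (hn : n < 0) : C.cobarGr n = ⊥ := by
  have key : ∀ n w, C.IsWord n w → w = 0 ∨ 0 ≤ n := by
    intro n w hw
    induction hw with
    | one => exact Or.inr le_rfl
    | @cons m n x w hx hw ih =>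
      rcases ih with rfl | ih
      · exact Or.inl (mul_zero _)
      · by_cases hm : m ≤ 0
        · rw [h m hm, Submodule.mem_bot] at hx
          exact Or.inl (by rw [hx, map_zero, zero_mul])
        · exact Or.inr (by omega)
  rw [cobarGr, Submodule.span_eq_bot]
  intro w hw
  exact (key n w hw).resolve_right (by omega)

end DGC

/-! ### The cobar construction on chains of a reduced simplicial set -/

namespace NormChains

variable (k : Type u) [Field k] {S : SSet.{w}}

theorem cell_skip {n : ℕ} (x : Simplex S (n + 1)) (i : Fin (n + 2)) :
    cell k x n (skip i) = cls k n (S.δ i x) := by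
  change _ = cls k n (S.map (SimplexCategory.δ i).op x)
  rw [cls_map]
  refine cell_congr k x rfl fun j hj => ?_
  simp only [fn, Nat.lt_succ_of_le hj, dif_pos, skip]
  change _ = ((Fin.succAbove i ⟨j, Nat.lt_succ_of_le hj⟩ : Fin (n + 2)) : ℕ)
  simp only [Fin.succAbove, Fin.lt_def, Fin.val_castSucc]
  split_ifs <;> rfl

/-- The cochain `c - 1` for a function `c` on `1`-simplices. -/
noncomputable def oneCochain (c : Simplex S 1 → k) (hc : ∀ x ∈ S.degenerate 1, c x = 1) :
    Carrier k S →ₗ[k] k :=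
  lift (fun n => match n with
    | 1 => fun x => c x - 1
    | _ => fun _ => 0) (by
    rintro (_ | _ | n) x hx
    · rfl
    · exact sub_eq_zero.mpr (hc x hx)
    · rfl)

variable {k} {c : Simplex S 1 → k} (hc : ∀ x ∈ S.degenerate 1, c x = 1)

theorem oneCochain_cls (x : Simplex S 1) : oneCochain k c hc (cls k 1 x) = c x - 1 :=
  lift_cls _ _ _ _

theorem oneCochain_cls_of_ne {n : ℕ} (hn : n ≠ 1) (x : Simplex S n) :
    oneCochain k c hc (cls k n x) = 0 := by
  refine (lift_cls _ _ _ _).trans ?_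
  match n, hn with
  | 0, _ => rfl
  | 1, h => exact absurd rfl h
  | n + 2, _ => rfl

theorem oneCochain_cell_of_ne {n m : ℕ} (hm : m ≠ 1) (x : Simplex S n) (f : ℕ → ℕ) :
    oneCochain k c hc (cell k x m f) = 0 := by
  by_cases hf : Valid m n f
  · rw [cell, dif_pos hf, oneCochain_cls_of_ne hc hm]
  · rw [cell, dif_neg hf, map_zero]

/-- A multiplicative function c on edges gives a twisting cochain c - 1: on a triangle, c₀ - c₂c₀ +
c₂ - 1 = -(c₂ - 1)(c₀ - 1). In the group algebra picture an edge γ is the generator γ - 1 of the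
cobar construction, and the resulting character is c. -/
theorem oneCochain_d (h : ∀ τ : Simplex S 2, c (S.δ 1 τ) = c (S.δ 2 τ) * c (S.δ 0 τ))
    (a : Carrier k S) : oneCochain k c hc (d k S a) =
      LinearMap.mul' k k (TensorProduct.map (oneCochain k c hc ∘ₗ signInv (isInternal k))
        (oneCochain k c hc) (comul k S a)) := by
  suffices H : oneCochain k c hc ∘ₗ d k S = LinearMap.mul' k k ∘ₗ
      TensorProduct.map (oneCochain k c hc ∘ₗ signInv (isInternal k)) (oneCochain k c hc) ∘ₗ
        comul k S from LinearMap.congr_fun H a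
  refine hom_ext fun n x => ?_
  simp only [LinearMap.comp_apply, d_cls, comul_cls, diag_eq, map_sum, TensorProduct.map_tmul,
    LinearMap.mul'_apply, signInv_cell, map_smul]
  by_cases hn : n = 2
  · subst hn
    rw [bdry_succ, map_sum, Finset.sum_range_succ, Finset.sum_range_succ, Finset.sum_range_one,
      Finset.sum_range_succ, Finset.sum_range_succ, Finset.sum_range_one,
      oneCochain_cell_of_ne hc (m := 0) (by omega) x (fun j => j),
      oneCochain_cell_of_ne hc (m := 2) (by omega) x (fun j => j),
      cell_congr k x (m := 1) (f := fun j => j) (g := skip 2) rfl (fun j hj => by simp only [skip]; split_ifs <;> omega),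
      cell_congr k x (m := 2 - 1) (m' := 1) (f := fun j => 1 + j) (g := skip 0) (by omega)
        (fun j hj => by simp only [skip]; split_ifs <;> omega)]
    have e := fun i => cell_skip k x i
    have e0 : cell k x 1 (skip 0) = cls k 1 (S.δ 0 x) := e 0
    have e1 : cell k x 1 (skip 1) = cls k 1 (S.δ 1 x) := e 1
    have e2 : cell k x 1 (skip 2) = cls k 1 (S.δ 2 x) := e 2
    simp only [map_smul, e0, e1, e2, oneCochain_cls, h x, smul_eq_mul]
    ring
  · rw [Finset.sum_eq_zero]
    · match n, hn with
      | 0, _ => exact map_zero _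
      | n + 1, hn =>
        rw [bdry_succ, map_sum]
        exact Finset.sum_eq_zero fun i _ => by
          rw [map_smul, oneCochain_cell_of_ne hc (by omega), smul_zero]
    · intro p hp
      rw [Finset.mem_range] at hp
      by_cases h1 : p = 1
      · rw [oneCochain_cell_of_ne hc (m := n - p) (by omega), mul_zero]
      · rw [oneCochain_cell_of_ne hc (m := p) h1, smul_zero, zero_mul]

variable [Subsingleton (Simplex S 0)] (b : Simplex S 0)

/-- The generator of the cobar construction determined by a chain. -/
noncomputable def cobarGen : Carrier k S →ₗ[k] (dgc k S b).cobarAlg :=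
  (dgc k S b).gen ∘ₗ (dgc k S b).proj

theorem cobarD_cobarGen (a : Carrier k S) :
    (dgc k S b).cobarD (cobarGen b a) = -(cobarGen b (d k S a)) + LinearMap.mul' k _
      (TensorProduct.map (cobarGen b ∘ₗ signInv (isInternal k)) (cobarGen b) (comul k S a)) := by
  refine ((dgc k S b).cobarD_gen _).trans (((dgc k S b).cobarDGen_apply _).trans ?_)
  change -(cobarGen b (d k S a)) + LinearMap.mul' k _
    (TensorProduct.map _ _ (TensorProduct.map _ _ (comul k S a))) = _
  congr 2
  generalize comul k S a = t
  induction t using TensorProduct.induction_on with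
  | zero => exact (congrArg _ (map_zero _)).trans ((map_zero _).trans (map_zero _).symm)
  | add s t hs ht => exact (congrArg _ (map_add _ _ _)).trans ((map_add _ _ _).trans
      ((congrArg₂ (· + ·) hs ht).trans (map_add _ _ _).symm))
  | tmul a a' =>
    change (dgc k S b).gen ((dgc k S b).barSign ((dgc k S b).proj a)) ⊗ₜ[k] cobarGen b a' =
      cobarGen b (signInv (isInternal k) a) ⊗ₜ[k] cobarGen b a'
    exact congrArg (fun y => (dgc k S b).gen y ⊗ₜ[k] cobarGen b a') ((dgc k S b).barSign_proj a)

theorem proj_cls_zero (x : Simplex S 0) : (dgc k S b).proj (cls k 0 x) = 0 := by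
  rw [Subsingleton.elim x b]
  exact (dgc k S b).proj_one

theorem cobarGen_cell_zero {n : ℕ} (x : Simplex S n) (f : ℕ → ℕ) :
    cobarGen b (cell k x 0 f) = 0 := by
  by_cases hf : Valid 0 n f
  · rw [cell, dif_pos hf]
    exact (congrArg (dgc k S b).gen (proj_cls_zero b _)).trans (map_zero (dgc k S b).gen)
  · rw [cell, dif_neg hf, map_zero]

theorem barGr_dgc_eq_bot (n : ℤ) (hn : n ≤ 0) : (dgc k S b).barGr n = ⊥ := by
  rw [eq_bot_iff]
  rintro _ ⟨a, ha, rfl⟩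
  change a ∈ gr k S n at ha
  rw [Submodule.mem_bot]
  induction ha using Submodule.span_induction with
  | mem a h =>
    obtain ⟨m, x, hm, rfl⟩ := h
    obtain rfl : m = 0 := by omega
    exact proj_cls_zero b x
  | zero => exact map_zero _
  | add a c _ _ ha hc =>
    exact (map_add (dgc k S b).proj a c).trans ((congrArg₂ (· + ·) ha hc).trans (add_zero 0))
  | smul r a _ ha =>
    exact (map_smul (dgc k S b).proj r a).trans ((congrArg (r • ·) ha).trans (smul_zero r))

/-- The faces of an edge are vertices, and each term of its coproduct contains a vertex; these
vanish in the reduced coalgebra. -/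
theorem cobarD_edge (γ : Simplex S 1) : (dgc k S b).cobarD (cobarGen b (cls k 1 γ)) = 0 := by
  rw [cobarD_cobarGen, d_cls, comul_cls, bdry_succ, diag_eq]
  simp only [map_sum, map_smul, cobarGen_cell_zero, smul_zero, Finset.sum_const_zero, neg_zero,
    zero_add]
  refine Finset.sum_eq_zero fun p hp => ?_
  rw [Finset.mem_range] at hp
  rw [TensorProduct.map_tmul, LinearMap.mul'_apply]
  by_cases h : p = 0
  · subst h
    rw [LinearMap.comp_apply, signInv_cell, map_smul, cobarGen_cell_zero, smul_zero, zero_mul]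
  · obtain rfl : p = 1 := by omega
    rw [cobarGen_cell_zero, mul_zero]

/-- With g standing for γ - 1, the element 2g + g² is γ² - 1, so the triangle witnesses that γ² is
homologous to 1. -/
theorem cobarD_triangle (τ : Simplex S 2) {γ : Simplex S 1} (h0 : S.δ 0 τ = γ)
    (h1 : S.δ 1 τ ∈ S.degenerate 1) (h2 : S.δ 2 τ = γ) :
    (dgc k S b).cobarD (cobarGen b (cls k 2 τ)) =
      -((2 : k) • cobarGen b (cls k 1 γ) +
        cobarGen b (cls k 1 γ) * cobarGen b (cls k 1 γ)) := by
  have e0 : cell k τ 1 (skip 0) = cls k 1 γ := by rw [← h0]; exact cell_skip k τ 0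
  have e1 : cell k τ 1 (skip 1) = 0 := (cell_skip k τ 1).trans (cls_degenerate k h1)
  have e2 : cell k τ 1 (skip 2) = cls k 1 γ := by rw [← h2]; exact cell_skip k τ 2
  rw [cobarD_cobarGen, d_cls, comul_cls, bdry_succ, diag_eq]
  simp only [map_sum, map_smul, TensorProduct.map_tmul, LinearMap.mul'_apply, LinearMap.comp_apply,
    signInv_cell]
  rw [Finset.sum_range_succ, Finset.sum_range_succ, Finset.sum_range_one,
      Finset.sum_range_succ, Finset.sum_range_succ, Finset.sum_range_one,
      cobarGen_cell_zero, cobarGen_cell_zero,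
      cell_congr k τ (m := 1) (f := fun j => j) (g := skip 2) rfl
        (fun j hj => by simp only [skip]; split_ifs <;> omega),
      cell_congr k τ (m := 2 - 1) (m' := 1) (f := fun j => 1 + j) (g := skip 0) (by omega)
        (fun j hj => by simp only [skip]; split_ifs <;> omega), e0, e1, e2]
  simp only [pow_zero, one_smul, map_zero, smul_zero, pow_one, neg_smul, mul_zero, zero_mul,
    add_zero, zero_add, Nat.reduceAdd, neg_one_sq, two_smul, neg_mul]
  abel

theorem hasAugmentedIdempotent [CharZero k] {c : Simplex S 1 → k}
    (hc : ∀ x ∈ S.degenerate 1, c x = 1)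
    (h : ∀ τ : Simplex S 2, c (S.δ 1 τ) = c (S.δ 2 τ) * c (S.δ 0 τ))
    (τ : Simplex S 2) {γ : Simplex S 1} (h0 : S.δ 0 τ = γ)
    (h1 : S.δ 1 τ ∈ S.degenerate 1) (h2 : S.δ 2 τ = γ) (hγ : c γ = -1) :
    (dgc k S b).cobarObj.HasAugmentedIdempotent := by
  have m1 : cobarGen b (cls k 1 γ) ∈ (dgc k S b).cobarGr 0 :=
    (dgc k S b).cobarGr_gen (n := 1) (Submodule.mem_map_of_mem (cls_mem k 1 γ))
  have m2 : cobarGen b (cls k 2 τ) ∈ (dgc k S b).cobarGr (0 + 1) :=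
    (dgc k S b).cobarGr_gen (n := 2) (Submodule.mem_map_of_mem (cls_mem k 2 τ))
  have hD := cobarD_edge (k := k) b γ
  have hT := cobarD_triangle (k := k) b τ h0 h1 h2
  let φ : (dgc k S b).bar →ₗ[k] k := Submodule.liftQ _ (oneCochain k c hc) (by
    rw [Submodule.span_singleton_le_iff_mem]
    exact oneCochain_cls_of_ne hc (by omega) b)
  have hφ : ∀ a : Carrier k S,
      TensorAlgebra.lift k φ (cobarGen b a) = oneCochain k c hc a := fun a =>
    TensorAlgebra.lift_ι_apply _ _
  have hχ : ∀ a, TensorAlgebra.lift k φ ((dgc k S b).cobarD a) = 0 := by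
    refine (dgc k S b).lift_cobarD_eq_zero φ fun x => ?_
    obtain ⟨x, rfl⟩ := Submodule.mkQ_surjective _ x
    refine (oneCochain_d hc h x).trans ?_
    change LinearMap.mul' k k _ = LinearMap.mul' k k
      (TensorProduct.map _ _ (TensorProduct.map _ _ (comul k S x)))
    congr 1
    generalize comul k S x = t
    induction t using TensorProduct.induction_on with
    | zero => exact (map_zero _).trans ((congrArg _ (map_zero _)).trans (map_zero _)).symm
    | add s t hs ht => exact ((congrArg _ (map_add _ _ _)).trans ((map_add _ _ _).trans
      ((congrArg₂ (· + ·) hs.symm ht.symm).trans (map_add _ _ _).symm))).symm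
    | tmul a a' =>
      change oneCochain k c hc (signInv (isInternal k) a) ⊗ₜ[k] oneCochain k c hc a' =
        φ ((dgc k S b).barSign ((dgc k S b).proj a)) ⊗ₜ[k] oneCochain k c hc a'
      exact congrArg (fun y => φ y ⊗ₜ[k] oneCochain k c hc a') ((dgc k S b).barSign_proj a).symm
  set g := cobarGen b (cls k 1 γ) with hg
  -- As g stands for γ - 1, this is (1 - γ)/2.
  refine ⟨fun n hn a ha => ?_, (-(1 / 2) : k) • g, ⟨Submodule.smul_mem _ _ m1, ?_⟩, ?_, ?_, ?_⟩
  · have : a ∈ (dgc k S b).cobarGr n := ha.1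
    rw [(dgc k S b).cobarGr_eq_bot (barGr_dgc_eq_bot b) hn] at this
    have h0 : a = 0 := (Submodule.mem_bot k).mp this
    rw [h0]
    exact zero_mem _
  · change (dgc k S b).cobarD ((-(1 / 2) : k) • g) = 0
    rw [map_smul, hD, smul_zero]
  · change (dgc k S b).cobarAug ((-(1 / 2) : k) • g) = 0
    rw [map_smul, hg]
    exact (congrArg _ ((dgc k S b).cobarAug_gen _)).trans (smul_zero _)
  -- For z = -g/2 one has z² - z = (g² + 2g)/4, which is -1/4 times the differential of the
  -- triangle.
  · refine ⟨(-(1 / 4) : k) • cobarGen b (cls k 2 τ), Submodule.smul_mem _ _ m2, ?_⟩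
    change (dgc k S b).cobarD _ = ((-(1 / 2) : k) • g) * ((-(1 / 2) : k) • g) - (-(1 / 2) : k) • g
    rw [map_smul, hT, smul_mul_smul_comm, smul_neg, smul_add, smul_smul, neg_add,
      ← neg_smul, ← neg_smul, sub_eq_add_neg, ← neg_smul, add_comm]
    congr 2 <;> norm_num
  -- The character vanishes on boundaries but takes g to c(γ) - 1 = -2, hence z to 1.
  · rintro ⟨y, _, hy⟩
    have h3 := hχ y
    change (dgc k S b).cobarD y = _ at hy
    rw [hy, map_smul, hg, hφ, oneCochain_cls, hγ] at h3
    norm_num at h3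

end NormChains

/-! ### The quotient of a punctured vector space by the antipodal map -/

/-- The complement of the origin. -/
abbrev Punctured (E : Type w) [Zero E] : Type w := {v : E // v ≠ 0}

/-- The quotient of the complement of the origin by the antipodal map. -/
abbrev AntipodalQuotient (E : Type w) [AddCommGroup E] : Type w :=
  Quotient (MulAction.orbitRel ℤˣ (Punctured E))

namespace AntipodalQuotient

section

variable {E : Type w} [AddCommGroup E]

/-- The quotient map. -/
abbrev mk (v : Punctured E) : AntipodalQuotient E := Quotient.mk _ v

theorem mk_eq_mk_iff {u v : Punctured E} : mk u = mk v ↔ u.1 = v.1 ∨ u.1 = -v.1 := by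
  rw [Quotient.eq]
  change u ∈ MulAction.orbit ℤˣ v ↔ _
  rw [MulAction.mem_orbit_iff]
  constructor
  · rintro ⟨g, rfl⟩
    rcases Int.units_eq_one_or g with rfl | rfl
    · exact Or.inl (by rw [one_smul])
    · exact Or.inr (by change ((-1 : ℤˣ) : ℤ) • v.1 = -v.1; simp)
  · rintro (h | h)
    · exact ⟨1, Subtype.ext (by rw [one_smul, h])⟩
    · exact ⟨-1, Subtype.ext (by change ((-1 : ℤˣ) : ℤ) • v.1 = u.1; simp [h])⟩

end

theorem ne_zero_of_mem_ball {E : Type w} [NormedAddCommGroup E] {v u : E} (h : u ∈ Metric.ball v ‖v‖) : u ≠ 0 := by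
  rintro rfl
  rw [Metric.mem_ball, dist_zero_left] at h
  exact lt_irrefl _ h

variable (E : Type w) [NormedAddCommGroup E] [NormedSpace ℝ E]

instance : LocallyPathConnectedSpace (Punctured E) :=
  IsOpen.locallyPathConnectedSpace (U := {v : E | v ≠ 0}) isOpen_ne

theorem pathConnectedSpace (h : 1 < Module.rank ℝ E) : PathConnectedSpace (AntipodalQuotient E) := by
  have : PathConnectedSpace (Punctured E) :=
    isPathConnected_iff_pathConnectedSpace.mp (isPathConnected_compl_singleton_of_one_lt_rank h 0)
  infer_instance

instance : LocallyPathConnectedSpace (AntipodalQuotient E) :=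
  inferInstanceAs (LocallyPathConnectedSpace (Quot _))

theorem isCoveringMap [LocallyCompactSpace E] : IsCoveringMap (mk : Punctured E → _) := by
  have : LocallyCompactSpace (Punctured E) :=
    IsOpen.locallyCompactSpace (s := {v : E | v ≠ 0}) isOpen_ne
  have : ContinuousConstSMul ℤˣ (Punctured E) :=
    ⟨fun g => ((continuous_const_smul (g : ℤ)).comp continuous_subtype_val).subtype_mk _⟩
  -- The action is free because v = -v forces v = 0; a finite group acting freely on a locally
  -- compact Hausdorff space gives a covering.
  have : IsCancelSMul ℤˣ (Punctured E) := isCancelSMul_iff_eq_one_of_smul_eq.mpr fun g v h => by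
    rcases Int.units_eq_one_or g with rfl | rfl
    · rfl
    · have h1 : ((-1 : ℤˣ) : ℤ) • v.1 = v.1 := congrArg Subtype.val h
      rw [Units.val_neg, Units.val_one, neg_smul, one_smul] at h1
      have h2 : (2 : ℝ) • v.1 = 0 := by
        rw [two_smul]
        nth_rewrite 1 [← h1]
        exact neg_add_cancel _
      exact absurd ((smul_eq_zero.mp h2).resolve_left two_ne_zero) v.2
  exact (isQuotientCoveringMap_quotientMk_of_properlyDiscontinuousSMul
    (G := ℤˣ) (E := Punctured E)).isCoveringMap

variable {E}

/-- By convexity the ball would contain the midpoint 0 of u and -u. -/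
theorem neg_notMem_ball {v u : E} (h : u ∈ Metric.ball v ‖v‖) : -u ∉ Metric.ball v ‖v‖ := by
  intro h'
  have := (convex_ball v ‖v‖) h h' (by norm_num : (0 : ℝ) ≤ 1 / 2) (by norm_num : (0 : ℝ) ≤ 1 / 2)
    (by norm_num)
  rw [smul_neg, add_neg_cancel] at this
  exact ne_zero_of_mem_ball this rfl

/-- The ball of radius ‖v‖ about v avoids the origin and its own antipode, so a loop in its image
lifts to a loop in the ball. There it contracts by convexity, and the contraction is projected back.
-/
theorem semilocallySimplyConnected [LocallyCompactSpace E] :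
    PtdSpace.SemilocallySimplyConnected (AntipodalQuotient E) := by
  have cov := isCoveringMap E
  intro x
  obtain ⟨v, rfl⟩ := Quotient.exists_rep x
  let B : Set (Punctured E) := Subtype.val ⁻¹' Metric.ball v.1 ‖v.1‖
  let B' : Set (Punctured E) := {u | -u.1 ∈ Metric.ball v.1 ‖v.1‖}
  have hB : IsOpen B := Metric.isOpen_ball.preimage continuous_subtype_val
  have hB' : IsOpen B' := Metric.isOpen_ball.preimage continuous_subtype_val.neg
  have hv : v ∈ B := Metric.mem_ball_self (norm_pos_iff.mpr v.2)
  refine ⟨mk '' B, cov.isOpenMap.image_mem_nhds (hB.mem_nhds hv), fun γ hγ => ?_⟩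
  obtain ⟨Γ, hΓ, hΓ0⟩ := cov.exists_path_lifts γ.toContinuousMap v γ.source
  have hΓ' : ∀ t, mk (Γ t) = γ t := fun t => congrFun hΓ t
  -- The lift stays in the union of the ball and its antipode, which are disjoint and open, and it
  -- starts in the ball.
  have hsub : Set.range Γ ⊆ B := by
    refine IsPreconnected.subset_left_of_subset_union hB hB' ?_ ?_ ⟨v, ⟨0, hΓ0⟩, hv⟩
      (isPreconnected_range Γ.continuous)
    · exact Set.disjoint_left.mpr fun u hu hu' => neg_notMem_ball hu hu'
    · rintro _ ⟨t, rfl⟩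
      obtain ⟨u, hu, h⟩ := hγ ⟨t, rfl⟩
      rw [← hΓ' t, mk_eq_mk_iff] at h
      rcases h with h | h
      · left
        change (Γ t).1 ∈ Metric.ball v.1 ‖v.1‖
        rw [← h]; exact hu
      · right
        change -(Γ t).1 ∈ Metric.ball v.1 ‖v.1‖
        rw [← h]; exact hu
  have h1 : Γ 1 = v := by
    have h : mk (Γ 1) = mk v := (hΓ' 1).trans γ.target
    rw [mk_eq_mk_iff] at h
    rcases h with h | h
    · exact Subtype.ext h
    · have h2 : Γ 1 ∈ B := hsub ⟨1, rfl⟩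
      have h3 := neg_notMem_ball (u := v.1) hv
      rw [← h] at h3
      exact absurd h2 h3
  have : SimplyConnectedSpace (Metric.ball v.1 ‖v.1‖) := by
    have := (convex_ball v.1 ‖v.1‖).contractibleSpace ⟨v.1, hv⟩
    infer_instance
  let i : C(Metric.ball v.1 ‖v.1‖, AntipodalQuotient E) :=
    ⟨fun u => mk ⟨u.1, ne_zero_of_mem_ball u.2⟩, by
      exact cov.continuous.comp (continuous_subtype_val.subtype_mk _)⟩
  let δ : Path (⟨v.1, hv⟩ : Metric.ball v.1 ‖v.1‖) ⟨v.1, hv⟩ :=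
    { toFun := fun t => ⟨(Γ t).1, hsub ⟨t, rfl⟩⟩
      continuous_toFun := (continuous_subtype_val.comp Γ.continuous).subtype_mk _
      source' := Subtype.ext (by change (Γ 0).1 = v.1; rw [hΓ0])
      target' := Subtype.ext (by change (Γ 1).1 = v.1; rw [h1]) }
  have h := (SimplyConnectedSpace.paths_homotopic δ (Path.refl _)).map i
  have e1 : δ.map i.continuous = γ := by
    ext t
    exact hΓ' t
  have e2 : (Path.refl (⟨v.1, hv⟩ : Metric.ball v.1 ‖v.1‖)).map i.continuous =
      Path.refl (mk v) := by
    ext t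
    rfl
  rw [e1, e2] at h
  exact h

end AntipodalQuotient

/-! ### Continuous maps out of standard simplices -/

instance (n : ℕ) : LocallyPathConnectedSpace (stdSimplex ℝ (Fin (n + 1))) :=
  (convex_stdSimplex ℝ _).locallyPathConnectedSpace

instance (n : ℕ) : ContractibleSpace (stdSimplex ℝ (Fin (n + 1))) :=
  (convex_stdSimplex ℝ _).contractibleSpace ⟨_, single_mem_stdSimplex ℝ 0⟩

namespace PtdSpace

variable {X : PtdSpace.{w}}

/-- The continuous map underlying a pointed singular simplex. -/
noncomputable def singMap {n : ℕ} (σ : NormChains.Simplex X.sing.toSSet n) :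
    C(stdSimplex ℝ (Fin (n + 1)), X.space) :=
  X.space.toSSetObjEquiv (op (SimplexCategory.mk n)) σ.1

theorem singMap_vertex {n : ℕ} (σ : NormChains.Simplex X.sing.toSSet n) (i : Fin (n + 1)) :
    singMap σ (stdSimplex.vertex i) = X.pt := σ.2 i

theorem singMap_map {m n : ℕ} (φ : SimplexCategory.mk m ⟶ SimplexCategory.mk n)
    (σ : NormChains.Simplex X.sing.toSSet n) (t : stdSimplex ℝ (Fin (m + 1))) :
    singMap (X.sing.toSSet.map φ.op σ) t = singMap σ (stdSimplex.map φ.toOrderHom t) := rfl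

theorem singMap_δ {n : ℕ} (i : Fin (n + 2)) (σ : NormChains.Simplex X.sing.toSSet (n + 1))
    (t : stdSimplex ℝ (Fin (n + 1))) :
    singMap (X.sing.toSSet.δ i σ : NormChains.Simplex X.sing.toSSet n) t =
      singMap σ (stdSimplex.map (Fin.succAbove i) t) := rfl

theorem singMap_injective {n : ℕ} :
    Function.Injective (singMap (X := X) (n := n)) := fun _ _ h =>
  Subtype.ext ((X.space.toSSetObjEquiv _).injective h)

/-- The pointed singular simplex determined by a continuous map. -/
noncomputable def singOf {n : ℕ} (f : C(stdSimplex ℝ (Fin (n + 1)), X.space))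
    (hf : ∀ i, f (stdSimplex.vertex i) = X.pt) : NormChains.Simplex X.sing.toSSet n :=
  ⟨(X.space.toSSetObjEquiv (op (SimplexCategory.mk n))).symm f, fun i => by
    rw [Equiv.apply_symm_apply]; exact hf i⟩

theorem singMap_singOf {n : ℕ} (f : C(stdSimplex ℝ (Fin (n + 1)), X.space))
    (hf : ∀ i, f (stdSimplex.vertex i) = X.pt) : singMap (singOf f hf) = f :=
  Equiv.apply_symm_apply _ _

theorem degenerate_of_const {σ : NormChains.Simplex X.sing.toSSet 1}
    (h : ∀ t, singMap σ t = X.pt) : σ ∈ X.sing.toSSet.degenerate 1 := by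
  refine ⟨0, by omega, SimplexCategory.σ 0, X.singPt, singMap_injective ?_⟩
  ext t
  rw [singMap_map, h]
  exact DFunLike.congr_fun (Equiv.apply_symm_apply (X.space.toSSetObjEquiv _) _) _

end PtdSpace

/-! ### The monodromy cocycle -/

namespace AntipodalQuotient

/-- A three-dimensional real vector space. -/
abbrev Space3 : Type w := ULift.{w} (Fin 3) → ℝ

/-- The vector with the given coordinates. -/
def vec (x y z : ℝ) : Space3.{w} := fun i => ![x, y, z] i.down

/-- The base point. -/
def base : Punctured Space3.{w} := ⟨vec 1 0 0, fun h => by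
  have := congrFun h ⟨0⟩
  simp [vec] at this⟩

/-- The quotient of a punctured three-dimensional vector space by the antipodal map, which is
homotopy equivalent to the real projective plane. -/
noncomputable def ptd : PtdSpace.{w} where
  space := TopCat.of (AntipodalQuotient Space3.{w})
  pt := mk base
  pathConnected := pathConnectedSpace _ (by
    rw [rank_fun']
    simp)

theorem ptd_hasUniversalCover : PtdSpace.HasUniversalCover ptd.{w} :=
  ⟨inferInstanceAs (LocallyPathConnectedSpace (AntipodalQuotient Space3.{w})),
    semilocallySimplyConnected⟩

section Cocycle

variable (k : Type u) [Field k]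

/-- The sign of the first coordinate. -/
noncomputable def sgn (v : Punctured Space3.{w}) : k := if 0 < v.1 ⟨0⟩ then 1 else -1

variable {k}

theorem sgn_mul_self (v : Punctured Space3.{w}) : sgn k v * sgn k v = 1 := by
  rw [sgn]; split_ifs <;> simp

/-- The point `v` has to lie over the base point, where the first coordinate is 1 or -1; elsewhere
it may vanish, and the sign is then not antipodally odd. -/
theorem sgn_of_neg {u v : Punctured Space3.{w}} (h : u.1 = -v.1) (hv : mk v = mk base) :
    sgn k u = - sgn k v := by
  rw [mk_eq_mk_iff] at hv
  have h1 : u.1 ⟨0⟩ = - v.1 ⟨0⟩ := congrFun h ⟨0⟩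
  rcases hv with hv | hv
  · have h2 : v.1 ⟨0⟩ = 1 := congrFun hv ⟨0⟩
    simp [sgn, h1, h2]
  · have h2 : v.1 ⟨0⟩ = -1 := congrFun hv ⟨0⟩
    rw [sgn, sgn, h1, h2, if_pos (by norm_num), if_neg (by norm_num), neg_neg]

/-- `F` is a lift of the singular simplex `σ`. -/
def IsLift {n : ℕ} (σ : NormChains.Simplex ptd.{w}.sing.toSSet n)
    (F : C(stdSimplex ℝ (Fin (n + 1)), Punctured Space3.{w})) : Prop :=
  ∀ t, mk (F t) = PtdSpace.singMap σ t

theorem exists_isLift {n : ℕ} (σ : NormChains.Simplex ptd.{w}.sing.toSSet n) : ∃ F, IsLift σ F := by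
  obtain ⟨F, ⟨_, hF⟩, _⟩ := (isCoveringMap Space3.{w}).existsUnique_continuousMap_lifts
    (PtdSpace.singMap σ) (stdSimplex.vertex 0) base (PtdSpace.singMap_vertex σ 0).symm
  exact ⟨F, fun t => congrFun hF t⟩

theorem IsLift.mk_vertex {n : ℕ} {σ : NormChains.Simplex ptd.{w}.sing.toSSet n}
    {F : C(stdSimplex ℝ (Fin (n + 1)), Punctured Space3.{w})} (hF : IsLift σ F) (i : Fin (n + 1)) :
    mk (F (stdSimplex.vertex i)) = mk base := (hF _).trans (PtdSpace.singMap_vertex σ i)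

theorem IsLift.map {m n : ℕ} {σ : NormChains.Simplex ptd.{w}.sing.toSSet n}
    {F : C(stdSimplex ℝ (Fin (n + 1)), Punctured Space3.{w})} (hF : IsLift σ F)
    (φ : SimplexCategory.mk m ⟶ SimplexCategory.mk n) :
    IsLift (ptd.{w}.sing.toSSet.map φ.op σ : NormChains.Simplex _ m)
      (F.comp ⟨stdSimplex.map φ.toOrderHom, stdSimplex.continuous_map _⟩) :=
  fun _ => hF _

/-- The monodromy of a loop. -/
noncomputable def monodromy (k : Type u) [Field k]
    (σ : NormChains.Simplex ptd.{w}.sing.toSSet 1) : k :=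
  sgn k ((exists_isLift σ).choose (stdSimplex.vertex 0)) *
    sgn k ((exists_isLift σ).choose (stdSimplex.vertex 1))

/-- By uniqueness of lifts two lifts agree or are antipodal, and in the latter case both endpoint
signs change, so their product does not. -/
theorem IsLift.monodromy_eq {σ : NormChains.Simplex ptd.{w}.sing.toSSet 1}
    {F : C(stdSimplex ℝ (Fin 2), Punctured Space3.{w})} (hF : IsLift σ F) :
    monodromy k σ = sgn k (F (stdSimplex.vertex 0)) * sgn k (F (stdSimplex.vertex 1)) := by
  have cov := isCoveringMap Space3.{w}
  have hG := (exists_isLift σ).choose_spec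
  rw [monodromy]
  generalize (exists_isLift σ).choose = G at hG ⊢
  have h0 : mk (F (stdSimplex.vertex 0)) = mk (G (stdSimplex.vertex 0)) :=
    (hF.mk_vertex 0).trans (hG.mk_vertex 0).symm
  rw [mk_eq_mk_iff] at h0
  rcases h0 with h0 | h0
  · have e : ⇑F = ⇑G := cov.eq_of_comp_eq F.continuous G.continuous
      (funext fun t => (hF t).trans (hG t).symm) _ (Subtype.ext h0)
    rw [e]
  · let G' : stdSimplex ℝ (Fin 2) → Punctured Space3.{w} := fun t =>
      ⟨-(G t).1, neg_ne_zero.mpr (G t).2⟩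
    have hG' : ∀ t, mk (G' t) = mk (G t) := fun t => mk_eq_mk_iff.mpr (Or.inr rfl)
    have e : ⇑F = G' := cov.eq_of_comp_eq F.continuous
      ((continuous_subtype_val.comp G.continuous).neg.subtype_mk _)
      (funext fun t => (hF t).trans ((hG' t).trans (hG t)).symm) _ (Subtype.ext h0)
    rw [e, sgn_of_neg (u := G' _) (v := G _) rfl (hG.mk_vertex 0),
      sgn_of_neg (u := G' _) (v := G _) rfl (hG.mk_vertex 1), neg_mul_neg]

theorem IsLift.monodromy_map {n : ℕ} {σ : NormChains.Simplex ptd.{w}.sing.toSSet n}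
    {F : C(stdSimplex ℝ (Fin (n + 1)), Punctured Space3.{w})} (hF : IsLift σ F)
    (φ : SimplexCategory.mk 1 ⟶ SimplexCategory.mk n) :
    monodromy k (ptd.{w}.sing.toSSet.map φ.op σ) =
      sgn k (F (stdSimplex.vertex (φ.toOrderHom 0))) *
        sgn k (F (stdSimplex.vertex (φ.toOrderHom 1))) := by
  rw [(hF.map φ).monodromy_eq]
  simp only [ContinuousMap.comp_apply, ContinuousMap.coe_mk, stdSimplex.map_vertex]

theorem monodromy_degenerate (σ : NormChains.Simplex ptd.{w}.sing.toSSet 1)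
    (hσ : σ ∈ ptd.{w}.sing.toSSet.degenerate 1) : monodromy k σ = 1 := by
  obtain ⟨m, hm, φ, y, rfl⟩ := hσ
  obtain rfl : m = 0 := by omega
  obtain ⟨F, hF⟩ := exists_isLift y
  rw [hF.monodromy_map φ, Subsingleton.elim (α := Fin 1) (φ.toOrderHom 1) (φ.toOrderHom 0),
    sgn_mul_self]

theorem IsLift.monodromy_δ {τ : NormChains.Simplex ptd.{w}.sing.toSSet 2}
    {F : C(stdSimplex ℝ (Fin 3), Punctured Space3.{w})} (hF : IsLift τ F) (i : Fin 3) :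
    monodromy k (ptd.{w}.sing.toSSet.δ i τ) =
      sgn k (F (stdSimplex.vertex (i.succAbove 0))) *
        sgn k (F (stdSimplex.vertex (i.succAbove 1))) :=
  hF.monodromy_map (SimplexCategory.δ i)

/-- All three edges are computed from one lift of the triangle, and the sign at the middle vertex
occurs twice. -/
theorem monodromy_cocycle (τ : NormChains.Simplex ptd.{w}.sing.toSSet 2) :
    monodromy k (ptd.{w}.sing.toSSet.δ 1 τ) =
      monodromy k (ptd.{w}.sing.toSSet.δ 2 τ) * monodromy k (ptd.{w}.sing.toSSet.δ 0 τ) := by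
  obtain ⟨F, hF⟩ := exists_isLift τ
  rw [hF.monodromy_δ, hF.monodromy_δ, hF.monodromy_δ]
  change sgn k (F (stdSimplex.vertex 0)) * sgn k (F (stdSimplex.vertex 2)) =
    sgn k (F (stdSimplex.vertex 0)) * sgn k (F (stdSimplex.vertex 1)) *
      (sgn k (F (stdSimplex.vertex 1)) * sgn k (F (stdSimplex.vertex 2)))
  rw [mul_assoc, ← mul_assoc (sgn k (F (stdSimplex.vertex 1))), sgn_mul_self, one_mul]

end Cocycle

/-! ### A triangle whose boundary is twice a loop -/

/-- The first two coordinates describe the boundary of the triangle: constant on the edge t₁ = 0,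
and antipodal curves between (1,0,0) and (-1,0,0) on the two others. They vanish together only at
(1/4, 1/2, 1/4), where the third coordinate, zero on the boundary, equals 1/32. Filling the loop
thus needs the third dimension. -/
theorem vec_ne_zero (t : stdSimplex ℝ (Fin 3)) :
    vec.{w} (1 - 2 * t 1) (t 1 * (t 0 - t 2)) (t 0 * t 1 * t 2) ≠ 0 := by
  intro h
  have h0 : 1 - 2 * t 1 = 0 := congrFun h ⟨0⟩
  have h1 : t 1 * (t 0 - t 2) = 0 := congrFun h ⟨1⟩
  have h2 : t 0 * t 1 * t 2 = 0 := congrFun h ⟨2⟩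
  have hs := stdSimplex.sum_eq_one t
  rw [Fin.sum_univ_three] at hs
  have e1 : t 1 = 1 / 2 := by linarith
  rw [e1] at h1 h2 hs
  have e2 : t 0 = t 2 := by linarith
  rw [e2] at h2 hs
  have e3 : t 2 = 1 / 4 := by linarith
  rw [e3] at h2
  norm_num at h2

/-- The lift of the triangle. -/
noncomputable def triangleLift : C(stdSimplex ℝ (Fin 3), Punctured Space3.{w}) where
  toFun t := ⟨vec (1 - 2 * t 1) (t 1 * (t 0 - t 2)) (t 0 * t 1 * t 2), vec_ne_zero t⟩
  continuous_toFun := by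
    have hc : ∀ i, Continuous fun t : stdSimplex ℝ (Fin 3) => t i := fun i =>
      (continuous_apply i).comp continuous_subtype_val
    refine Continuous.subtype_mk (continuous_pi fun i => ?_) _
    have h0 := hc 0
    have h1 := hc 1
    have h2 := hc 2
    obtain ⟨i⟩ := i
    fin_cases i
    · exact continuous_const.sub (continuous_const.mul h1)
    · exact h1.mul (h0.sub h2)
    · exact (h0.mul h1).mul h2

theorem triangleLift_apply (t : stdSimplex ℝ (Fin 3)) :
    (triangleLift.{w} t).1 = vec (1 - 2 * t 1) (t 1 * (t 0 - t 2)) (t 0 * t 1 * t 2) := rfl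

theorem vec_neg (x y z : ℝ) : -vec.{w} x y z = vec (-x) (-y) (-z) := by
  funext j
  obtain ⟨j⟩ := j
  fin_cases j <;> rfl

theorem mk_triangleLift_vertex (i : Fin 3) :
    mk (triangleLift.{w} (stdSimplex.vertex i)) = mk base := by
  rw [mk_eq_mk_iff, triangleLift_apply, base, vec_neg]
  obtain rfl | rfl | rfl : i = 0 ∨ i = 1 ∨ i = 2 := by omega
  · left; congr 1 <;> simp
  · right; congr 1 <;> simp; norm_num
  · left; congr 1 <;> simp

/-- The map underlying the triangle. -/
noncomputable def triangleMap : C(stdSimplex ℝ (Fin 3), AntipodalQuotient Space3.{w}) :=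
  ⟨fun t => mk (triangleLift.{w} t),
    (isCoveringMap Space3.{w}).continuous.comp triangleLift.{w}.continuous⟩

/-- The triangle. -/
noncomputable def triangle : NormChains.Simplex ptd.{w}.sing.toSSet 2 :=
  PtdSpace.singOf (X := ptd.{w}) (n := 2) triangleMap mk_triangleLift_vertex

theorem isLift_triangle : IsLift triangle.{w} triangleLift.{w} := fun t =>
  (DFunLike.congr_fun (PtdSpace.singMap_singOf (X := ptd.{w}) (n := 2) triangleMap
    mk_triangleLift_vertex) t).symm

theorem stdSimplex_map_apply {m n : ℕ} (f : Fin m → Fin n) (t : stdSimplex ℝ (Fin m)) (j : Fin n) :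
    stdSimplex.map f t j = ∑ i with f i = j, t i := by
  rw [stdSimplex.map_coe, FunOnFinite.linearMap_apply_apply]

theorem stdSimplex_map_succAbove_self {n : ℕ} (i : Fin (n + 1)) (t : stdSimplex ℝ (Fin n)) :
    stdSimplex.map i.succAbove t i = 0 := by
  rw [stdSimplex_map_apply]
  refine Finset.sum_eq_zero fun l hl => ?_
  exact absurd (Finset.mem_filter.mp hl).2 (Fin.succAbove_ne i l)

theorem stdSimplex_map_succAbove {n : ℕ} (i : Fin (n + 1)) (t : stdSimplex ℝ (Fin n)) (j : Fin n) :
    stdSimplex.map i.succAbove t (i.succAbove j) = t j := by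
  rw [stdSimplex_map_apply, Finset.sum_eq_single j]
  · intro l hl hne
    exact absurd (Fin.succAbove_right_injective (Finset.mem_filter.mp hl).2) hne
  · intro hl
    simp at hl

/-- In the edge coordinates the two lifts are antipodal because t₀ + t₁ = 1 gives 1 - 2t₁ = -(1 -
2t₀), so they become equal in the quotient. -/
theorem triangle_face_eq :
    (ptd.{w}.sing.toSSet.δ 2 triangle : NormChains.Simplex _ 1) = ptd.{w}.sing.toSSet.δ 0 triangle := by
  refine PtdSpace.singMap_injective (ContinuousMap.ext fun t => ?_)
  rw [PtdSpace.singMap_δ, PtdSpace.singMap_δ, ← isLift_triangle, ← isLift_triangle]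
  refine mk_eq_mk_iff.mpr (Or.inr ?_)
  have hs := stdSimplex.add_eq_one t
  have a0 : stdSimplex.map (Fin.succAbove (2 : Fin 3)) t 0 = t 0 := stdSimplex_map_succAbove 2 t 0
  have a1 : stdSimplex.map (Fin.succAbove (2 : Fin 3)) t 1 = t 1 := stdSimplex_map_succAbove 2 t 1
  have a2 : stdSimplex.map (Fin.succAbove (2 : Fin 3)) t 2 = 0 := stdSimplex_map_succAbove_self 2 t
  have b0 : stdSimplex.map (Fin.succAbove (0 : Fin 3)) t 0 = 0 := stdSimplex_map_succAbove_self 0 t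
  have b1 : stdSimplex.map (Fin.succAbove (0 : Fin 3)) t 1 = t 0 := stdSimplex_map_succAbove 0 t 0
  have b2 : stdSimplex.map (Fin.succAbove (0 : Fin 3)) t 2 = t 1 := stdSimplex_map_succAbove 0 t 1
  rw [triangleLift_apply, triangleLift_apply, a0, a1, a2, b0, b1, b2, vec_neg]
  congr 1
  · linarith
  · ring
  · ring

theorem triangle_face_degenerate :
    ptd.{w}.sing.toSSet.δ 1 triangle ∈ ptd.{w}.sing.toSSet.degenerate 1 := by
  refine PtdSpace.degenerate_of_const fun t => ?_
  rw [PtdSpace.singMap_δ, ← isLift_triangle]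
  refine mk_eq_mk_iff.mpr (Or.inl ?_)
  have a1 : stdSimplex.map (Fin.succAbove (1 : Fin 3)) t 1 = 0 := stdSimplex_map_succAbove_self 1 t
  rw [triangleLift_apply, a1, base]
  congr 1 <;> ring

theorem monodromy_triangle_face (k : Type u) [Field k] :
    monodromy k (ptd.{w}.sing.toSSet.δ 0 triangle) = -1 := by
  rw [isLift_triangle.monodromy_δ]
  have e1 : sgn k (triangleLift.{w} (stdSimplex.vertex 1)) = -1 := by
    refine if_neg ?_
    change ¬ (0 : ℝ) < 1 - 2 * Pi.single (M := fun _ => ℝ) (1 : Fin 3) 1 1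
    rw [Pi.single_eq_same]
    norm_num
  have e2 : sgn k (triangleLift.{w} (stdSimplex.vertex 2)) = 1 := by
    refine if_pos ?_
    change (0 : ℝ) < 1 - 2 * Pi.single (M := fun _ => ℝ) (2 : Fin 3) 1 1
    rw [Pi.single_eq_of_ne (by decide)]
    norm_num
  change sgn k (triangleLift (stdSimplex.vertex 1)) * sgn k (triangleLift (stdSimplex.vertex 2)) = -1
  rw [e1, e2, mul_one]

theorem hasAugmentedIdempotent (k : Type u) [Field k] [CharZero k] :
    (ptd.{w}.chains k).cobarObj.HasAugmentedIdempotent :=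
  NormChains.hasAugmentedIdempotent _ monodromy_degenerate monodromy_cocycle triangle rfl
    triangle_face_degenerate triangle_face_eq (monodromy_triangle_face k)

end AntipodalQuotient

/-! ### The nonexistence theorem -/

theorem mainTheorem2 (k : Type u) [Field k] [CharZero k] :
    (¬ ∃ F : PtdSpace.{w} ⥤ CDGC.{u, max u w} k,
      ∀ X : PtdSpace.{w}, DGC.OmegaQuasiIsomorphic (F.obj X).obj (X.chains k)) ∧
    (¬ ∃ F : PtdSpace.HasUniversalCover.{w}.FullSubcategory ⥤ CDGC.{u, max u w} k,
      ∀ X : PtdSpace.HasUniversalCover.{w}.FullSubcategory,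
        DGC.OmegaQuasiIsomorphic (F.obj X).obj (X.obj.chains k)) := by
  -- Only the value of the functor at one space matters, and that space belongs to both categories.
  have key : ∀ C : CDGC.{u, max u w} k,
      ¬ DGC.OmegaQuasiIsomorphic C.obj (AntipodalQuotient.ptd.{w}.chains k) := fun C h =>
    DGC.IsCocommutative.not_hasAugmentedIdempotent C.property
      (h.hasAugmentedIdempotent_iff.mpr (AntipodalQuotient.hasAugmentedIdempotent k))
  exact ⟨fun ⟨F, hF⟩ => key _ (hF _),
    fun ⟨F, hF⟩ => key _ (hF ⟨_, AntipodalQuotient.ptd_hasUniversalCover⟩)⟩
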